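/- Let $d_s,d_a,d_\phi,d_{\phi'},d_\psi,H,T$ be natural numbers with $H,T\ge 1$, and let $\mathcal S\subset\mathbb R^{d_s}$, $\mathcal A\subset\mathbb R^{d_a}$ be the state and action spaces. Let $\phi_f:\mathcal S\times\mathcal A\to\mathbb R^{d_\phi}$, $\phi_r:\mathcal S\times\mathcal A\to\mathbb R^{d_{\phi'}}$ and $\psi:\mathcal S\to\mathbb R^{d_\psi}$ be known (measurable) feature maps. **Model.** The unknown MDP $M^*=M_w$ is given by weights $w=(w_r,w_1,\dots,w_{d_\psi})$, $w_r\in\mathbb R^{d_{\phi'}}$, $w_j\in\mathbb R^{d_\phi}$. An episode has $H$ steps and starts from $s_1\sim\rho$. In state $s$ under action $a$ the observed reward is $r=\bar r^{M_w}(s,a)+\epsilon_r$ with mean $\bar r^{M_w}(s,a)=\langle w_r,\phi_r(s,a)\rangle$ and $\epsilon_r\sim\mathcal N(0,\sigma_r^2)$, and, independently, the next state $s'$ satisfies $\psi(s')=(\langle w_j,\phi_f(s,a)\rangle)_{j\le d_\psi}+\epsilon_f$ with $\epsilon_f\sim\mathcal N(0,\sigma_f^2 I_{d_\psi})$. Here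 $s'$ is drawn, given the value $z$ of this embedding, from a known probability kernel $D(\cdot\mid z)$ that is concentrated on $\{\psi=z\}$ for Lebesgue-a.e. $z$ and does not depend on $w$ (for invertible $\psi$, $s'=\psi^{-1}(z)$); $\rho$, $D$, $\sigma_r$, $\sigma_f$ are known and $\sigma_r,\sigma_f>0$. The prior (Bayesian linear regression) is $w_r\sim\mathcal N(0,\Sigma_r)$ and $w_1,\dots,w_{d_\psi}\sim\mathcal N(0,\Sigma_f)$, all independent. **Values and policies.** A deterministic policy $\mu$ picks actions $a_i=\mu_i(s_i)$, $V^{M}_{\mu,i}(s)=\mathbb E\big[\sum_{j=i}^{H}\bar r^{M}(s_j,a_j)\mid s_i=s\big]$, and $\mu^{M}$ denotes an optimal policy, i.e. one maximizing $V^M_{\mu,i}(s)$ over all $\mu$, for all $i\le H$ and all $s$. It is assumed that for prior-almost every $w$ such a policy $\mu^{M_w}$ exists, and that it is chosen measurably in $w$. **PSRL.** In episode $k$ let $\mathcal H_k$ be the states, actions and observed rewards of the first $k-1$ episodes. PSRL draws $M^k$ from the posterior distribution of $M^*$ given $\mathcal H_k$ (independently of $M^*$ given $\mathcal H_k$) and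 uses $\mu^k=\mu^{M^k}$ during the episode. Its regret in this episode is $\Delta_k=\int \big(V^{M^*}_{\mu^{M^*},1}(s)-V^{M^*}_{\mu^k,1}(s)\big)\,\rho(ds)$, and $\mathrm{BayesRegret}(T)=\mathbb E\big[\sum_{k=1}^{\lceil T/H\rceil}\Delta_k\big]$, the expectation being over the prior and the run of the algorithm. **Theorem.** There is $p\in\mathbb N$ such that for all real $R_{\max},\kappa,c$ and all $\sigma_r,\sigma_f>0$ there is a constant $C$, depending only on $R_{\max},\kappa,c,\sigma_r,\sigma_f$, such that for all $d_s,d_a,d_\phi,d_{\phi'},d_\psi$, all $H,T\ge1$ and all models as above with these $\sigma_r,\sigma_f$ and with 1. $d_\psi\le c\,d_\phi$ and $d_{\phi'}\le c\,d_\phi$, 2. prior variances of the transition $\phi_f(s,a)^\top\Sigma_f\,\phi_f(s,a)\le\kappa$ for all $(s,a)$, 3. $\mathbb E\big[\sup_{s,a}|\bar r^{M^*}(s,a)|^2\big]\le R_{\max}^2$ under the prior, the regret $\sum_{k=1}^{\lceil T/H\rceil}\Delta_k$ is integrable and $$\mathrm{BayesRegret}(T)\le C\,H^{3/2}\,d_\phi\,\sqrt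 T\,(1+\log T)^p .$$ That is, the Bayesian regret of PSRL is $\tilde O(H^{3/2}d_\phi\sqrt T)$, where $\tilde O$ hides factors that are polylogarithmic in $T$. -/

import Mathlib

open MeasureTheory ProbabilityTheory
open scoped ENNReal NNReal

noncomputable section

namespace PSRL

/-! ### Finite-horizon MDPs, policies and value functions

Time steps inside an episode are numbered `0, …, H - 1`. -/

/-- The unknown part of an MDP: mean reward `r̄(s, a)` and transition law `P(· | s, a)`. -/
structure MDP (S A : Type) [MeasurableSpace S] [MeasurableSpace A] where
  rew : S × A → ℝ
  trans : Kernel (S × A) S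

/-- A deterministic (measurable) policy; the action may depend on the step of the episode. -/
structure Policy (S A : Type) [MeasurableSpace S] [MeasurableSpace A] where
  act : ℕ → S → A
  measurable_act : ∀ i, Measurable (act i)

variable {S A : Type} [MeasurableSpace S] [MeasurableSpace A]

/-- `stateKernel M μ i n s` is the law of `s_{i+n}` given `s_i = s`, when the actions are chosen
by `μ` in the MDP `M`. -/
def MDP.stateKernel (M : MDP S A) (μ : Policy S A) (i : ℕ) : ℕ → Kernel S S
  | 0 => Kernel.id
  | n + 1 =>
    (M.trans.comap (fun s => (s, μ.act (i + n) s))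
      (measurable_id.prodMk (μ.measurable_act (i + n)))) ∘ₖ M.stateKernel μ i n

/-- `V_{μ,i}^M(s) = E[∑_{j = i}^{H - 1} r̄(s_j, a_j) | s_i = s]`, the expected reward from step `i`
to the end of the episode. -/
def MDP.value (M : MDP S A) (H : ℕ) (μ : Policy S A) (i : ℕ) (s : S) : ℝ :=
  ∑ n ∈ Finset.range (H - i), ∫ s', M.rew (s', μ.act (i + n) s') ∂(M.stateKernel μ i n s)

/-- `μ` is an optimal policy for `M`: it maximizes the value at every step from every state. -/
def MDP.IsOptimal (M : MDP S A) (H : ℕ) (μ : Policy S A) : Prop :=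
  ∀ (ν : Policy S A) (i : ℕ) (s : S), i < H → M.value H ν i s ≤ M.value H μ i s

/-! ### Bayesian linear regression in feature space -/

/-- The unknown weights: one vector `w_r` for the reward and one vector for each of the `dψ`
coordinates of the embedded next state. -/
abbrev Weights (dφ dφ' dψ : ℕ) : Type :=
  EuclideanSpace ℝ (Fin dφ') × (Fin dψ → EuclideanSpace ℝ (Fin dφ))

/-- The known data of a model that is linear in feature embeddings. -/
structure FeatureModel (S A : Type) [MeasurableSpace S] [MeasurableSpace A]
    (dφ dφ' dψ : ℕ) where
  /-- transition features -/
  φf : S × A → EuclideanSpace ℝ (Fin dφ)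
  measurable_φf : Measurable φf
  /-- reward features -/
  φr : S × A → EuclideanSpace ℝ (Fin dφ')
  measurable_φr : Measurable φr
  /-- embedding of the next state -/
  ψ : S → (Fin dψ → ℝ)
  measurable_ψ : Measurable ψ
  /-- known law of the next state given its embedding; for invertible `ψ` it is the Dirac mass at
  the preimage under `ψ` -/
  decode : Kernel (Fin dψ → ℝ) S
  isMarkovKernel_decode : IsMarkovKernel decode
  /-- a state drawn from `decode z` has embedding `z` -/
  map_ψ_decode : ∀ᵐ z ∂(volume : Measure (Fin dψ → ℝ)), (decode z).map ψ = Measure.dirac z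
  /-- initial state distribution -/
  ρ : Measure S
  isProbabilityMeasure_ρ : IsProbabilityMeasure ρ
  /-- standard deviation of the reward noise -/
  σr : ℝ≥0
  /-- standard deviation of the transition noise -/
  σf : ℝ≥0
  /-- prior covariance of the reward weights -/
  covr : Matrix (Fin dφ') (Fin dφ') ℝ
  posSemidef_covr : covr.PosSemidef
  /-- prior covariance of the weights of each coordinate of the transition -/
  covf : Matrix (Fin dφ) (Fin dφ) ℝ
  posSemidef_covf : covf.PosSemidef

namespace FeatureModel

variable {dφ dφ' dψ : ℕ} (M : FeatureModel S A dφ dφ' dψ)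

/-- The prior: `w_r ∼ N(0, covr)`, and independently of it the `dψ` weight vectors of the
transition are i.i.d. `N(0, covf)`. -/
def prior : Measure (Weights dφ dφ' dψ) :=
  (multivariateGaussian 0 M.covr).prod (Measure.pi fun _ => multivariateGaussian 0 M.covf)

instance : IsProbabilityMeasure M.prior := by unfold prior; infer_instance

/-- Mean reward `⟨w_r, φ_r(s, a)⟩`. -/
def meanReward (p : Weights dφ dφ' dψ × (S × A)) : ℝ := inner ℝ p.1.1 (M.φr p.2)

/-- Mean of the embedded next state: coordinate `j` is `⟨w_j, φ_f(s, a)⟩`. -/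
def meanEmbedding (p : Weights dφ dφ' dψ × (S × A)) : Fin dψ → ℝ :=
  fun j => inner ℝ (p.1.2 j) (M.φf p.2)

lemma measurable_meanReward : Measurable M.meanReward :=
  (measurable_fst.comp measurable_fst).inner (M.measurable_φr.comp measurable_snd)

lemma measurable_meanEmbedding : Measurable M.meanEmbedding :=
  measurable_pi_lambda _ fun j =>
    ((measurable_pi_apply j).comp (measurable_snd.comp measurable_fst)).inner
      (M.measurable_φf.comp measurable_snd)

/-- Observed reward: `r = ⟨w_r, φ_r(s, a)⟩ + ε_r` with `ε_r ∼ N(0, σr²)`. -/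
def rewardKernel : Kernel (Weights dφ dφ' dψ × (S × A)) ℝ :=
  (Kernel.id ×ₖ Kernel.const _ (gaussianReal 0 (M.σr ^ 2))).map
    fun q => M.meanReward q.1 + q.2

/-- Embedded next state: `ψ(s') = W φ_f(s, a) + ε_f` with `ε_f ∼ N(0, σf² I)`. -/
def embeddingKernel : Kernel (Weights dφ dφ' dψ × (S × A)) (Fin dψ → ℝ) :=
  (Kernel.id ×ₖ Kernel.const _ (Measure.pi fun _ => gaussianReal 0 (M.σf ^ 2))).map
    fun q => M.meanEmbedding q.1 + q.2

/-- Law of the next state given the weights, the state and the action. -/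
def transKernel : Kernel (Weights dφ dφ' dψ × (S × A)) S := M.decode ∘ₖ M.embeddingKernel

instance : IsMarkovKernel M.rewardKernel :=
  Kernel.IsMarkovKernel.map _
    ((M.measurable_meanReward.comp measurable_fst).add measurable_snd)

instance : IsMarkovKernel M.embeddingKernel :=
  Kernel.IsMarkovKernel.map _
    ((M.measurable_meanEmbedding.comp measurable_fst).add measurable_snd)

instance : IsMarkovKernel M.transKernel := by
  have := M.isMarkovKernel_decode
  unfold transKernel; infer_instance

/-- The MDP with weights `w`. -/
def mdp (w : Weights dφ dφ' dψ) : MDP S A where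
  rew h := M.meanReward (w, h)
  trans := M.transKernel.comap (fun h => (w, h)) measurable_prodMk_left

end FeatureModel

/-! ### Posterior sampling -/

/-- A planner chooses a policy for each value of the weights, measurably in the weights. -/
structure Planner (S A : Type) [MeasurableSpace S] [MeasurableSpace A] (dφ dφ' dψ : ℕ) where
  act : Weights dφ dφ' dψ → ℕ → S → A
  measurable_act : ∀ i, Measurable fun p : Weights dφ dφ' dψ × S => act p.1 i p.2

/-- The policy that the planner chooses for the weights `w`. -/
def Planner.policy {dφ dφ' dψ : ℕ} (π : Planner S A dφ dφ' dψ) (w : Weights dφ dφ' dψ) :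
    Policy S A where
  act := π.act w
  measurable_act i := (π.measurable_act i).comp measurable_prodMk_left

lemma measurable_snoc {X : Type} [MeasurableSpace X] (n : ℕ) :
    Measurable fun q : (Fin n → X) × X => (Fin.snoc q.1 q.2 : Fin (n + 1) → X) := by
  refine measurable_pi_lambda _ fun i => ?_
  refine Fin.lastCases ?_ (fun j => ?_) i
  · simpa using measurable_snd
  · simpa [Function.comp_def] using
      (measurable_pi_apply j).comp (measurable_fst (α := Fin n → X) (β := X))

/-- States, actions and observed rewards of one episode. -/
abbrev Episode (S A : Type) (H : ℕ) : Type := Fin H → S × A × ℝ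

/-- The sampled weights and the data of the first `k` episodes. -/
abbrev Run (S A : Type) (dφ dφ' dψ H k : ℕ) : Type := Fin k → Weights dφ dφ' dψ × Episode S A H

namespace FeatureModel

variable {dφ dφ' dψ : ℕ} (M : FeatureModel S A dφ dφ' dψ) (π : Planner S A dφ dφ' dψ)

/-- Given true weights `w` and sampled weights `w'`, and the first `n` steps with the state `s`
reached after them: the law of (action, reward, next state) at step `n`. The action is that of
the policy planned for `w'`; reward and next state are independent and follow the true MDP. -/
def stepKernel (n : ℕ) :
    Kernel ((Weights dφ dφ' dψ × Weights dφ dφ' dψ) × (Episode S A n × S)) (A × ℝ × S) :=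
  Kernel.deterministic (fun p => π.act p.1.2 n p.2.2)
      ((π.measurable_act n).comp
        ((measurable_snd.comp measurable_fst).prodMk (measurable_snd.comp measurable_snd))) ×ₖ
    (M.rewardKernel ×ₖ M.transKernel).comap
      (fun p => (p.1.1, (p.2.2, π.act p.1.2 n p.2.2)))
      ((measurable_fst.comp measurable_fst).prodMk ((measurable_snd.comp measurable_snd).prodMk
        ((π.measurable_act n).comp
          ((measurable_snd.comp measurable_fst).prodMk (measurable_snd.comp measurable_snd)))))

/-- Law of the first `n` steps of an episode and of the state reached after them, given the true
weights and the sampled weights. -/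
def partialEpisode :
    (n : ℕ) → Kernel (Weights dφ dφ' dψ × Weights dφ dφ' dψ) (Episode S A n × S)
  | 0 => Kernel.const _ (M.ρ.map fun s => (Fin.elim0, s))
  | n + 1 => (partialEpisode n ⊗ₖ M.stepKernel π n).map
      fun q => (Fin.snoc q.1.1 (q.1.2, q.2.1, q.2.2.1), q.2.2.2)

/-- Law of the data of an episode of length `H`, given the true and the sampled weights. -/
def episodeKernel (H : ℕ) :
    Kernel (Weights dφ dφ' dψ × Weights dφ dφ' dψ) (Episode S A H) :=
  (M.partialEpisode π H).map Prod.fst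

instance (n : ℕ) : IsMarkovKernel (M.stepKernel π n) := by unfold stepKernel; infer_instance

lemma isMarkovKernel_partialEpisode (n : ℕ) : IsMarkovKernel (M.partialEpisode π n) := by
  induction n with
  | zero =>
    have := M.isProbabilityMeasure_ρ
    have : IsProbabilityMeasure (M.ρ.map fun s => ((Fin.elim0, s) : Episode S A 0 × S)) :=
      Measure.isProbabilityMeasure_map measurable_prodMk_left.aemeasurable
    unfold partialEpisode; infer_instance
  | succ n ih =>
    refine Kernel.IsMarkovKernel.map _ (Measurable.prodMk ?_ (by fun_prop))
    exact (measurable_snoc n).comp (f := fun q : (Episode S A n × S) × (A × ℝ × S) =>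
      (q.1.1, (q.1.2, q.2.1, q.2.2.1))) (by fun_prop)

instance (H : ℕ) : IsMarkovKernel (M.episodeKernel π H) := by
  have := M.isMarkovKernel_partialEpisode π H
  exact Kernel.IsMarkovKernel.map _ measurable_fst

/-- The data (states, actions, rewards) contained in a run. -/
def data {H k : ℕ} (x : Run S A dφ dφ' dψ H k) : Fin k → Episode S A H := fun j => (x j).2

lemma measurable_data {H k : ℕ} :
    Measurable (data : Run S A dφ dφ' dψ H k → (Fin k → Episode S A H)) :=
  measurable_pi_lambda _ fun j => measurable_snd.comp (measurable_pi_apply j)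

/-- Posterior distribution of the weights given the data of the first `k` episodes, when
`κ` is the law of the first `k` episodes given the weights. -/
def posteriorOf {H k : ℕ} (κ : Kernel (Weights dφ dφ' dψ) (Run S A dφ dφ' dψ H k))
    [IsMarkovKernel κ] : Kernel (Fin k → Episode S A H) (Weights dφ dφ' dψ) :=
  haveI : IsMarkovKernel (κ.map data) := Kernel.IsMarkovKernel.map _ measurable_data
  posterior (κ.map data) M.prior

/-- One more episode of posterior sampling: after the run `x`, draw `w'` from the posterior given
the data of `x`, independently of the true weights `w` given the data, and act for one episode
according to the policy planned for `w'`. -/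
def extend {H k : ℕ} (κ : Kernel (Weights dφ dφ' dψ) (Run S A dφ dφ' dψ H k))
    [IsMarkovKernel κ] : Kernel (Weights dφ dφ' dψ) (Run S A dφ dφ' dψ H (k + 1)) :=
  (κ ⊗ₖ (M.posteriorOf κ).comap
        (fun p : Weights dφ dφ' dψ × Run S A dφ dφ' dψ H k => data p.2)
        (measurable_data.comp measurable_snd) ⊗ₖ
      (M.episodeKernel π H).comap
        (fun p : Weights dφ dφ' dψ × (Run S A dφ dφ' dψ H k × Weights dφ dφ' dψ) =>
          (p.1, p.2.2))
        (measurable_fst.prodMk (measurable_snd.comp measurable_snd))).map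
    fun q => Fin.snoc q.1.1 (q.1.2, q.2)

instance {H k : ℕ} (κ : Kernel (Weights dφ dφ' dψ) (Run S A dφ dφ' dψ H k))
    [IsMarkovKernel κ] : IsMarkovKernel (M.extend π κ) := by
  have : IsMarkovKernel (κ.map data) := Kernel.IsMarkovKernel.map _ measurable_data
  have : IsMarkovKernel (M.posteriorOf κ) := by unfold posteriorOf; infer_instance
  refine Kernel.IsMarkovKernel.map _ ?_
  exact (measurable_snoc k).comp (f := fun q : (Run S A dφ dφ' dψ H k × Weights dφ dφ' dψ) ×
    Episode S A H => (q.1.1, (q.1.2, q.2))) (by fun_prop)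

/-- Law of the first `k` episodes of posterior sampling given the true weights (together with
the fact that it is a Markov kernel). -/
def runKernelAux (H : ℕ) : (k : ℕ) →
    {κ : Kernel (Weights dφ dφ' dψ) (Run S A dφ dφ' dψ H k) // IsMarkovKernel κ}
  | 0 => ⟨Kernel.const _ (Measure.dirac Fin.elim0), inferInstance⟩
  | k + 1 =>
    haveI := (runKernelAux H k).2
    ⟨M.extend π (runKernelAux H k).1, inferInstance⟩

/-- Law of the first `k` episodes of posterior sampling given the true weights. -/
def runKernel (H k : ℕ) : Kernel (Weights dφ dφ' dψ) (Run S A dφ dφ' dψ H k) :=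
  (M.runKernelAux π H k).1

/-- Joint law of the true weights, drawn from the prior, and of the first `k` episodes of
posterior sampling. -/
def runLaw (H k : ℕ) : Measure (Weights dφ dφ' dψ × Run S A dφ dφ' dψ H k) :=
  M.prior ⊗ₘ M.runKernel π H k

/-- Regret of an episode in which the policy planned for `w'` is used while `w` is true. -/
def episodeRegret (H : ℕ) (w w' : Weights dφ dφ' dψ) : ℝ :=
  ∫ s, ((M.mdp w).value H (π.policy w) 0 s - (M.mdp w).value H (π.policy w') 0 s) ∂M.ρ

/-- Regret of a run of posterior sampling, the sum of the regrets of its episodes. -/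
def regret (H k : ℕ) (p : Weights dφ dφ' dψ × Run S A dφ dφ' dψ H k) : ℝ :=
  ∑ j, M.episodeRegret π H p.1 (p.2 j).1

end FeatureModel

/-- Number of episodes of length `H` up to time `T`. -/
def numEpisodes (T H : ℕ) : ℕ := ⌈(T : ℝ) / (H : ℝ)⌉₊

/-- Bayesian regret of posterior sampling up to time `T`. -/
def FeatureModel.bayesRegret {dφ dφ' dψ : ℕ} (M : FeatureModel S A dφ dφ' dψ)
    (π : Planner S A dφ dφ' dψ) (H T : ℕ) : ℝ :=
  ∫ p, M.regret π H (numEpisodes T H) p ∂(M.runLaw π H (numEpisodes T H))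

end PSRL

end

noncomputable section

namespace PSRL

/-! ### Product densities and Gaussian shifts -/

/-! Given the data of the earlier episodes, the sampled weights `w'` have the same law as the true
weights `w`. Hence the optimal value of the true model may be replaced, in expectation, by that of
the sampled model, and the expected regret of an episode becomes the difference of the values of one
and the same policy in two models (`integral_episodeRegret_eq`).

That difference telescopes along an episode run in the true model (`enorm_totalReward_sub_le`). Each
step costs the gap of the mean rewards, plus the remaining value of the sampled model, of size at
most `H` times its largest mean reward, times the total variation distance of two Gaussians with
equal covariance, which is at most of the order of the distance of their means divided by `σf`
(`abs_integral_pi_gaussianReal_add_sub_le`).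

Both gaps are linear in the weights. In a direction `φ`, each weight matrix is compared with the
posterior mean: the squared gap is at most twice (deviation of `w'` plus deviation of `w`) times the
posterior variance at `φ`, where the deviation is normalized and taken in the worst direction
(`sum_sq_sub_dotProduct_le`). By conjugacy a weight matrix drawn from the posterior is an affine
image of a standard Gaussian matrix, and its deviation is at most the squared operator norm of that
matrix, whose mean is linear in the sum of the two dimensions (`lintegral_iSup_rowsSq_le`,
`lintegral_devSq_le`). Linearity is essential: the Hilbert–Schmidt norm would give the product of
the dimensions and lose a factor `√dφ` in the regret. The posterior variances, frozen at the start
of an episode, add up to a log-determinant (`elliptic_potential`).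

The inequality `R x ≤ η R² G + D / (2η)` separates deviations `G` from variances `D`, so only
expectations occur and no high-probability event is needed. The random factor `R`, the supremum of
the sampled mean rewards, causes no harm: given the data it is independent of the transition
deviation of `w`, and also of that of `w'`, because the likelihood factors into a reward part and a
transition part. Over `K` episodes the dominant terms are `K H² η dφ` and `H² dφ log T / η`; with `η
= 1 / √K` and `K ≈ T / H` they give `H^(3/2) dφ √T log T`.

The posterior is never computed. All laws of runs have densities with respect to the run with zero
weights (`lintegral_runKernel`), so posterior expectations appear as integrals of likelihoods
against the prior. -/

lemma lintegral_pi_prod {ι : Type*} [Fintype ι] {X : ι → Type*} [∀ i, MeasurableSpace (X i)]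
    (μ : ∀ i, Measure (X i)) [∀ i, IsProbabilityMeasure (μ i)] (f : ∀ i, X i → ℝ≥0∞)
    (hf : ∀ i, Measurable (f i)) :
    ∫⁻ x, ∏ i, f i (x i) ∂(Measure.pi μ) = ∏ i, ∫⁻ x, f i x ∂(μ i) := by
  have h := lintegral_prod_eq_prod_lintegral_of_indepFun (μ := Measure.pi μ) Finset.univ
    (fun i x => f i (x i)) (iIndepFun_pi (fun i => (hf i).aemeasurable))
    (fun i => (hf i).comp (measurable_pi_apply i))
  rw [h]
  refine Finset.prod_congr rfl fun i _ => ?_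
  exact (measurePreserving_eval μ i).lintegral_comp (hf i)

lemma pi_withDensity {ι : Type*} [Fintype ι] {X : ι → Type*} [∀ i, MeasurableSpace (X i)]
    (μ : ∀ i, Measure (X i)) [∀ i, IsProbabilityMeasure (μ i)] (f : ∀ i, X i → ℝ≥0∞)
    (hf : ∀ i, Measurable (f i)) [∀ i, SigmaFinite ((μ i).withDensity (f i))] :
    Measure.pi (fun i => (μ i).withDensity (f i)) =
      (Measure.pi μ).withDensity fun x => ∏ i, f i (x i) := by
  refine Measure.pi_eq fun s hs => ?_
  rw [withDensity_apply _ (MeasurableSet.univ_pi hs), ← lintegral_indicator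
    (MeasurableSet.univ_pi hs)]
  have : ∀ x : ∀ i, X i, (Set.univ.pi s).indicator (fun x => ∏ i, f i (x i)) x =
      ∏ i, (s i).indicator (f i) (x i) := by
    intro x
    by_cases hx : x ∈ Set.univ.pi s
    · rw [Set.indicator_of_mem hx]
      exact Finset.prod_congr rfl fun i _ => by rw [Set.indicator_of_mem (hx i trivial)]
    · rw [Set.indicator_of_notMem hx]
      simp only [Set.mem_pi, Set.mem_univ, forall_const, not_forall] at hx
      obtain ⟨i, hi⟩ := hx
      exact (Finset.prod_eq_zero (Finset.mem_univ i) (Set.indicator_of_notMem hi _)).symm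
  simp_rw [this]
  rw [lintegral_pi_prod μ _ fun i => (hf i).indicator (hs i)]
  refine Finset.prod_congr rfl fun i _ => ?_
  rw [withDensity_apply _ (hs i), lintegral_indicator (hs i)]

/-- The centred Gaussian serves as reference for every mean, so that the likelihoods of all weights
are densities with respect to one common law. -/
lemma gaussianReal_eq_withDensity (m : ℝ) {v : ℝ≥0} (hv : v ≠ 0) :
    gaussianReal m v = (gaussianReal 0 v).withDensity
      fun x => ENNReal.ofReal (Real.exp ((m * x - m ^ 2 / 2) / v)) := by
  rw [gaussianReal_of_var_ne_zero m hv, gaussianReal_of_var_ne_zero 0 hv,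
    ← withDensity_mul _ (measurable_gaussianPDF 0 v) (by fun_prop)]
  congr 1
  ext x
  have hv' : (v : ℝ) ≠ 0 := by exact_mod_cast hv
  rw [Pi.mul_apply, gaussianPDF, gaussianPDF, ← ENNReal.ofReal_mul (gaussianPDFReal_nonneg _ _ _),
    gaussianPDFReal, gaussianPDFReal, mul_assoc _ (Real.exp _), ← Real.exp_add]
  congr 3
  field_simp
  ring

lemma pi_gaussianReal_map_add {ι : Type*} [Fintype ι] (m : ι → ℝ) {v : ℝ≥0} (hv : v ≠ 0) :
    (Measure.pi fun _ : ι => gaussianReal 0 v).map (fun x => m + x) =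
      (Measure.pi fun _ : ι => gaussianReal 0 v).withDensity
        fun x => ENNReal.ofReal (Real.exp ((∑ i, (m i * x i - m i ^ 2 / 2)) / v)) := by
  have h1 : (Measure.pi fun _ : ι => gaussianReal 0 v).map (fun x => m + x) =
      Measure.pi fun i => (gaussianReal 0 v).map (fun x => m i + x) := by
    rw [← Measure.pi_map_pi (fun i => by fun_prop)]
    rfl
  have h2 : ∀ i, (gaussianReal 0 v).map (fun x => m i + x) = (gaussianReal 0 v).withDensity
      fun x => ENNReal.ofReal (Real.exp ((m i * x - m i ^ 2 / 2) / v)) := by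
    intro i
    rw [gaussianReal_map_const_add, zero_add, gaussianReal_eq_withDensity _ hv]
  have (i : ι) : IsProbabilityMeasure ((gaussianReal 0 v).withDensity
      fun x => ENNReal.ofReal (Real.exp ((m i * x - m i ^ 2 / 2) / v))) := by
    rw [← gaussianReal_eq_withDensity _ hv]; infer_instance
  rw [h1]
  simp_rw [h2]
  rw [pi_withDensity _ _ fun i => by fun_prop]
  congr 1
  ext x
  rw [Finset.sum_div, Real.exp_sum, ENNReal.ofReal_prod_of_nonneg fun i _ => (Real.exp_pos _).le]

lemma pi_gaussianReal_eq_withDensity_volume {ι : Type*} [Fintype ι] {v : ℝ≥0} (hv : v ≠ 0) :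
    (Measure.pi fun _ : ι => gaussianReal 0 v) =
      (volume : Measure (ι → ℝ)).withDensity fun x =>
        ENNReal.ofReal (∏ i, gaussianPDFReal 0 v (x i)) := by
  refine Measure.pi_eq fun s hs => ?_
  rw [withDensity_apply _ (MeasurableSet.univ_pi hs), volume_pi, Measure.restrict_pi_pi]
  have hint (i : ι) : Integrable (gaussianPDFReal 0 v) (volume.restrict (s i)) :=
    (integrable_gaussianPDFReal 0 v).restrict
  rw [← ofReal_integral_eq_lintegral_ofReal (Integrable.fintype_prod hint)
    (ae_of_all _ fun x => Finset.prod_nonneg fun i _ => gaussianPDFReal_nonneg _ _ _),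
    integral_fintype_prod_eq_prod, ENNReal.ofReal_prod_of_nonneg fun i _ =>
      integral_nonneg fun x => gaussianPDFReal_nonneg _ _ _]
  refine Finset.prod_congr rfl fun i _ => ?_
  rw [gaussianReal_apply_eq_integral _ hv]

/-- A density with respect to Lebesgue measure allows a linear change of variables. The constant may
stay anonymous, because it occurs on both sides wherever it is used. -/
lemma stdGaussian_eq_withDensity (d : ℕ) :
    ∃ c : ℝ, 0 < c ∧ stdGaussian (EuclideanSpace ℝ (Fin d)) =
      (volume : Measure (EuclideanSpace ℝ (Fin d))).withDensity
        fun x => ENNReal.ofReal (c * Real.exp (-(x.ofLp ⬝ᵥ x.ofLp) / 2)) := by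
  refine ⟨∏ _i : Fin d, (√(2 * Real.pi * (1 : ℝ≥0)))⁻¹, Finset.prod_pos fun _ _ => by positivity, ?_⟩
  rw [← map_pi_eq_stdGaussian]
  have key : (Measure.pi fun _ : Fin d => gaussianReal 0 1) =
      (volume : Measure (Fin d → ℝ)).withDensity fun x => ENNReal.ofReal
        ((∏ _i : Fin d, (√(2 * Real.pi * (1 : ℝ≥0)))⁻¹) * Real.exp (-(x ⬝ᵥ x) / 2)) := by
    rw [pi_gaussianReal_eq_withDensity_volume one_ne_zero]
    congr 1
    ext x
    congr 1
    simp only [gaussianPDFReal, dotProduct]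
    rw [Finset.prod_mul_distrib, ← Real.exp_sum, ← Finset.sum_neg_distrib, Finset.sum_div]
    congr 2
    refine Finset.sum_congr rfl fun i _ => ?_
    simp
    ring
  rw [key]
  ext s hs
  have hm : Measurable (WithLp.toLp 2 : (Fin d → ℝ) → EuclideanSpace ℝ (Fin d)) := by fun_prop
  rw [Measure.map_apply hm hs, withDensity_apply _ hs, withDensity_apply _ (hm hs),
    ← lintegral_indicator hs, ← lintegral_indicator (hm hs),
    ← (PiLp.volume_preserving_toLp (Fin d)).lintegral_comp]
  · rfl
  · refine Measurable.indicator ?_ hs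
    simp only [dotProduct]
    fun_prop

end PSRL

end

noncomputable section

namespace PSRL

/-! ### Quadratic exponential tilts of the standard Gaussian -/

open Matrix in
open scoped MatrixOrder in
lemma exists_sqrt_matrix {d : ℕ} {S : Matrix (Fin d) (Fin d) ℝ} (hS : S.PosSemidef) :
    (CFC.sqrt S)ᵀ = CFC.sqrt S ∧ CFC.sqrt S * CFC.sqrt S = S := by
  refine ⟨?_, CFC.sqrt_mul_sqrt_self _ hS.nonneg⟩
  have := (CFC.sqrt_nonneg S).isSelfAdjoint
  rwa [IsSelfAdjoint, Matrix.star_eq_conjTranspose, Matrix.conjTranspose_eq_transpose_of_trivial]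
    at this

open Matrix in
open scoped MatrixOrder in
/-- A Gaussian tilted by the exponential of a concave quadratic function is, up to a constant,
the law of an affine function of a standard Gaussian. -/
lemma exists_withDensity_tilt {d : ℕ} {A : Matrix (Fin d) (Fin d) ℝ} (hA : A.PosSemidef) :
    ∃ B : Matrix (Fin d) (Fin d) ℝ, Bᵀ = B ∧ B * B = 1 + A ∧ ∀ b : Fin d → ℝ,
      ∃ (c : ℝ) (T : EuclideanSpace ℝ (Fin d) → EuclideanSpace ℝ (Fin d)),
      0 < c ∧ Measurable T ∧
      (∀ ζ a, ((1 + A) *ᵥ (T ζ).ofLp - b) ⬝ᵥ a = ζ.ofLp ⬝ᵥ (B *ᵥ a)) ∧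
      (stdGaussian (EuclideanSpace ℝ (Fin d))).withDensity
          (fun z => ENNReal.ofReal (Real.exp (b ⬝ᵥ z.ofLp - (z.ofLp ⬝ᵥ A *ᵥ z.ofLp) / 2))) =
        ENNReal.ofReal c • (stdGaussian (EuclideanSpace ℝ (Fin d))).map T := by
  have hQ : (1 + A).PosDef := PosDef.one.add_posSemidef hA
  obtain ⟨hBt, hBB⟩ := exists_sqrt_matrix hQ.posSemidef
  set B := CFC.sqrt (1 + A)
  have hdet : B.det ≠ 0 := by
    have := hQ.det_pos
    rw [← hBB, det_mul] at this
    exact fun h => by simp [h] at this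
  have hBi : B * B⁻¹ = 1 := mul_nonsing_inv _ (Ne.isUnit hdet)
  have hBi' : B⁻¹ * B = 1 := nonsing_inv_mul _ (Ne.isUnit hdet)
  refine ⟨B, hBt, hBB, fun b => ?_⟩
  -- The maximizer of `b·z - z·Az/2 - |z|²/2`, which is `(1 + A)⁻¹ b`; after completing the square
  -- it is the mean of the tilted Gaussian.
  set m : Fin d → ℝ := (B⁻¹ * B⁻¹) *ᵥ b
  have hm : (1 + A) *ᵥ m = b := by
    rw [mulVec_mulVec, ← hBB, Matrix.mul_assoc, ← Matrix.mul_assoc B B⁻¹, hBi, Matrix.one_mul, hBi,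
      one_mulVec]
  obtain ⟨c0, hc0, hstd⟩ := stdGaussian_eq_withDensity d
  let f : EuclideanSpace ℝ (Fin d) →ₗ[ℝ] EuclideanSpace ℝ (Fin d) := toEuclideanLin B⁻¹
  have hf : ∀ ζ, (f ζ).ofLp = B⁻¹ *ᵥ ζ.ofLp := fun ζ => rfl
  have hfdet : LinearMap.det f ≠ 0 := by
    have : LinearMap.det f = B⁻¹.det := by
      simp only [f, toLpLin_eq_toLin, LinearMap.det_toLin]
    rw [this, det_nonsing_inv, Ring.inverse_eq_inv']
    exact inv_ne_zero hdet
  have hfm : Measurable f := f.continuous_of_finiteDimensional.measurable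
  let T : EuclideanSpace ℝ (Fin d) → EuclideanSpace ℝ (Fin d) := fun ζ => WithLp.toLp 2 m + f ζ
  have hT : Measurable T := measurable_const.add hfm
  have hTo : ∀ ζ, (T ζ).ofLp = m + B⁻¹ *ᵥ ζ.ofLp := fun ζ => rfl
  have hBT : ∀ ζ, B *ᵥ ((T ζ).ofLp - m) = ζ.ofLp := by
    intro ζ
    rw [hTo, add_sub_cancel_left, mulVec_mulVec, hBi, one_mulVec]
  have hsymm : ∀ x y : Fin d → ℝ, x ⬝ᵥ B *ᵥ y = (B *ᵥ x) ⬝ᵥ y := by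
    intro x y
    rw [dotProduct_mulVec, ← mulVec_transpose, hBt]
  have hg : Measurable fun x : EuclideanSpace ℝ (Fin d) =>
      ENNReal.ofReal (c0 * Real.exp (-(x.ofLp ⬝ᵥ x.ofLp) / 2)) := by
    simp only [dotProduct]; fun_prop
  have hq : Measurable fun z : EuclideanSpace ℝ (Fin d) => ENNReal.ofReal
      (Real.exp (b ⬝ᵥ z.ofLp - (z.ofLp ⬝ᵥ A *ᵥ z.ofLp) / 2)) := by
    simp only [dotProduct, mulVec]; fun_prop
  -- The constant is the Jacobian of `B⁻¹` times `exp (b·m/2)`, the value of the completed square at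
  -- `m`.
  refine ⟨|(LinearMap.det f)⁻¹|⁻¹ * Real.exp (b ⬝ᵥ m / 2), T, by positivity, hT, ?_, ?_⟩
  · intro ζ a
    rw [← hm, ← mulVec_sub, ← hBB, ← mulVec_mulVec, hBT, hsymm]
  · refine Measure.ext_of_lintegral _ fun h hh => ?_
    rw [lintegral_withDensity_eq_lintegral_mul _ hq hh, lintegral_smul_measure,
      lintegral_map hh hT, hstd, lintegral_withDensity_eq_lintegral_mul _ hg (hq.mul hh),
      ← Function.comp_def h T, lintegral_withDensity_eq_lintegral_mul _ hg (hh.comp hT)]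
    let k : EuclideanSpace ℝ (Fin d) → ℝ≥0∞ := fun z => ENNReal.ofReal
      (c0 * Real.exp (-((B *ᵥ (z.ofLp - m)) ⬝ᵥ (B *ᵥ (z.ofLp - m))) / 2)) * h z
    have hk : Measurable k := by
      refine Measurable.mul ?_ hh
      simp only [dotProduct, mulVec]; fun_prop
    have e1 : ∫⁻ ζ, ((fun x : EuclideanSpace ℝ (Fin d) =>
        ENNReal.ofReal (c0 * Real.exp (-(x.ofLp ⬝ᵥ x.ofLp) / 2))) * (h ∘ T)) ζ =
        ENNReal.ofReal |(LinearMap.det f)⁻¹| * ∫⁻ z, k z := by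
      calc _ = ∫⁻ ζ, k (T ζ) := by
            refine lintegral_congr fun ζ => ?_
            simp only [k, Pi.mul_apply, Function.comp, hBT]
        _ = ∫⁻ y, k (WithLp.toLp 2 m + y) ∂(Measure.map f volume) := by
            rw [lintegral_map (f := fun y => k (WithLp.toLp 2 m + y)) (hk.comp (by fun_prop)) hfm]
        _ = _ := by
            rw [Measure.map_linearMap_addHaar_eq_smul_addHaar _ hfdet, lintegral_smul_measure,
              lintegral_add_left_eq_self, smul_eq_mul]
    have e2 : ∀ z, k z = ENNReal.ofReal (Real.exp (-(b ⬝ᵥ m / 2))) *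
        ((fun x : EuclideanSpace ℝ (Fin d) =>
          ENNReal.ofReal (c0 * Real.exp (-(x.ofLp ⬝ᵥ x.ofLp) / 2))) *
        ((fun z : EuclideanSpace ℝ (Fin d) => ENNReal.ofReal
          (Real.exp (b ⬝ᵥ z.ofLp - (z.ofLp ⬝ᵥ A *ᵥ z.ofLp) / 2))) * h)) z := by
      intro z
      simp only [k, Pi.mul_apply]
      rw [← mul_assoc, ← mul_assoc, ← ENNReal.ofReal_mul (Real.exp_pos _).le,
        ← ENNReal.ofReal_mul (by positivity)]
      congr 2
      rw [mul_comm (Real.exp _) (c0 * _), mul_assoc, mul_assoc, ← Real.exp_add, ← Real.exp_add]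
      congr 2
      have h1 : (B *ᵥ (z.ofLp - m)) ⬝ᵥ (B *ᵥ (z.ofLp - m)) =
          z.ofLp ⬝ᵥ z.ofLp + z.ofLp ⬝ᵥ A *ᵥ z.ofLp - 2 * (b ⬝ᵥ z.ofLp) + b ⬝ᵥ m := by
        have h2 : ∀ x : Fin d → ℝ, m ⬝ᵥ (1 + A) *ᵥ x = b ⬝ᵥ x := by
          intro x
          rw [← hm, ← hBB, ← mulVec_mulVec, hsymm, hsymm, mulVec_mulVec]
        rw [← hsymm, mulVec_mulVec, hBB, mulVec_sub, hm, sub_dotProduct, dotProduct_sub,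
          dotProduct_sub, h2, add_mulVec, one_mulVec, dotProduct_add, dotProduct_comm z.ofLp b,
          dotProduct_comm m b]
        ring
      rw [h1]
      ring
    rw [e1]
    simp_rw [e2]
    rw [lintegral_const_mul _ (hg.mul (hq.mul hh)), smul_eq_mul]
    generalize lintegral (volume : Measure (EuclideanSpace ℝ (Fin d))) _ = I
    rw [← mul_assoc, ← mul_assoc,
      ← ENNReal.ofReal_mul (by positivity), ← ENNReal.ofReal_mul (by positivity)]
    have : |(LinearMap.det f)⁻¹|⁻¹ * Real.exp (b ⬝ᵥ m / 2) * |(LinearMap.det f)⁻¹| *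
        Real.exp (-(b ⬝ᵥ m / 2)) = 1 := by
      have h3 : |(LinearMap.det f)⁻¹| ≠ 0 := by positivity
      rw [Real.exp_neg]
      field_simp
    rw [this, ENNReal.ofReal_one, one_mul]

end PSRL

end

noncomputable section

namespace PSRL

/-! ### The squared operator norm of a Gaussian matrix -/

/-- The exponent `1/4` lies below the critical `1/2`, so a factor `exp (-x²/4)` of the Gaussian
density survives. -/
lemma lintegral_exp_sq_div_four_lt_top :
    ∫⁻ x, ENNReal.ofReal (Real.exp (x ^ 2 / 4)) ∂(gaussianReal 0 1) < ∞ := by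
  rw [gaussianReal_of_var_ne_zero _ one_ne_zero,
    lintegral_withDensity_eq_lintegral_mul _ (measurable_gaussianPDF 0 1) (by fun_prop)]
  have h : ∀ x : ℝ, (gaussianPDF 0 1 * fun x => ENNReal.ofReal (Real.exp (x ^ 2 / 4))) x =
      ENNReal.ofReal ((√(2 * Real.pi * (1 : ℝ≥0)))⁻¹ * Real.exp (-(1 / 4) * x ^ 2)) := by
    intro x
    rw [Pi.mul_apply, gaussianPDF, ← ENNReal.ofReal_mul (gaussianPDFReal_nonneg _ _ _),
      gaussianPDFReal, mul_assoc, ← Real.exp_add]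
    congr 3
    simp
    ring
  simp_rw [h]
  exact ((integrable_exp_neg_mul_sq (by norm_num)).const_mul _).lintegral_lt_top

/-- The Gaussian exponential moment `E exp(x² / 4)`. -/
def expSqMoment : ℝ :=
  (∫⁻ x, ENNReal.ofReal (Real.exp (x ^ 2 / 4)) ∂(gaussianReal 0 1)).toReal

lemma ofReal_expSqMoment :
    ENNReal.ofReal expSqMoment =
      ∫⁻ x, ENNReal.ofReal (Real.exp (x ^ 2 / 4)) ∂(gaussianReal 0 1) :=
  ENNReal.ofReal_toReal lintegral_exp_sq_div_four_lt_top.ne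

lemma one_le_expSqMoment : 1 ≤ expSqMoment := by
  have h : ENNReal.ofReal 1 ≤ ENNReal.ofReal expSqMoment := by
    rw [ofReal_expSqMoment]
    calc ENNReal.ofReal 1 = ∫⁻ _x : ℝ, 1 ∂(gaussianReal 0 1) := by simp
      _ ≤ _ := lintegral_mono fun x => by
        rw [← ENNReal.ofReal_one]
        exact ENNReal.ofReal_le_ofReal (Real.one_le_exp (by positivity))
  exact (ENNReal.ofReal_le_ofReal_iff' .. |>.1 h).resolve_right (by norm_num)

/-- The variable `⟨z, v⟩` is distributed as `‖v‖` times a standard normal, as the characteristic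
functions show. -/
lemma lintegral_exp_inner_sq_le {E : Type*} [NormedAddCommGroup E] [InnerProductSpace ℝ E]
    [FiniteDimensional ℝ E] [MeasurableSpace E] [BorelSpace E] {v : E} (hv : ‖v‖ ≤ 1) :
    ∫⁻ z, ENNReal.ofReal (Real.exp (inner ℝ z v ^ 2 / 4)) ∂(stdGaussian E) ≤
      ENNReal.ofReal expSqMoment := by
  have h1 : (stdGaussian E).map (fun z => inner ℝ z v) = (gaussianReal 0 1).map (fun x => ‖v‖ * x) := by
    apply Measure.ext_of_charFun
    ext t
    rw [gaussianReal_map_const_mul, charFun_gaussianReal, charFun_apply, integral_map (by fun_prop)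
      (by fun_prop)]
    have : ∀ z : E, inner ℝ (inner ℝ z v) t = inner ℝ z (t • v) := by
      intro z; simp [inner_smul_right]
    simp_rw [this]
    rw [← charFun_apply, charFun_stdGaussian, norm_smul]
    congr 1
    have ht : ((|t| : ℝ) : ℂ) ^ 2 = (t : ℂ) ^ 2 := by
      rw [← Complex.ofReal_pow, sq_abs, Complex.ofReal_pow]
    simp [mul_pow, ht]
    ring
  rw [ofReal_expSqMoment, ← lintegral_map (f := fun x => ENNReal.ofReal (Real.exp (x ^ 2 / 4)))
    (by fun_prop) (by fun_prop), h1, lintegral_map (by fun_prop) (by fun_prop)]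
  refine lintegral_mono fun x => ENNReal.ofReal_le_ofReal (Real.exp_le_exp.2 ?_)
  rw [mul_pow]
  have : ‖v‖ ^ 2 ≤ 1 := pow_le_one₀ (norm_nonneg _) hv
  nlinarith [sq_nonneg x]

/-- The squared length of the image of `v` under the matrix with rows `ζ j`. -/
def rowsSq {ι E : Type*} [Fintype ι] [NormedAddCommGroup E] [InnerProductSpace ℝ E]
    (ζ : ι → E) (v : E) : ℝ := ∑ j, inner ℝ (ζ j) v ^ 2

section

variable {ι E : Type*} [Fintype ι] [NormedAddCommGroup E] [InnerProductSpace ℝ E]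

lemma rowsSq_add_le (ζ : ι → E) (v w : E) :
    rowsSq ζ (v + w) ≤ 2 * rowsSq ζ v + 2 * rowsSq ζ w := by
  rw [rowsSq, rowsSq, rowsSq, Finset.mul_sum, Finset.mul_sum, ← Finset.sum_add_distrib]
  refine Finset.sum_le_sum fun j _ => ?_
  rw [inner_add_right]
  nlinarith [sq_nonneg (inner ℝ (ζ j) v - inner ℝ (ζ j) w)]

variable [FiniteDimensional ℝ E] [MeasurableSpace E] [BorelSpace E]

lemma measurable_rowsSq : Measurable fun p : (ι → E) × E => rowsSq p.1 p.2 := by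
  unfold rowsSq; fun_prop

/-- A volume argument in place of a net. Since `v = (v/2 + w) + (v/2 - w)`, for each `w` one of the
two summands has `rowsSq` at least a quarter of that of `v`. Averaging over the ball of radius `1/2`
bounds the value at any single `v` by an integral over the unit ball that does not depend on `v`;
the change of radius costs `2 ^ d`, the two signs another factor `2`. -/
lemma exp_rowsSq_le (ζ : ι → E) {v : E} (hv : ‖v‖ ≤ 1) :
    ENNReal.ofReal (Real.exp (rowsSq ζ v / 16)) * volume (Metric.ball (0 : E) 1) ≤
      ENNReal.ofReal (2 ^ (Module.finrank ℝ E + 1)) *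
        ∫⁻ w in Metric.ball (0 : E) 1, ENNReal.ofReal (Real.exp (rowsSq ζ w / 4)) := by
  set f : E → ℝ≥0∞ := fun w => ENNReal.ofReal (Real.exp (rowsSq ζ w / 4))
  set u : E := (1 / 2 : ℝ) • v
  have hu : ‖u‖ ≤ 1 / 2 := by
    rw [norm_smul]; norm_num; linarith
  have hf : Measurable f := by
    have := (measurable_rowsSq (ι := ι) (E := E)).comp (measurable_prodMk_left (x := ζ))
    simp only [Function.comp_def] at this
    fun_prop
  have hvol : volume (Metric.ball (0 : E) 1) =
      ENNReal.ofReal (2 ^ Module.finrank ℝ E) * volume (Metric.ball (0 : E) (1 / 2)) := by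
    rw [Measure.addHaar_ball_of_pos volume (0 : E) (by norm_num : (0 : ℝ) < 1 / 2), ← mul_assoc,
      ← ENNReal.ofReal_mul (by positivity), ← mul_pow]
    norm_num
  have hpair : ∀ w, ENNReal.ofReal (Real.exp (rowsSq ζ v / 16)) ≤ f (u + w) + f (u - w) := by
    intro w
    have h1 : rowsSq ζ v ≤ 2 * rowsSq ζ (u + w) + 2 * rowsSq ζ (u - w) := by
      have : v = (u + w) + (u - w) := by
        simp only [u]; module
      conv_lhs => rw [this]
      exact rowsSq_add_le _ _ _
    rcases le_total (rowsSq ζ (u + w)) (rowsSq ζ (u - w)) with h | h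
    · refine le_add_left (ENNReal.ofReal_le_ofReal (Real.exp_le_exp.2 ?_))
      linarith
    · refine le_add_right (ENNReal.ofReal_le_ofReal (Real.exp_le_exp.2 ?_))
      linarith
  have hadd : ∫⁻ w in Metric.ball (0 : E) (1 / 2), f (u + w) ≤
      ∫⁻ w in Metric.ball (0 : E) 1, f w := by
    rw [← lintegral_indicator Metric.isOpen_ball.measurableSet,
      ← lintegral_indicator Metric.isOpen_ball.measurableSet,
      ← lintegral_add_left_eq_self ((Metric.ball (0 : E) 1).indicator f) u]
    refine lintegral_mono fun w => ?_
    by_cases hw : w ∈ Metric.ball (0 : E) (1 / 2)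
    · rw [Set.indicator_of_mem hw, Set.indicator_of_mem]
      rw [mem_ball_zero_iff] at hw ⊢
      linarith [norm_add_le u w]
    · rw [Set.indicator_of_notMem hw]; exact zero_le
  have hsub : ∫⁻ w in Metric.ball (0 : E) (1 / 2), f (u - w) =
      ∫⁻ w in Metric.ball (0 : E) (1 / 2), f (u + w) := by
    rw [← lintegral_indicator Metric.isOpen_ball.measurableSet,
      ← lintegral_indicator Metric.isOpen_ball.measurableSet, ← lintegral_neg_eq_self]
    refine lintegral_congr fun w => ?_
    by_cases hw : w ∈ Metric.ball (0 : E) (1 / 2)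
    · rw [Set.indicator_of_mem hw, Set.indicator_of_mem, sub_neg_eq_add]
      simpa using hw
    · rw [Set.indicator_of_notMem hw, Set.indicator_of_notMem]
      simpa using hw
  calc _ = ENNReal.ofReal (2 ^ Module.finrank ℝ E) *
        ∫⁻ _w in Metric.ball (0 : E) (1 / 2), ENNReal.ofReal (Real.exp (rowsSq ζ v / 16)) := by
        rw [hvol, setLIntegral_const]; ring
    _ ≤ ENNReal.ofReal (2 ^ Module.finrank ℝ E) *
        ∫⁻ w in Metric.ball (0 : E) (1 / 2), (f (u + w) + f (u - w)) := by
        gcongr with w; exact hpair w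
    _ ≤ ENNReal.ofReal (2 ^ Module.finrank ℝ E) *
        (2 * ∫⁻ w in Metric.ball (0 : E) 1, f w) := by
        rw [lintegral_add_left (f := fun w => f (u + w)) (hf.comp (by fun_prop)), hsub, ← two_mul]
        gcongr
    _ = _ := by
        rw [← mul_assoc]
        congr 1
        rw [pow_succ, ENNReal.ofReal_mul (by positivity)]
        norm_num

/-- The supremum is the squared operator norm of a Gaussian matrix. By `exp_rowsSq_le` its
exponential is dominated by an integral whose expectation factors over the rows, and taking a
logarithm leaves a bound linear in `d` and in the number of rows. -/
lemma lintegral_iSup_rowsSq_le :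
    ∫⁻ ζ, (⨆ v : Metric.closedBall (0 : E) 1, ENNReal.ofReal (rowsSq ζ v.1))
        ∂(Measure.pi fun _ : ι => stdGaussian E) ≤
      ENNReal.ofReal (16 * (2 + Module.finrank ℝ E +
        Fintype.card ι * Real.log expSqMoment)) := by
  set d := Module.finrank ℝ E
  set m := Fintype.card ι
  set P := Measure.pi fun _ : ι => stdGaussian E
  have hB : 0 < expSqMoment := lt_of_lt_of_le one_pos one_le_expSqMoment
  have hlog : 0 ≤ Real.log expSqMoment := Real.log_nonneg one_le_expSqMoment
  -- Chosen so that `exp t` is the bound on the expected exponential; the exponential term of the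
  -- linearization below then has expectation at most `1`.
  set t : ℝ := (d + 1) * Real.log 2 + m * Real.log expSqMoment
  have ht : 0 ≤ t := by positivity
  have hexpt : Real.exp t = 2 ^ (d + 1) * expSqMoment ^ m := by
    rw [Real.exp_add, mul_comm _ (Real.log 2), mul_comm _ (Real.log expSqMoment),
      Real.exp_mul, Real.exp_mul, Real.exp_log hB, Real.exp_log two_pos]
    norm_cast
  set V := volume (Metric.ball (0 : E) 1)
  have hV0 : V ≠ 0 := (Metric.measure_ball_pos _ _ one_pos).ne'
  have hVt : V ≠ ∞ := measure_ball_lt_top.ne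
  set X : (ι → E) → ℝ≥0∞ := fun ζ =>
    ∫⁻ w in Metric.ball (0 : E) 1, ENNReal.ofReal (Real.exp (rowsSq ζ w / 4))
  have hjm : Measurable fun p : (ι → E) × E => ENNReal.ofReal (Real.exp (rowsSq p.1 p.2 / 4)) := by
    have := measurable_rowsSq (ι := ι) (E := E)
    fun_prop
  have hX : Measurable X := hjm.lintegral_prod_right'
  have hEX : ∫⁻ ζ, X ζ ∂P ≤ ENNReal.ofReal (expSqMoment ^ m) * V := by
    calc ∫⁻ ζ, X ζ ∂P = ∫⁻ w in Metric.ball (0 : E) 1, ∫⁻ ζ,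
          ENNReal.ofReal (Real.exp (rowsSq ζ w / 4)) ∂P := lintegral_lintegral_swap hjm.aemeasurable
      _ ≤ ∫⁻ _w in Metric.ball (0 : E) 1, ENNReal.ofReal (expSqMoment ^ m) := by
          refine setLIntegral_mono' Metric.isOpen_ball.measurableSet fun w hw => ?_
          have : ∀ ζ : ι → E, ENNReal.ofReal (Real.exp (rowsSq ζ w / 4)) =
              ∏ j, ENNReal.ofReal (Real.exp (inner ℝ (ζ j) w ^ 2 / 4)) := by
            intro ζ
            rw [rowsSq, Finset.sum_div, Real.exp_sum,
              ENNReal.ofReal_prod_of_nonneg fun i _ => (Real.exp_pos _).le]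
          simp_rw [this]
          rw [lintegral_pi_prod (fun _ : ι => stdGaussian E)
            (fun _ z => ENNReal.ofReal (Real.exp (inner ℝ z w ^ 2 / 4))) (fun _ => by fun_prop)]
          calc _ ≤ ∏ _j : ι, ENNReal.ofReal expSqMoment := Finset.prod_le_prod' fun j _ =>
                lintegral_exp_inner_sq_le (mem_ball_zero_iff.1 hw).le
            _ = _ := by
              rw [Finset.prod_const, Finset.card_univ, ENNReal.ofReal_pow hB.le]
      _ = _ := by rw [setLIntegral_const]
  have hpt : ∀ ζ, (⨆ v : Metric.closedBall (0 : E) 1, ENNReal.ofReal (rowsSq ζ v.1)) ≤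
      16 * (ENNReal.ofReal (Real.exp (-t)) *
        (ENNReal.ofReal (2 ^ (d + 1)) * X ζ * V⁻¹) + ENNReal.ofReal t) := by
    intro ζ
    refine iSup_le fun ⟨v, hv⟩ => ?_
    rw [mem_closedBall_zero_iff] at hv
    have h1 : ENNReal.ofReal (Real.exp (rowsSq ζ v / 16)) ≤
        ENNReal.ofReal (2 ^ (d + 1)) * X ζ * V⁻¹ := by
      rw [← div_eq_mul_inv, ENNReal.le_div_iff_mul_le (Or.inl hV0) (Or.inl hVt)]
      exact exp_rowsSq_le ζ hv
    -- The tangent-line bound `y ≤ exp (y - t) + t` plays the part of Jensen's inequality for the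
    -- logarithm.
    have h2 : rowsSq ζ v / 16 ≤ Real.exp (-t) * Real.exp (rowsSq ζ v / 16) + t := by
      rw [← Real.exp_add]
      linarith [Real.add_one_le_exp (-t + rowsSq ζ v / 16)]
    calc ENNReal.ofReal (rowsSq ζ v) = 16 * ENNReal.ofReal (rowsSq ζ v / 16) := by
          rw [show (16 : ℝ≥0∞) = ENNReal.ofReal 16 by norm_num, ← ENNReal.ofReal_mul (by norm_num)]
          congr 1; ring
      _ ≤ 16 * (ENNReal.ofReal (Real.exp (-t)) * ENNReal.ofReal (Real.exp (rowsSq ζ v / 16)) +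
            ENNReal.ofReal t) := by
          rw [← ENNReal.ofReal_mul (Real.exp_pos _).le, ← ENNReal.ofReal_add (by positivity) ht]
          gcongr
      _ ≤ _ := by gcongr
  calc _ ≤ ∫⁻ ζ, 16 * (ENNReal.ofReal (Real.exp (-t)) *
        (ENNReal.ofReal (2 ^ (d + 1)) * X ζ * V⁻¹) + ENNReal.ofReal t) ∂P := lintegral_mono hpt
    _ = 16 * (ENNReal.ofReal (Real.exp (-t)) *
        (ENNReal.ofReal (2 ^ (d + 1)) * (∫⁻ ζ, X ζ ∂P) * V⁻¹) + ENNReal.ofReal t) := by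
        rw [lintegral_const_mul _ (by fun_prop), lintegral_add_right _ measurable_const,
          lintegral_const_mul _ (by fun_prop), lintegral_mul_const _ (by fun_prop),
          lintegral_const_mul _ hX, lintegral_const]
        simp
    _ ≤ 16 * (ENNReal.ofReal (Real.exp (-t)) *
        (ENNReal.ofReal (2 ^ (d + 1)) * (ENNReal.ofReal (expSqMoment ^ m) * V) * V⁻¹) +
          ENNReal.ofReal t) := by gcongr
    _ = 16 * (1 + ENNReal.ofReal t) := by
        rw [← mul_assoc (ENNReal.ofReal (2 ^ (d + 1))), mul_assoc _ V, ENNReal.mul_inv_cancel hV0 hVt,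
          mul_one, ← ENNReal.ofReal_mul (by positivity), ← hexpt,
          ← ENNReal.ofReal_mul (Real.exp_pos _).le, ← Real.exp_add]
        simp
    _ = ENNReal.ofReal (16 * (1 + t)) := by
        rw [ENNReal.ofReal_mul (by norm_num), ENNReal.ofReal_add zero_le_one ht]
        norm_num
    _ ≤ _ := by
        refine ENNReal.ofReal_le_ofReal ?_
        have : Real.log 2 ≤ 1 := by linarith [Real.log_two_lt_d9]
        have h3 : ((d : ℝ) + 1) * Real.log 2 ≤ (d + 1) * 1 := by gcongr
        simp only [t]
        linarith

end

end PSRL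

end

noncomputable section

namespace PSRL

/-! ### The elliptical potential -/

section Elliptic

open Matrix
open scoped MatrixOrder

variable {d : ℕ}

/-- Evaluation of the characteristic polynomial at `-1`; bounds on the determinant reduce to bounds
on eigenvalues. -/
lemma det_one_add_eq_prod {M : Matrix (Fin d) (Fin d) ℝ} (hM : M.IsHermitian) :
    (1 + M).det = ∏ i, (1 + hM.eigenvalues i) := by
  have h := congrArg (Polynomial.eval (-1)) hM.charpoly_eq
  rw [Matrix.eval_charpoly, Polynomial.eval_prod] at h
  have h1 : (scalar (Fin d)) (-1 : ℝ) - M = -(1 + M) := by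
    rw [map_neg, map_one]; abel
  rw [h1, det_neg] at h
  have h2 : ∏ i, Polynomial.eval (-1) (Polynomial.X - Polynomial.C ((hM.eigenvalues i : ℝ))) =
      (-1) ^ d * ∏ i, (1 + hM.eigenvalues i) := by
    have : ((-1 : ℝ)) ^ d = ∏ _i : Fin d, (-1 : ℝ) := by simp
    rw [this, ← Finset.prod_mul_distrib]
    refine Finset.prod_congr rfl fun i _ => ?_
    simp; ring
  erw [h2] at h
  rw [Fintype.card_fin] at h
  exact mul_left_cancel₀ (pow_ne_zero _ (by norm_num)) h

lemma one_add_sum_le_prod_one_add {ι : Type*} (s : Finset ι) {f : ι → ℝ} (hf : ∀ i, 0 ≤ f i) :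
    1 + ∑ i ∈ s, f i ≤ ∏ i ∈ s, (1 + f i) := by
  induction s using Finset.cons_induction with
  | empty => simp
  | cons a s ha ih =>
    rw [Finset.sum_cons, Finset.prod_cons]
    have := Finset.sum_nonneg fun i (_ : i ∈ s) => hf i
    nlinarith [hf a, mul_nonneg (hf a) this, mul_le_mul_of_nonneg_left ih (hf a)]

lemma one_add_trace_le_det {M : Matrix (Fin d) (Fin d) ℝ} (hM : M.PosSemidef) :
    1 + M.trace ≤ (1 + M).det := by
  rw [det_one_add_eq_prod hM.1, hM.1.trace_eq_sum_eigenvalues]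
  exact one_add_sum_le_prod_one_add _ hM.eigenvalues_nonneg

/-- Each eigenvalue is at most the trace. This is cruder than the inequality of means, but only
inside a logarithm. -/
lemma det_one_add_le {M : Matrix (Fin d) (Fin d) ℝ} (hM : M.PosSemidef) :
    (1 + M).det ≤ (1 + M.trace) ^ d := by
  rw [det_one_add_eq_prod hM.1, hM.1.trace_eq_sum_eigenvalues]
  calc _ ≤ ∏ _i : Fin d, (1 + ∑ i, (hM.1.eigenvalues i : ℝ)) := by
        refine Finset.prod_le_prod (fun i _ => ?_) fun i _ => ?_
        · linarith [hM.eigenvalues_nonneg i]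
        · have := Finset.single_le_sum (fun j _ => hM.eigenvalues_nonneg j) (Finset.mem_univ i)
          simpa using this
    _ = _ := by simp

variable (Sg : Matrix (Fin d) (Fin d) ℝ)

/-- The posterior variance in direction `φ`, up to the noise variance, of the Bayesian regression
with prior covariance `Sg` and data precision `A`. -/
def postVar (A : Matrix (Fin d) (Fin d) ℝ) (φ : Fin d → ℝ) : ℝ :=
  φ ⬝ᵥ (Sg *ᵥ ((1 + A * Sg)⁻¹ *ᵥ φ))

/-- The log-determinant potential. -/
def logDet (A : Matrix (Fin d) (Fin d) ℝ) : ℝ := Real.log (1 + A * Sg).det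

variable {Sg}

/-- By Sylvester's determinant identity everything can be expressed through the symmetric matrix `S
A S` with `S = √Sg`. The prior covariance is never inverted and may be singular. -/
lemma exists_whitening (hSg : Sg.PosSemidef) {A : Matrix (Fin d) (Fin d) ℝ} (hA : A.PosSemidef) :
    ∃ S, Sᵀ = S ∧ S * S = Sg ∧ (S * A * S).PosSemidef ∧ (1 + A * Sg).det = (1 + S * A * S).det ∧
      0 < (1 + A * Sg).det := by
  obtain ⟨h1, h2⟩ := exists_sqrt_matrix hSg
  set S := CFC.sqrt Sg
  have h3 : (S * A * S).PosSemidef := by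
    have := hA.mul_mul_conjTranspose_same S
    rwa [conjTranspose_eq_transpose_of_trivial, h1] at this
  have h4 : (1 + A * Sg).det = (1 + S * A * S).det := by
    rw [← h2, ← Matrix.mul_assoc, det_one_add_mul_comm, Matrix.mul_assoc]
  exact ⟨S, h1, h2, h3, h4, h4 ▸ (PosDef.one.add_posSemidef h3).det_pos⟩

lemma logDet_le (hSg : Sg.PosSemidef) {A : Matrix (Fin d) (Fin d) ℝ} (hA : A.PosSemidef) :
    logDet Sg A ≤ d * Real.log (1 + (A * Sg).trace) := by
  obtain ⟨S, h1, h2, h3, h4, h5⟩ := exists_whitening hSg hA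
  have htr : (A * Sg).trace = (S * A * S).trace := by
    rw [← h2, ← Matrix.mul_assoc, trace_mul_comm, Matrix.mul_assoc]
  have h6 : 0 ≤ (S * A * S).trace := h3.trace_nonneg
  rw [logDet, htr, ← Real.log_pow]
  refine Real.log_le_log h5 ?_
  rw [h4]
  exact det_one_add_le h3

lemma dotProduct_self_nonneg (x : Fin d → ℝ) : 0 ≤ x ⬝ᵥ x :=
  Finset.sum_nonneg fun i _ => mul_self_nonneg (x i)

lemma dotProduct_mulVec_symm {M : Matrix (Fin d) (Fin d) ℝ} (hM : Mᵀ = M) (x y : Fin d → ℝ) :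
    x ⬝ᵥ M *ᵥ y = (M *ᵥ x) ⬝ᵥ y := by
  rw [dotProduct_mulVec, ← mulVec_transpose, hM]

lemma posSemidef_outer_sum {n : ℕ} {s : ℝ} (hs : 0 ≤ s) (φ : Fin n → Fin d → ℝ) :
    (s • ∑ i, vecMulVec (φ i) (φ i)).PosSemidef := by
  refine PosSemidef.smul (posSemidef_sum _ fun i _ => ?_) hs
  simpa using posSemidef_vecMulVec_self_star (φ i)

/-- Directions are parametrized as `φ = α + A Sg α`; this is the form in which `devNum` and `devDen`
test them. -/
lemma inv_mulVec_add {A : Matrix (Fin d) (Fin d) ℝ} (h : 0 < (1 + A * Sg).det) (φ : Fin d → ℝ) :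
    (1 + A * Sg)⁻¹ *ᵥ φ + A *ᵥ (Sg *ᵥ ((1 + A * Sg)⁻¹ *ᵥ φ)) = φ := by
  have : (1 + A * Sg) *ᵥ ((1 + A * Sg)⁻¹ *ᵥ φ) = φ := by
    rw [mulVec_mulVec, mul_nonsing_inv _ h.ne'.isUnit, one_mulVec]
  rw [add_mulVec, one_mulVec, ← mulVec_mulVec] at this
  exact this

/-- In whitened coordinates the posterior variance is the quadratic form of `(1 + S A S)⁻¹` at `S
φ`; the vector `a` stands for `(1 + S A S)⁻¹ S φ`. -/
lemma postVar_eq {A S : Matrix (Fin d) (Fin d) ℝ} (hS : Sᵀ = S) (hSS : S * S = Sg)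
    (h : 0 < (1 + A * Sg).det) (φ : Fin d → ℝ) :
    ∃ a : Fin d → ℝ, (1 + S * A * S) *ᵥ a = S *ᵥ φ ∧ postVar Sg A φ = (S *ᵥ φ) ⬝ᵥ a := by
  have h1 := congrArg (S *ᵥ ·) (inv_mulVec_add h φ)
  refine ⟨S *ᵥ ((1 + A * Sg)⁻¹ *ᵥ φ), ?_, ?_⟩
  · rw [add_mulVec, one_mulVec, ← h1, ← hSS]
    simp only [mulVec_add, mulVec_mulVec, Matrix.mul_assoc]
  · rw [postVar, ← dotProduct_mulVec_symm hS, mulVec_mulVec _ S S, hSS]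

lemma postVar_nonneg (hSg : Sg.PosSemidef) {A : Matrix (Fin d) (Fin d) ℝ}
    (hA : A.PosSemidef) (φ : Fin d → ℝ) : 0 ≤ postVar Sg A φ := by
  obtain ⟨S, h1, h2, h3, h4, h5⟩ := exists_whitening hSg hA
  obtain ⟨a, ha, hD⟩ := postVar_eq h1 h2 h5 φ
  rw [hD, ← ha, dotProduct_comm, add_mulVec, one_mulVec, dotProduct_add]
  exact add_nonneg (dotProduct_self_nonneg a) (by simpa using h3.dotProduct_mulVec_nonneg a)

/-- Data only reduce the variance. With `a` as in `postVar_eq`, `|a|² ≤ Sφ·a`, and expanding `|Sφ -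
a|² ≥ 0` gives `Sφ·a ≤ |Sφ|²`. -/
lemma postVar_le (hSg : Sg.PosSemidef) {A : Matrix (Fin d) (Fin d) ℝ}
    (hA : A.PosSemidef) (φ : Fin d → ℝ) : postVar Sg A φ ≤ φ ⬝ᵥ Sg *ᵥ φ := by
  obtain ⟨S, h1, h2, h3, h4, h5⟩ := exists_whitening hSg hA
  obtain ⟨a, ha, hD⟩ := postVar_eq h1 h2 h5 φ
  have e1 : a ⬝ᵥ a ≤ (S *ᵥ φ) ⬝ᵥ a := by
    rw [← ha, add_mulVec, one_mulVec, add_dotProduct, dotProduct_comm (_ *ᵥ a) a]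
    have : 0 ≤ a ⬝ᵥ (S * A * S) *ᵥ a := by simpa using h3.dotProduct_mulVec_nonneg a
    linarith
  have e2 : 0 ≤ (S *ᵥ φ - a) ⬝ᵥ (S *ᵥ φ - a) := dotProduct_self_nonneg _
  have e3 : φ ⬝ᵥ Sg *ᵥ φ = (S *ᵥ φ) ⬝ᵥ (S *ᵥ φ) := by
    rw [← dotProduct_mulVec_symm h1, mulVec_mulVec, h2]
  rw [sub_dotProduct, dotProduct_sub, dotProduct_sub, dotProduct_comm a] at e2
  rw [hD, e3]
  linarith

/-- A batch form, with all variances frozen before the batch. Adding the batch multiplies the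
determinant by `det (1 + M)`, where `M` is positive semidefinite with trace `x = s ∑ postVar`, so
the potential grows by at least `log (1 + x) ≥ x / (1 + x)`. As variances do not exceed those of the
prior, `x ≤ n κ s`, and the factor `1 + n κ s` is the price of the delayed update. -/
lemma elliptic_potential (hSg : Sg.PosSemidef) {A : Matrix (Fin d) (Fin d) ℝ}
    (hA : A.PosSemidef) {n : ℕ} {s κ : ℝ} (hs : 0 ≤ s) (φ : Fin n → Fin d → ℝ)
    (hφ : ∀ i, φ i ⬝ᵥ Sg *ᵥ φ i ≤ κ) :
    s * ∑ i, postVar Sg A (φ i) ≤ (1 + n * κ * s) *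
      (logDet Sg (A + s • ∑ i, vecMulVec (φ i) (φ i)) - logDet Sg A) := by
  obtain ⟨S, h1, h2, h3, h4, h5⟩ := exists_whitening hSg hA
  have hQ : (1 + S * A * S).PosDef := PosDef.one.add_posSemidef h3
  obtain ⟨hBt, hBB⟩ := exists_sqrt_matrix hQ.posSemidef
  set B := CFC.sqrt (1 + S * A * S)
  choose a ha hD using fun i => postVar_eq h1 h2 h5 (φ i)
  set u : Fin n → Fin d → ℝ := fun i => B *ᵥ a i
  have hBu : ∀ i, B *ᵥ u i = S *ᵥ φ i := fun i => by
    rw [mulVec_mulVec, hBB, ha]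
  have huu : ∀ i, u i ⬝ᵥ u i = postVar Sg A (φ i) := fun i => by
    rw [hD, ← ha, ← hBB, ← mulVec_mulVec, ← dotProduct_mulVec_symm hBt, dotProduct_comm]
  set M := s • ∑ i, vecMulVec (u i) (u i)
  have hM : M.PosSemidef := posSemidef_outer_sum hs u
  have htr : M.trace = s * ∑ i, postVar Sg A (φ i) := by
    simp only [M, trace_smul, trace_sum, trace_vecMulVec, smul_eq_mul, huu]
  have hconj : ∀ {C : Matrix (Fin d) (Fin d) ℝ}, Cᵀ = C → ∀ x : Fin d → ℝ,
      vecMulVec (C *ᵥ x) (C *ᵥ x) = C * vecMulVec x x * C := by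
    intro C hC x
    rw [mul_vecMulVec, vecMulVec_mul, ← mulVec_transpose, hC]
  have hdet : (1 + (A + s • ∑ i, vecMulVec (φ i) (φ i)) * Sg).det =
      (1 + A * Sg).det * (1 + M).det := by
    have e1 : S * (A + s • ∑ i, vecMulVec (φ i) (φ i)) * S =
        S * A * S + B * M * B := by
      simp only [M, Matrix.mul_add, Matrix.add_mul, Matrix.mul_smul, Matrix.smul_mul, Matrix.mul_sum,
        Matrix.sum_mul, ← hconj h1, ← hconj hBt, hBu]
    have e2 : 1 + (S * A * S + B * M * B) = B * (1 + M) * B := by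
      rw [Matrix.mul_add, Matrix.add_mul, Matrix.mul_one, hBB, add_assoc]
    rw [← h2, ← Matrix.mul_assoc, det_one_add_mul_comm, ← Matrix.mul_assoc, e1, e2, det_mul, det_mul,
      h2, h4, ← hBB, det_mul]
    ring
  set x := s * ∑ i, postVar Sg A (φ i)
  have hx : 0 ≤ x := mul_nonneg hs (Finset.sum_nonneg fun i _ => postVar_nonneg hSg hA _)
  have hxX : x ≤ n * κ * s := by
    have : ∑ i, postVar Sg A (φ i) ≤ n * κ := by
      calc _ ≤ ∑ _i : Fin n, κ := Finset.sum_le_sum fun i _ => (postVar_le hSg hA _).trans (hφ i)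
        _ = _ := by simp
    calc x ≤ s * (n * κ) := mul_le_mul_of_nonneg_left this hs
      _ = _ := by ring
  have h1M : 1 + x ≤ (1 + M).det := by
    rw [← htr]; exact one_add_trace_le_det hM
  have hlog : x / (1 + x) ≤ Real.log (1 + M).det := by
    calc x / (1 + x) = 1 - (1 + x)⁻¹ := by field_simp; ring
      _ ≤ Real.log (1 + x) := Real.one_sub_inv_le_log_of_pos (by linarith)
      _ ≤ _ := Real.log_le_log (by linarith) h1M
  rw [logDet, logDet, hdet, Real.log_mul h5.ne' (by linarith), add_sub_cancel_left]
  rw [div_le_iff₀ (by linarith)] at hlog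
  have : 0 ≤ Real.log (1 + M).det := Real.log_nonneg (by linarith)
  nlinarith

end Elliptic

end PSRL

end

noncomputable section

namespace PSRL

/-! ### The deviation from the posterior mean in Bayesian linear regression

The data of a regression with `ι` outputs enter through a precision matrix `A` and vectors `b j`. -/

section Deviation

open Matrix
open scoped MatrixOrder

variable {d : ℕ} {ι : Type*} [Fintype ι]

/-- Log-likelihood of the weights `W`, as a quadratic function. -/
def logLik (A : Matrix (Fin d) (Fin d) ℝ) (b W : ι → Fin d → ℝ) : ℝ :=
  ∑ j, (b j ⬝ᵥ W j - W j ⬝ᵥ A *ᵥ W j / 2)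

variable (Sg : Matrix (Fin d) (Fin d) ℝ)

/-- Squared distance from the posterior mean, tested in the direction with dual vector `α`. -/
def devNum (A : Matrix (Fin d) (Fin d) ℝ) (b W : ι → Fin d → ℝ) (α : Fin d → ℝ) : ℝ :=
  ∑ j, (W j ⬝ᵥ (α + A *ᵥ (Sg *ᵥ α)) - b j ⬝ᵥ (Sg *ᵥ α)) ^ 2

/-- Posterior variance in the direction with dual vector `α`. -/
def devDen (A : Matrix (Fin d) (Fin d) ℝ) (α : Fin d → ℝ) : ℝ :=
  (Sg *ᵥ α) ⬝ᵥ (α + A *ᵥ (Sg *ᵥ α))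

/-- Squared distance of the weights from the posterior mean, normalized by the posterior
variance, in the worst direction. -/
def devSq (A : Matrix (Fin d) (Fin d) ℝ) (b W : ι → Fin d → ℝ) : ℝ≥0∞ :=
  ⨆ n, ENNReal.ofReal (devNum Sg A b W (TopologicalSpace.denseSeq (Fin d → ℝ) n)) /
    ENNReal.ofReal (devDen Sg A (TopologicalSpace.denseSeq (Fin d → ℝ) n))

section Measurability

variable {X : Type*} [MeasurableSpace X] {A : X → Matrix (Fin d) (Fin d) ℝ}
  {b W : X → ι → Fin d → ℝ}

lemma measurable_logLik (hA : ∀ i j, Measurable fun x => A x i j) (hb : Measurable b)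
    (hW : Measurable W) : Measurable fun x => logLik (A x) (b x) (W x) := by
  have hb' : ∀ j i, Measurable fun x => b x j i := fun j i => by fun_prop
  have hW' : ∀ j i, Measurable fun x => W x j i := fun j i => by fun_prop
  simp only [logLik, dotProduct, mulVec]
  fun_prop

lemma measurable_devSq (hA : ∀ i j, Measurable fun x => A x i j) (hb : Measurable b)
    (hW : Measurable W) : Measurable fun x => devSq Sg (A x) (b x) (W x) := by
  have hb' : ∀ j i, Measurable fun x => b x j i := fun j i => by fun_prop
  have hW' : ∀ j i, Measurable fun x => W x j i := fun j i => by fun_prop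
  simp only [devSq, devNum, devDen, dotProduct, mulVec, Pi.add_apply]
  fun_prop

end Measurability

variable {Sg}

/-- The supremum in `devSq` runs over a dense sequence for the sake of measurability; continuity
extends the bound to all directions. A positive number divided by zero is `∞`, hence finiteness of
`devSq` also controls directions of zero variance. -/
lemma devNum_le (A : Matrix (Fin d) (Fin d) ℝ) (b W : ι → Fin d → ℝ)
    (h : devSq Sg A b W ≠ ∞) (α : Fin d → ℝ) (hden : ∀ α, 0 ≤ devDen Sg A α) :
    devNum Sg A b W α ≤ (devSq Sg A b W).toReal * devDen Sg A α := by
  refine (TopologicalSpace.denseRange_denseSeq (Fin d → ℝ)).induction_on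
    (p := fun α => devNum Sg A b W α ≤ (devSq Sg A b W).toReal * devDen Sg A α) α ?_ fun n => ?_
  · have c1 : Continuous fun α => devNum Sg A b W α := by
      simp only [devNum, dotProduct, mulVec, Pi.add_apply]; fun_prop
    have c2 : Continuous fun α => devDen Sg A α := by
      simp only [devDen, dotProduct, mulVec, Pi.add_apply]; fun_prop
    exact isClosed_le c1 (c2.const_mul _)
  · have h1 := le_iSup (fun n => ENNReal.ofReal
      (devNum Sg A b W (TopologicalSpace.denseSeq (Fin d → ℝ) n)) /
        ENNReal.ofReal (devDen Sg A (TopologicalSpace.denseSeq (Fin d → ℝ) n))) n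
    change _ ≤ devSq Sg A b W at h1
    rw [ENNReal.div_le_iff_le_mul (Or.inr h) (Or.inl ENNReal.ofReal_ne_top),
      ← ENNReal.ofReal_toReal h, ← ENNReal.ofReal_mul ENNReal.toReal_nonneg] at h1
    exact (ENNReal.ofReal_le_ofReal_iff (mul_nonneg ENNReal.toReal_nonneg (hden _))).1 h1

lemma devDen_nonneg (hSg : Sg.PosSemidef) {A : Matrix (Fin d) (Fin d) ℝ} (hA : A.PosSemidef)
    (α : Fin d → ℝ) : 0 ≤ devDen Sg A α := by
  rw [devDen, dotProduct_add, dotProduct_comm _ α]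
  exact add_nonneg (by simpa using hSg.dotProduct_mulVec_nonneg α)
    (by simpa using hA.dotProduct_mulVec_nonneg (Sg *ᵥ α))

/-- Two weight matrices differ in direction `φ` by at most their distances from the posterior
mean. -/
lemma sum_sq_sub_dotProduct_le (hSg : Sg.PosSemidef) {A : Matrix (Fin d) (Fin d) ℝ}
    (hA : A.PosSemidef) (b W W' : ι → Fin d → ℝ) (h : devSq Sg A b W ≠ ∞)
    (h' : devSq Sg A b W' ≠ ∞) (φ : Fin d → ℝ) :
    ∑ j, ((W' j - W j) ⬝ᵥ φ) ^ 2 ≤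
      2 * ((devSq Sg A b W').toReal + (devSq Sg A b W).toReal) * postVar Sg A φ := by
  obtain ⟨S, h1, h2, h3, h4, h5⟩ := exists_whitening hSg hA
  -- For this `α` the tested direction is `φ`, the number `b j · Sg α` is the posterior mean of `W j
  -- · φ`, and `devDen` is the posterior variance. The two weight matrices are compared through
  -- their common mean, whence the factor `2`.
  set α := (1 + A * Sg)⁻¹ *ᵥ φ
  have hα : α + A *ᵥ (Sg *ᵥ α) = φ := inv_mulVec_add h5 φ
  have hd : devDen Sg A α = postVar Sg A φ := by rw [devDen, hα, postVar, dotProduct_comm]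
  have e1 := devNum_le A b W h α (devDen_nonneg hSg hA)
  have e2 := devNum_le A b W' h' α (devDen_nonneg hSg hA)
  rw [hd] at e1 e2
  have : ∑ j, ((W' j - W j) ⬝ᵥ φ) ^ 2 ≤ 2 * devNum Sg A b W' α + 2 * devNum Sg A b W α := by
    rw [devNum, devNum, hα, Finset.mul_sum, Finset.mul_sum, ← Finset.sum_add_distrib]
    refine Finset.sum_le_sum fun j _ => ?_
    rw [sub_dotProduct]
    nlinarith [sq_nonneg ((W' j ⬝ᵥ φ - b j ⬝ᵥ Sg *ᵥ α) + (W j ⬝ᵥ φ - b j ⬝ᵥ Sg *ᵥ α))]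
  linarith

/-- The hypothesis on `z` says that `B ζ j` is `1 + S A S` applied to the distance of `z j` from its
posterior mean. In the direction `u = B S α` the numerator of the deviation is then `rowsSq ζ u` and
the denominator `‖u‖²`, so the quotient is a value of `rowsSq` at a unit vector. -/
lemma devSq_mulVec_le {A B S : Matrix (Fin d) (Fin d) ℝ} (hS : Sᵀ = S) (hSS : S * S = Sg)
    (hB : Bᵀ = B) (hBB : B * B = 1 + S * A * S)
    (b z : ι → Fin d → ℝ) (ζ : ι → EuclideanSpace ℝ (Fin d))
    (hz : ∀ j a, ((1 + S * A * S) *ᵥ z j - S *ᵥ b j) ⬝ᵥ a = (ζ j).ofLp ⬝ᵥ (B *ᵥ a)) :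
    devSq Sg A b (fun j => S *ᵥ z j) ≤
      ⨆ v : Metric.closedBall (0 : EuclideanSpace ℝ (Fin d)) 1, ENNReal.ofReal (rowsSq ζ v.1) := by
  have hQ : (1 + S * A * S)ᵀ = 1 + S * A * S := by rw [← hBB, transpose_mul, hB]
  refine iSup_le fun n => ?_
  generalize TopologicalSpace.denseSeq (Fin d → ℝ) n = α
  set u : EuclideanSpace ℝ (Fin d) := WithLp.toLp 2 (B *ᵥ (S *ᵥ α))
  have hinner : ∀ j, inner ℝ (ζ j) u = (ζ j).ofLp ⬝ᵥ (B *ᵥ (S *ᵥ α)) := fun j => by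
    rw [EuclideanSpace.inner_eq_star_dotProduct, dotProduct_comm]; rfl
  have e0 : S *ᵥ (α + A *ᵥ (Sg *ᵥ α)) = (1 + S * A * S) *ᵥ (S *ᵥ α) := by
    rw [← hSS]
    simp only [mulVec_add, mulVec_mulVec, Matrix.mul_assoc, Matrix.add_mul, Matrix.one_mul,
      add_mulVec]
  have hnum : devNum Sg A b (fun j => S *ᵥ z j) α = rowsSq ζ u := by
    refine Finset.sum_congr rfl fun j _ => ?_
    have e1 : (S *ᵥ z j) ⬝ᵥ (α + A *ᵥ (Sg *ᵥ α)) = ((1 + S * A * S) *ᵥ z j) ⬝ᵥ (S *ᵥ α) := by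
      rw [← dotProduct_mulVec_symm hS, ← dotProduct_mulVec_symm hQ, e0]
    have e2 : b j ⬝ᵥ Sg *ᵥ α = (S *ᵥ b j) ⬝ᵥ (S *ᵥ α) := by
      rw [← dotProduct_mulVec_symm hS, mulVec_mulVec, hSS]
    rw [hinner, ← hz, sub_dotProduct, e1, e2]
  have hden : devDen Sg A α = ‖u‖ ^ 2 := by
    rw [EuclideanSpace.real_norm_sq_eq]
    have : ∑ i, u i ^ 2 = (B *ᵥ (S *ᵥ α)) ⬝ᵥ (B *ᵥ (S *ᵥ α)) :=
      Finset.sum_congr rfl fun i _ => sq _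
    rw [this, ← dotProduct_mulVec_symm hB, mulVec_mulVec _ B B, hBB, ← e0, dotProduct_mulVec_symm hS,
      mulVec_mulVec, hSS, devDen]
  rw [hnum, hden]
  -- For `u = 0` the quotient is `0 / 0 = 0`.
  by_cases hu : u = 0
  · have : rowsSq ζ u = 0 := by simp [rowsSq, hu]
    simp [this]
  · have hu' : 0 < ‖u‖ := norm_pos_iff.2 hu
    refine le_trans (le_of_eq ?_) (le_iSup _ ⟨(‖u‖⁻¹ : ℝ) • u, by
      rw [mem_closedBall_zero_iff, norm_smul, norm_inv, norm_norm, inv_mul_cancel₀ hu'.ne']⟩)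
    rw [← ENNReal.ofReal_div_of_pos (by positivity)]
    congr 1
    simp only [rowsSq, inner_smul_right, mul_pow, ← Finset.mul_sum]
    field_simp

/-- Tilting independent standard Gaussians by quadratic exponentials. -/
lemma exists_pi_tilt {A : Matrix (Fin d) (Fin d) ℝ} (hA : A.PosSemidef) :
    ∃ B : Matrix (Fin d) (Fin d) ℝ, Bᵀ = B ∧ B * B = 1 + A ∧ ∀ b : ι → Fin d → ℝ,
      ∃ (c : ℝ≥0∞) (T : (ι → EuclideanSpace ℝ (Fin d)) → ι → EuclideanSpace ℝ (Fin d)),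
      (∀ ζ j a, ((1 + A) *ᵥ (T ζ j).ofLp - b j) ⬝ᵥ a = (ζ j).ofLp ⬝ᵥ (B *ᵥ a)) ∧
      ∀ h : (ι → EuclideanSpace ℝ (Fin d)) → ℝ≥0∞, Measurable h →
        ∫⁻ z, h z * ENNReal.ofReal (Real.exp (logLik A b fun j => (z j).ofLp))
            ∂(Measure.pi fun _ : ι => stdGaussian (EuclideanSpace ℝ (Fin d))) =
          c * ∫⁻ ζ, h (T ζ) ∂(Measure.pi fun _ : ι => stdGaussian (EuclideanSpace ℝ (Fin d))) := by
  obtain ⟨B, hB, hBB, hT⟩ := exists_withDensity_tilt hA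
  refine ⟨B, hB, hBB, fun b => ?_⟩
  choose c T hc hTm hTz hTd using fun j => hT (b j)
  set γ := stdGaussian (EuclideanSpace ℝ (Fin d))
  let g : ι → EuclideanSpace ℝ (Fin d) → ℝ≥0∞ := fun j z => ENNReal.ofReal
    (Real.exp (b j ⬝ᵥ z.ofLp - (z.ofLp ⬝ᵥ A *ᵥ z.ofLp) / 2))
  have hg : ∀ j, Measurable (g j) := fun j => by
    simp only [g, dotProduct, mulVec]; fun_prop
  let TT : (ι → EuclideanSpace ℝ (Fin d)) → ι → EuclideanSpace ℝ (Fin d) := fun ζ j => T j (ζ j)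
  have hTT : Measurable TT :=
    measurable_pi_lambda _ fun j => (hTm j).comp (measurable_pi_apply j)
  have hpm (j : ι) : IsProbabilityMeasure (γ.map (T j)) :=
    Measure.isProbabilityMeasure_map (hTm j).aemeasurable
  have hTd' : ∀ j, γ.withDensity (g j) = ENNReal.ofReal (c j) • γ.map (T j) := hTd
  have hfin (j : ι) : IsFiniteMeasure (γ.withDensity (g j)) := by
    rw [hTd' j]
    exact Measure.smul_finite _ ENNReal.ofReal_ne_top
  have htilt : (Measure.pi fun _ : ι => γ).withDensity (fun z => ∏ j, g j (z j)) =
      (∏ j, ENNReal.ofReal (c j)) • (Measure.pi fun _ : ι => γ).map TT := by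
    rw [← pi_withDensity (fun _ => γ) g hg]
    refine Measure.pi_eq fun s hs => ?_
    have e1 : (Measure.pi fun _ : ι => γ).map TT = Measure.pi fun j => γ.map (T j) := by
      rw [← Measure.pi_map_pi (fun j => (hTm j).aemeasurable)]
    rw [e1, Measure.smul_apply, Measure.pi_pi, smul_eq_mul, ← Finset.prod_mul_distrib]
    refine Finset.prod_congr rfl fun j _ => ?_
    rw [hTd' j, Measure.smul_apply, smul_eq_mul]
  have hlik : ∀ z : ι → EuclideanSpace ℝ (Fin d),
      ENNReal.ofReal (Real.exp (logLik A b fun j => (z j).ofLp)) = ∏ j, g j (z j) := by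
    intro z
    rw [logLik, Real.exp_sum, ENNReal.ofReal_prod_of_nonneg fun i _ => (Real.exp_pos _).le]
  have hgm : Measurable fun z : ι → EuclideanSpace ℝ (Fin d) => ∏ j, g j (z j) :=
    Finset.measurable_prod _ fun j _ => (hg j).comp (measurable_pi_apply j)
  refine ⟨∏ j, ENNReal.ofReal (c j), TT, fun ζ j a => hTz j (ζ j) a, fun h hh => ?_⟩
  simp_rw [hlik]
  rw [← lintegral_map hh hTT, ← smul_eq_mul, ← lintegral_smul_measure, ← htilt,
    lintegral_withDensity_eq_lintegral_mul _ hgm hh]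
  exact lintegral_congr fun z => mul_comm _ _

lemma pi_multivariateGaussian_eq_map (Sg : Matrix (Fin d) (Fin d) ℝ) :
    (Measure.pi fun _ : ι => multivariateGaussian 0 Sg) =
      (Measure.pi fun _ : ι => stdGaussian (EuclideanSpace ℝ (Fin d))).map
        fun z j => WithLp.toLp 2 (CFC.sqrt Sg *ᵥ (z j).ofLp) := by
  have h0 : ∀ x : EuclideanSpace ℝ (Fin d),
      0 + toEuclideanCLM (𝕜 := ℝ) (CFC.sqrt Sg) x = WithLp.toLp 2 (CFC.sqrt Sg *ᵥ x.ofLp) := by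
    intro x; rw [zero_add]; rfl
  simp only [multivariateGaussian, h0]
  have hm : Measurable fun x : EuclideanSpace ℝ (Fin d) =>
      (WithLp.toLp 2 (CFC.sqrt Sg *ᵥ x.ofLp) : EuclideanSpace ℝ (Fin d)) := by fun_prop
  have (i : ι) : IsProbabilityMeasure ((stdGaussian (EuclideanSpace ℝ (Fin d))).map
      fun x : EuclideanSpace ℝ (Fin d) =>
        (WithLp.toLp 2 (CFC.sqrt Sg *ᵥ x.ofLp) : EuclideanSpace ℝ (Fin d))) :=
    Measure.isProbabilityMeasure_map hm.aemeasurable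
  rw [← Measure.pi_map_pi (fun _ => hm.aemeasurable)]

lemma measurable_devSq_weights (Sg A : Matrix (Fin d) (Fin d) ℝ) (b : ι → Fin d → ℝ) :
    Measurable fun W : ι → EuclideanSpace ℝ (Fin d) => devSq Sg A b (fun j => (W j).ofLp) := by
  have h1 : ∀ i j, Measurable fun _ : ι → EuclideanSpace ℝ (Fin d) => A i j :=
    fun _ _ => measurable_const
  have h2 : Measurable fun (W : ι → EuclideanSpace ℝ (Fin d)) j => (W j).ofLp := by fun_prop
  exact measurable_devSq Sg h1 measurable_const h2

lemma measurable_exp_logLik_weights (A : Matrix (Fin d) (Fin d) ℝ) (b : ι → Fin d → ℝ) :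
    Measurable fun W : ι → EuclideanSpace ℝ (Fin d) =>
      ENNReal.ofReal (Real.exp (logLik A b (fun j => (W j).ofLp))) := by
  have h1 : ∀ i j, Measurable fun _ : ι → EuclideanSpace ℝ (Fin d) => A i j :=
    fun _ _ => measurable_const
  have h2 : Measurable fun (W : ι → EuclideanSpace ℝ (Fin d)) j => (W j).ofLp := by fun_prop
  exact (Real.measurable_exp.comp (measurable_logLik h1 measurable_const h2)).ennreal_ofReal

lemma logLik_mulVec {S : Matrix (Fin d) (Fin d) ℝ} (hS : Sᵀ = S) (A : Matrix (Fin d) (Fin d) ℝ)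
    (b z : ι → Fin d → ℝ) :
    logLik A b (fun j => S *ᵥ z j) = logLik (S * A * S) (fun j => S *ᵥ b j) z := by
  refine Finset.sum_congr rfl fun j _ => ?_
  rw [dotProduct_mulVec_symm hS, ← dotProduct_mulVec_symm hS (z j), mulVec_mulVec,
    mulVec_mulVec, Matrix.mul_assoc]

/-- Under the posterior, the expected squared deviation is of the order of the dimensions. -/
lemma lintegral_devSq_le (hSg : Sg.PosSemidef) {A : Matrix (Fin d) (Fin d) ℝ}
    (hA : A.PosSemidef) (b : ι → Fin d → ℝ) :
    ∫⁻ W, devSq Sg A b (fun j => (W j).ofLp) *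
        ENNReal.ofReal (Real.exp (logLik A b fun j => (W j).ofLp))
        ∂(Measure.pi fun _ : ι => multivariateGaussian 0 Sg) ≤
      ENNReal.ofReal (16 * (2 + d + Fintype.card ι * Real.log expSqMoment)) *
        ∫⁻ W, ENNReal.ofReal (Real.exp (logLik A b fun j => (W j).ofLp))
          ∂(Measure.pi fun _ : ι => multivariateGaussian 0 Sg) := by
  obtain ⟨h1, h2⟩ := exists_sqrt_matrix hSg
  rw [pi_multivariateGaussian_eq_map]
  generalize CFC.sqrt Sg = S at h1 h2 ⊢
  have hA' : (S * A * S).PosSemidef := by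
    have := hA.mul_mul_conjTranspose_same S
    rwa [conjTranspose_eq_transpose_of_trivial, h1] at this
  obtain ⟨B, hB, hBB, hT⟩ := exists_pi_tilt (ι := ι) hA'
  obtain ⟨c, T, hTz, hTd⟩ := hT fun j => S *ᵥ b j
  have hF : Measurable fun (z : ι → EuclideanSpace ℝ (Fin d)) j =>
      (WithLp.toLp 2 (S *ᵥ (z j).ofLp) : EuclideanSpace ℝ (Fin d)) := by
    fun_prop
  have hmd := measurable_devSq_weights Sg A b
  have hml := measurable_exp_logLik_weights A b
  have e1 := lintegral_map (μ := Measure.pi fun _ : ι => stdGaussian (EuclideanSpace ℝ (Fin d)))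
    (hmd.mul hml) hF
  have e2 := lintegral_map (μ := Measure.pi fun _ : ι => stdGaussian (EuclideanSpace ℝ (Fin d)))
    hml hF
  simp only [Pi.mul_apply, logLik_mulVec h1] at e1 e2
  rw [e1, e2]
  -- The constant `c` is the total mass of the unnormalized posterior, so it is a common factor of
  -- both sides.
  have key1 := hTd (fun _ => 1) measurable_const
  simp only [one_mul, lintegral_const, measure_univ, mul_one] at key1
  have hmF := hmd.comp hF
  simp only [Function.comp_def] at hmF
  have key2 := hTd _ hmF
  rw [key1, key2, mul_comm (ENNReal.ofReal _) c]
  refine mul_le_mul' le_rfl ?_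
  have hbound := lintegral_iSup_rowsSq_le (ι := ι) (E := EuclideanSpace ℝ (Fin d))
  rw [finrank_euclideanSpace_fin] at hbound
  refine le_trans (lintegral_mono fun ζ => ?_) hbound
  exact devSq_mulVec_le h1 h2 hB hBB b (fun j => (T ζ j).ofLp) ζ fun j a => hTz ζ j a

end Deviation

end PSRL

end

noncomputable section

namespace PSRL

/-! ### The likelihood of the data -/

section Stats

open Matrix

variable {d : ℕ} {ι : Type*} [Fintype ι]

lemma logLik_zero (W : ι → Fin d → ℝ) : logLik 0 0 W = 0 := by simp [logLik]

lemma logLik_add (A A' : Matrix (Fin d) (Fin d) ℝ) (b b' W : ι → Fin d → ℝ) :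
    logLik (A + A') (b + b') W = logLik A b W + logLik A' b' W := by
  simp only [logLik, ← Finset.sum_add_distrib]
  refine Finset.sum_congr rfl fun j _ => ?_
  rw [Pi.add_apply, add_dotProduct, add_mulVec, dotProduct_add]
  ring

lemma logLik_sum {κ : Type*} (s : Finset κ) (A : κ → Matrix (Fin d) (Fin d) ℝ)
    (b : κ → ι → Fin d → ℝ) (W : ι → Fin d → ℝ) :
    logLik (∑ k ∈ s, A k) (∑ k ∈ s, b k) W = ∑ k ∈ s, logLik (A k) (b k) W := by
  induction s using Finset.cons_induction with
  | empty => simp [logLik_zero]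
  | cons a s ha ih => rw [Finset.sum_cons, Finset.sum_cons, Finset.sum_cons, logLik_add, ih]

lemma logLik_outer (t : ℝ) (φ : Fin d → ℝ) (y : ι → ℝ) (W : ι → Fin d → ℝ) :
    logLik (t • vecMulVec φ φ) (fun j => (t * y j) • φ) W =
      t * ∑ j, ((W j ⬝ᵥ φ) * y j - (W j ⬝ᵥ φ) ^ 2 / 2) := by
  rw [logLik, Finset.mul_sum]
  refine Finset.sum_congr rfl fun j _ => ?_
  rw [smul_dotProduct, dotProduct_comm φ, smul_mulVec, dotProduct_smul, vecMulVec_mulVec,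
    dotProduct_smul, dotProduct_comm φ]
  simp
  ring

end Stats

variable {S A : Type} [MeasurableSpace S] [MeasurableSpace A]

namespace FeatureModel

variable {dφ dφ' dψ : ℕ} (M : FeatureModel S A dφ dφ' dψ)

/-- Log-likelihood ratio of the reward `r` at `h`, with respect to zero weights. -/
def rewLik (w : Weights dφ dφ' dψ) (h : S × A) (r : ℝ) : ℝ :=
  (M.meanReward (w, h) * r - M.meanReward (w, h) ^ 2 / 2) / (M.σr ^ 2 : ℝ≥0)

/-- Log-likelihood ratio of the next state `s` at `h`, with respect to zero weights. -/
def nextLik (w : Weights dφ dφ' dψ) (h : S × A) (s : S) : ℝ :=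
  (∑ j, (M.meanEmbedding (w, h) j * M.ψ s j - M.meanEmbedding (w, h) j ^ 2 / 2)) /
    (M.σf ^ 2 : ℝ≥0)

section

variable {X : Type*} [MeasurableSpace X] {w : X → Weights dφ dφ' dψ} {h : X → S × A}

lemma measurable_rewLik {r : X → ℝ} (hw : Measurable w) (hh : Measurable h) (hr : Measurable r) :
    Measurable fun x => M.rewLik (w x) (h x) (r x) := by
  have h1 : Measurable fun x => M.meanReward (w x, h x) :=
    M.measurable_meanReward.comp (hw.prodMk hh)
  unfold rewLik
  fun_prop

lemma measurable_nextLik {s : X → S} (hw : Measurable w) (hh : Measurable h) (hs : Measurable s) :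
    Measurable fun x => M.nextLik (w x) (h x) (s x) := by
  have h1 : Measurable fun x => M.meanEmbedding (w x, h x) :=
    M.measurable_meanEmbedding.comp (hw.prodMk hh)
  have h2 : Measurable fun x => M.ψ (s x) := M.measurable_ψ.comp hs
  unfold nextLik
  fun_prop

end

lemma rewardKernel_apply (p : Weights dφ dφ' dψ × (S × A)) :
    M.rewardKernel p = gaussianReal (M.meanReward p) (M.σr ^ 2) := by
  have hm : Measurable fun q : (Weights dφ dφ' dψ × (S × A)) × ℝ => M.meanReward q.1 + q.2 :=
    (M.measurable_meanReward.comp measurable_fst).add measurable_snd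
  rw [rewardKernel, Kernel.map_apply _ hm, Kernel.prod_apply,
    Kernel.id_apply, Kernel.const_apply, Measure.dirac_prod, Measure.map_map hm
      measurable_prodMk_left]
  change Measure.map (fun x => M.meanReward p + x) _ = _
  rw [gaussianReal_map_const_add, zero_add]

lemma embeddingKernel_apply (p : Weights dφ dφ' dψ × (S × A)) :
    M.embeddingKernel p =
      (Measure.pi fun _ => gaussianReal 0 (M.σf ^ 2)).map (fun x => M.meanEmbedding p + x) := by
  have hm : Measurable fun q : (Weights dφ dφ' dψ × (S × A)) × (Fin dψ → ℝ) =>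
      M.meanEmbedding q.1 + q.2 :=
    (M.measurable_meanEmbedding.comp measurable_fst).add measurable_snd
  rw [embeddingKernel, Kernel.map_apply _ hm, Kernel.prod_apply,
    Kernel.id_apply, Kernel.const_apply, Measure.dirac_prod, Measure.map_map hm
      measurable_prodMk_left]
  rfl

lemma meanReward_zero (h : S × A) : M.meanReward (0, h) = 0 := by simp [meanReward]

lemma meanEmbedding_zero (h : S × A) : M.meanEmbedding (0, h) = 0 := by
  ext j; simp [meanEmbedding]

lemma embeddingKernel_zero (h : S × A) :
    M.embeddingKernel (0, h) = Measure.pi fun _ => gaussianReal 0 (M.σf ^ 2) := by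
  rw [embeddingKernel_apply, meanEmbedding_zero]
  simp

variable {M}

lemma lintegral_rewardKernel (hσ : M.σr ≠ 0) (w : Weights dφ dφ' dψ) (h : S × A)
    {g : ℝ → ℝ≥0∞} (hg : Measurable g) :
    ∫⁻ r, g r ∂(M.rewardKernel (w, h)) =
      ∫⁻ r, g r * ENNReal.ofReal (Real.exp (M.rewLik w h r)) ∂(M.rewardKernel (0, h)) := by
  rw [rewardKernel_apply, rewardKernel_apply, meanReward_zero,
    gaussianReal_eq_withDensity _ (pow_ne_zero 2 hσ),
    lintegral_withDensity_eq_lintegral_mul _ (by fun_prop) hg]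
  exact lintegral_congr fun r => mul_comm _ _

/-- The noise has a Lebesgue density, so a property of `decode z` for Lebesgue-almost every `z` is
enough. -/
lemma ae_decode (hσ : M.σf ≠ 0) (h : S × A) :
    ∀ᵐ z ∂(M.embeddingKernel (0, h)), ∀ᵐ s ∂(M.decode z), M.ψ s = z := by
  have hac : M.embeddingKernel (0, h) ≪ volume := by
    rw [embeddingKernel_zero, pi_gaussianReal_eq_withDensity_volume (pow_ne_zero 2 hσ)]
    exact withDensity_absolutelyContinuous _ _
  filter_upwards [hac.ae_le M.map_ψ_decode] with z hz
  have : ∀ᵐ y ∂((M.decode z).map M.ψ), y = z := by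
    rw [hz, ae_dirac_eq]; rfl
  exact ae_of_ae_map M.measurable_ψ.aemeasurable this

/-- Almost surely the decoded state determines its embedding, and decoding does not involve the
weights; so the density of the embedding, read at `ψ s`, is a density for the state itself. -/
lemma lintegral_transKernel (hσ : M.σf ≠ 0) (w : Weights dφ dφ' dψ) (h : S × A)
    {g : S → ℝ≥0∞} (hg : Measurable g) :
    ∫⁻ s, g s ∂(M.transKernel (w, h)) =
      ∫⁻ s, g s * ENNReal.ofReal (Real.exp (M.nextLik w h s)) ∂(M.transKernel (0, h)) := by
  have hL : Measurable fun s => ENNReal.ofReal (Real.exp (M.nextLik w h s)) :=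
    (Real.measurable_exp.comp (M.measurable_nextLik measurable_const measurable_const
      measurable_id)).ennreal_ofReal
  rw [transKernel, Kernel.lintegral_comp _ _ _ hg, 
    Kernel.lintegral_comp _ _ _
      (g := fun s => g s * ENNReal.ofReal (Real.exp (M.nextLik w h s))) (hg.mul hL),
    embeddingKernel_apply, pi_gaussianReal_map_add _ (pow_ne_zero 2 hσ),
    lintegral_withDensity_eq_lintegral_mul _ (by fun_prop) hg.lintegral_kernel,
    ← M.embeddingKernel_zero h]
  refine lintegral_congr_ae ?_
  filter_upwards [ae_decode hσ h] with z hz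
  rw [Pi.mul_apply, ← lintegral_const_mul _ hg]
  refine lintegral_congr_ae ?_
  filter_upwards [hz] with s hs
  rw [mul_comm, nextLik, hs]

end FeatureModel

end PSRL

end

/-! ### Likelihood ratios of episodes with respect to zero weights -/

noncomputable section

namespace PSRL

variable {S A : Type} [MeasurableSpace S] [MeasurableSpace A]

lemma measurable_init {X : Type} [MeasurableSpace X] (n : ℕ) :
    Measurable fun e : Fin (n + 1) → X => (Fin.init e : Fin n → X) :=
  measurable_pi_lambda _ fun i => measurable_pi_apply i.castSucc

namespace FeatureModel

variable {dφ dφ' dψ : ℕ} (M : FeatureModel S A dφ dφ' dψ) (π : Planner S A dφ dφ' dψ)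

/-- Log-likelihood ratio of the first `n` steps of an episode and of the state reached. -/
def partLik (w : Weights dφ dφ' dψ) : (n : ℕ) → Episode S A n × S → ℝ
  | 0, _ => 0
  | n + 1, p => partLik w n (Fin.init p.1, (p.1 (Fin.last n)).1) +
      (M.rewLik w ((p.1 (Fin.last n)).1, (p.1 (Fin.last n)).2.1) (p.1 (Fin.last n)).2.2 +
        M.nextLik w ((p.1 (Fin.last n)).1, (p.1 (Fin.last n)).2.1) p.2)

/-- Log-likelihood ratio of an episode. -/
def epLik (w : Weights dφ dφ' dψ) {n : ℕ} (e : Episode S A (n + 1)) : ℝ :=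
  M.partLik w n (Fin.init e, (e (Fin.last n)).1) +
    M.rewLik w ((e (Fin.last n)).1, (e (Fin.last n)).2.1) (e (Fin.last n)).2.2

section

variable {X : Type*} [MeasurableSpace X] {w : X → Weights dφ dφ' dψ}

lemma measurable_partLik (n : ℕ) {p : X → Episode S A n × S} (hw : Measurable w)
    (hp : Measurable p) : Measurable fun x => M.partLik (w x) n (p x) := by
  induction n with
  | zero => exact measurable_const
  | succ n ih =>
    have hl : Measurable fun x => (p x).1 (Fin.last n) := by fun_prop
    have hi : Measurable fun x => (Fin.init (p x).1 : Episode S A n) :=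
      (measurable_init n).comp hp.fst
    exact (ih (hi.prodMk hl.fst)).add ((M.measurable_rewLik hw (hl.fst.prodMk hl.snd.fst)
      hl.snd.snd).add (M.measurable_nextLik hw (hl.fst.prodMk hl.snd.fst) hp.snd))

lemma measurable_epLik {n : ℕ} {e : X → Episode S A (n + 1)} (hw : Measurable w)
    (he : Measurable e) : Measurable fun x => M.epLik (w x) (e x) := by
  have hl : Measurable fun x => (e x) (Fin.last n) := by fun_prop
  have hi : Measurable fun x => (Fin.init (e x) : Episode S A n) := (measurable_init n).comp he
  exact (M.measurable_partLik n hw (hi.prodMk hl.fst)).add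
    (M.measurable_rewLik hw (hl.fst.prodMk hl.snd.fst) hl.snd.snd)

end

instance (n : ℕ) : IsMarkovKernel (M.partialEpisode π n) := M.isMarkovKernel_partialEpisode π n

/-- Appending a step to a partial episode. -/
def appendStep (n : ℕ) (q : (Episode S A n × S) × (A × ℝ × S)) : Episode S A (n + 1) × S :=
  (Fin.snoc q.1.1 (q.1.2, q.2.1, q.2.2.1), q.2.2.2)

lemma measurable_appendStep (n : ℕ) :
    Measurable (appendStep n : (Episode S A n × S) × (A × ℝ × S) → _) :=
  Measurable.prodMk ((measurable_snoc n).comp (f := fun q : (Episode S A n × S) × (A × ℝ × S) =>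
    (q.1.1, (q.1.2, q.2.1, q.2.2.1))) (by fun_prop)) (by fun_prop)

lemma lintegral_partialEpisode_succ (n : ℕ) (p : Weights dφ dφ' dψ × Weights dφ dφ' dψ)
    {f : Episode S A (n + 1) × S → ℝ≥0∞} (hf : Measurable f) :
    ∫⁻ x, f x ∂(M.partialEpisode π (n + 1) p) =
      ∫⁻ x, ∫⁻ q, f (appendStep n (x, q)) ∂(M.stepKernel π n (p, x)) ∂(M.partialEpisode π n p) := by
  have : M.partialEpisode π (n + 1) =
      (M.partialEpisode π n ⊗ₖ M.stepKernel π n).map (appendStep n) := rfl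
  rw [this, Kernel.map_apply _ (measurable_appendStep n),
    lintegral_map hf (measurable_appendStep n), Kernel.lintegral_compProd _ _ _
      (f := fun q => f (appendStep n q)) (hf.comp (measurable_appendStep n))]

lemma lintegral_stepKernel (n : ℕ) (w w' : Weights dφ dφ' dψ) (x : Episode S A n × S)
    {g : A × ℝ × S → ℝ≥0∞} (hg : Measurable g) :
    ∫⁻ q, g q ∂(M.stepKernel π n ((w, w'), x)) =
      ∫⁻ r, ∫⁻ s, g (π.act w' n x.2, r, s) ∂(M.transKernel (w, (x.2, π.act w' n x.2)))
        ∂(M.rewardKernel (w, (x.2, π.act w' n x.2))) := by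
  rw [stepKernel, Kernel.lintegral_deterministic_prod _ _ _ hg, Kernel.comap_apply,
    Kernel.lintegral_prod _ _ _ (g := fun c => g (π.act w' n x.2, c))
      (hg.comp measurable_prodMk_left)]

variable {M}

/-- The action is a function of the sampled weights and the state, whatever the true weights; only
reward and next state contribute to the ratio. -/
lemma lintegral_stepKernel_lik (hr : M.σr ≠ 0) (hf : M.σf ≠ 0) (n : ℕ)
    (w w' : Weights dφ dφ' dψ) (x : Episode S A n × S)
    {g : A × ℝ × S → ℝ≥0∞} (hg : Measurable g) :
    ∫⁻ q, g q ∂(M.stepKernel π n ((w, w'), x)) =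
      ∫⁻ q, g q * ENNReal.ofReal (Real.exp (M.rewLik w (x.2, q.1) q.2.1 +
        M.nextLik w (x.2, q.1) q.2.2)) ∂(M.stepKernel π n ((0, w'), x)) := by
  have h1 : Measurable fun q : A × ℝ × S => M.rewLik w (x.2, q.1) q.2.1 :=
    M.measurable_rewLik (by fun_prop) (by fun_prop) (by fun_prop)
  have h2 : Measurable fun q : A × ℝ × S => M.nextLik w (x.2, q.1) q.2.2 :=
    M.measurable_nextLik (by fun_prop) (by fun_prop) (by fun_prop)
  have h3 : Measurable fun q : A × ℝ × S => g q * ENNReal.ofReal (Real.exp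
      (M.rewLik w (x.2, q.1) q.2.1 + M.nextLik w (x.2, q.1) q.2.2)) := by fun_prop
  rw [lintegral_stepKernel _ _ _ _ _ _ hg, lintegral_stepKernel _ _ _ _ _ _ h3,
    lintegral_rewardKernel hr]
  · refine lintegral_congr fun r => ?_
    rw [lintegral_transKernel hf _ _ (by fun_prop), ← lintegral_mul_const]
    · refine lintegral_congr fun s => ?_
      rw [mul_assoc, ← ENNReal.ofReal_mul (Real.exp_pos _).le, ← Real.exp_add,
        add_comm (M.nextLik _ _ _)]
    · have h4 : Measurable fun s : S => M.nextLik w (x.2, π.act w' n x.2) s :=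
        M.measurable_nextLik (by fun_prop) (by fun_prop) (by fun_prop)
      fun_prop
  · exact Measurable.lintegral_prod_right' (f := fun q : ℝ × S => g (π.act w' n x.2, q.1, q.2))
      (by fun_prop)

/-- For the last step of an episode: the state reached after it is not recorded, so the transition
integrates to one and only the reward carries information. -/
lemma lintegral_stepKernel_rewLik (hr : M.σr ≠ 0) (n : ℕ)
    (w w' : Weights dφ dφ' dψ) (x : Episode S A n × S)
    {g : A × ℝ → ℝ≥0∞} (hg : Measurable g) :
    ∫⁻ q, g (q.1, q.2.1) ∂(M.stepKernel π n ((w, w'), x)) =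
      ∫⁻ q, g (q.1, q.2.1) * ENNReal.ofReal (Real.exp (M.rewLik w (x.2, q.1) q.2.1))
        ∂(M.stepKernel π n ((0, w'), x)) := by
  have h1 : Measurable fun q : A × ℝ × S => M.rewLik w (x.2, q.1) q.2.1 :=
    M.measurable_rewLik (by fun_prop) (by fun_prop) (by fun_prop)
  have h3 : Measurable fun q : A × ℝ × S => g (q.1, q.2.1) * ENNReal.ofReal (Real.exp
      (M.rewLik w (x.2, q.1) q.2.1)) := by fun_prop
  rw [lintegral_stepKernel _ _ _ _ _ _ (by fun_prop), lintegral_stepKernel _ _ _ _ _ _ h3]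
  simp only [lintegral_const, measure_univ, mul_one]
  exact lintegral_rewardKernel hr _ _ (by fun_prop)

lemma lintegral_partialEpisode (hr : M.σr ≠ 0) (hf : M.σf ≠ 0) (w w' : Weights dφ dφ' dψ) (n : ℕ)
    {f : Episode S A n × S → ℝ≥0∞} (hfm : Measurable f) :
    ∫⁻ x, f x ∂(M.partialEpisode π n (w, w')) =
      ∫⁻ x, f x * ENNReal.ofReal (Real.exp (M.partLik w n x)) ∂(M.partialEpisode π n (0, w')) := by
  induction n with
  | zero => simp [partLik, partialEpisode]
  | succ n ih =>
    have hL : Measurable fun x => M.partLik w (n + 1) x :=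
      M.measurable_partLik (n + 1) measurable_const measurable_id
    have hL' : Measurable fun x => M.partLik w n x :=
      M.measurable_partLik n measurable_const measurable_id
    have hfa := hfm.comp (measurable_appendStep (S := S) (A := A) n)
    have hg : Measurable fun x => f x * ENNReal.ofReal (Real.exp (M.partLik w (n + 1) x)) :=
      hfm.mul (Real.measurable_exp.comp hL).ennreal_ofReal
    rw [lintegral_partialEpisode_succ _ _ _ _ hfm, lintegral_partialEpisode_succ _ _ _ _ hg, ih]
    · refine lintegral_congr fun x => ?_
      rw [lintegral_stepKernel_lik π hr hf n w w' x (g := fun q => f (appendStep n (x, q)))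
        (hfa.comp measurable_prodMk_left),
        ← lintegral_mul_const]
      · refine lintegral_congr fun q => ?_
        rw [mul_assoc, ← ENNReal.ofReal_mul (Real.exp_pos _).le, ← Real.exp_add, add_comm _
          (M.partLik w n x)]
        simp [appendStep, partLik]
      · have h1 : Measurable fun q : A × ℝ × S => M.rewLik w (x.2, q.1) q.2.1 :=
          M.measurable_rewLik (by fun_prop) (by fun_prop) (by fun_prop)
        have h2 : Measurable fun q : A × ℝ × S => M.nextLik w (x.2, q.1) q.2.2 :=
          M.measurable_nextLik (by fun_prop) (by fun_prop) (by fun_prop)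
        exact (hfa.comp measurable_prodMk_left).mul
          (Real.measurable_exp.comp (h1.add h2)).ennreal_ofReal
    · exact Measurable.lintegral_kernel_prod_right'' hfa

lemma lintegral_episodeKernel (hr : M.σr ≠ 0) (hf : M.σf ≠ 0) (w w' : Weights dφ dφ' dψ) (n : ℕ)
    {f : Episode S A (n + 1) → ℝ≥0∞} (hfm : Measurable f) :
    ∫⁻ e, f e ∂(M.episodeKernel π (n + 1) (w, w')) =
      ∫⁻ e, f e * ENNReal.ofReal (Real.exp (M.epLik w e))
        ∂(M.episodeKernel π (n + 1) (0, w')) := by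
  have hL : Measurable fun e => M.epLik w (n := n) e :=
    M.measurable_epLik measurable_const measurable_id
  have hL' : Measurable fun x => M.partLik w n x :=
    M.measurable_partLik n measurable_const measurable_id
  have hg : Measurable fun e : Episode S A (n + 1) => f e * ENNReal.ofReal
      (Real.exp (M.epLik w e)) := hfm.mul (Real.measurable_exp.comp hL).ennreal_ofReal
  have hs (x : Episode S A n × S) : Measurable fun q : A × ℝ =>
      f (Fin.snoc x.1 (x.2, q.1, q.2)) :=
    hfm.comp ((measurable_snoc n).comp (f := fun q : A × ℝ => (x.1, (x.2, q.1, q.2)))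
      (by fun_prop))
  rw [episodeKernel, Kernel.map_apply _ measurable_fst, Kernel.map_apply _ measurable_fst,
    lintegral_map hfm measurable_fst, lintegral_map hg measurable_fst,
    lintegral_partialEpisode_succ _ _ _ _ (f := fun x => f x.1) (hfm.comp measurable_fst),
    lintegral_partialEpisode_succ _ _ _ _
      (f := fun x => f x.1 * ENNReal.ofReal (Real.exp (M.epLik w x.1))) (hg.comp measurable_fst),
    lintegral_partialEpisode π hr hf]
  · refine lintegral_congr fun x => ?_
    have e1 := lintegral_stepKernel_rewLik π hr n w w' x (hs x)
    change (∫⁻ q, f (Fin.snoc x.1 (x.2, q.1, q.2.1)) ∂(M.stepKernel π n ((w, w'), x))) * _ = _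
    have h1 : Measurable fun q : A × ℝ × S => M.rewLik w (x.2, q.1) q.2.1 :=
      M.measurable_rewLik (by fun_prop) (by fun_prop) (by fun_prop)
    rw [e1, ← lintegral_mul_const]
    · refine lintegral_congr fun q => ?_
      rw [mul_assoc, ← ENNReal.ofReal_mul (Real.exp_pos _).le, ← Real.exp_add, add_comm _
        (M.partLik w n x)]
      simp [appendStep, epLik]
    · exact ((hs x).comp (by fun_prop : Measurable fun q : A × ℝ × S => (q.1, q.2.1))).mul
        (Real.measurable_exp.comp h1).ennreal_ofReal
  · exact Measurable.lintegral_kernel_prod_right''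
      ((hfm.comp measurable_fst).comp (measurable_appendStep n))

end FeatureModel

end PSRL

end

noncomputable section

namespace PSRL

variable {S A : Type} [MeasurableSpace S] [MeasurableSpace A]

namespace FeatureModel

variable {dφ dφ' dψ : ℕ} (M : FeatureModel S A dφ dφ' dψ) (π : Planner S A dφ dφ' dψ)

/-! ### Sufficient statistics -/

/-- The transition feature seen at step `i`. -/
def featf {H : ℕ} (e : Episode S A H) (i : Fin H) : Fin dφ → ℝ :=
  (M.φf ((e i).1, (e i).2.1)).ofLp

/-- The reward feature seen at step `i`. -/
def featr {H : ℕ} (e : Episode S A H) (i : Fin H) : Fin dφ' → ℝ :=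
  (M.φr ((e i).1, (e i).2.1)).ofLp

/-- Precision matrix for the transition gained in an episode. -/
def precf {n : ℕ} (e : Episode S A (n + 1)) : Matrix (Fin dφ) (Fin dφ) ℝ :=
  ((M.σf : ℝ) ^ 2)⁻¹ • ∑ i : Fin n, Matrix.vecMulVec (M.featf e i.castSucc) (M.featf e i.castSucc)

/-- Precision-weighted observed transitions of an episode. -/
def obsf {n : ℕ} (e : Episode S A (n + 1)) : Fin dψ → Fin dφ → ℝ :=
  ∑ i : Fin n, fun j => (((M.σf : ℝ) ^ 2)⁻¹ * M.ψ (e i.succ).1 j) • M.featf e i.castSucc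

/-- Precision matrix for the reward gained in an episode. -/
def precr {n : ℕ} (e : Episode S A (n + 1)) : Matrix (Fin dφ') (Fin dφ') ℝ :=
  ((M.σr : ℝ) ^ 2)⁻¹ • ∑ i : Fin (n + 1), Matrix.vecMulVec (M.featr e i) (M.featr e i)

/-- Precision-weighted observed rewards of an episode. -/
def obsr {n : ℕ} (e : Episode S A (n + 1)) : Fin 1 → Fin dφ' → ℝ :=
  ∑ i : Fin (n + 1), fun _ => (((M.σr : ℝ) ^ 2)⁻¹ * (e i).2.2) • M.featr e i

lemma meanReward_eq (w : Weights dφ dφ' dψ) (h : S × A) :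
    M.meanReward (w, h) = w.1.ofLp ⬝ᵥ (M.φr h).ofLp := by
  rw [meanReward, EuclideanSpace.inner_eq_star_dotProduct, dotProduct_comm]; rfl

lemma meanEmbedding_eq (w : Weights dφ dφ' dψ) (h : S × A) (j : Fin dψ) :
    M.meanEmbedding (w, h) j = (w.2 j).ofLp ⬝ᵥ (M.φf h).ofLp := by
  rw [meanEmbedding, EuclideanSpace.inner_eq_star_dotProduct, dotProduct_comm]; rfl

lemma partLik_eq_sum (w : Weights dφ dφ' dψ) {n : ℕ} (e : Episode S A (n + 1)) :
    M.partLik w n (Fin.init e, (e (Fin.last n)).1) =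
      ∑ i : Fin n, (M.rewLik w ((e i.castSucc).1, (e i.castSucc).2.1) (e i.castSucc).2.2 +
        M.nextLik w ((e i.castSucc).1, (e i.castSucc).2.1) (e i.succ).1) := by
  induction n with
  | zero => simp [partLik]
  | succ n ih =>
    rw [Fin.sum_univ_castSucc, partLik]
    congr 1
    exact ih (Fin.init e)

/-- An episode of length `n + 1` shows `n + 1` rewards but only `n` transitions. The likelihood is a
function of the reward weights times a function of the transition weights, which is why the two stay
independent a posteriori. -/
lemma epLik_eq_logLik (w : Weights dφ dφ' dψ) {n : ℕ} (e : Episode S A (n + 1)) :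
    M.epLik w e = logLik (M.precr e) (M.obsr e) (fun _ => w.1.ofLp) +
      logLik (M.precf e) (M.obsf e) (fun j => (w.2 j).ofLp) := by
  have hr : logLik (M.precr e) (M.obsr e) (fun _ => w.1.ofLp) =
      ∑ i, M.rewLik w ((e i).1, (e i).2.1) (e i).2.2 := by
    rw [precr, obsr, Finset.smul_sum, logLik_sum]
    refine Finset.sum_congr rfl fun i _ => ?_
    rw [logLik_outer _ _ (fun _ : Fin 1 => (e i).2.2), rewLik, meanReward_eq, Fin.sum_univ_one,
      div_eq_inv_mul _ ((M.σr ^ 2 : ℝ≥0) : ℝ)]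
    push_cast
    rfl
  have hf : logLik (M.precf e) (M.obsf e) (fun j => (w.2 j).ofLp) =
      ∑ i : Fin n, M.nextLik w ((e i.castSucc).1, (e i.castSucc).2.1) (e i.succ).1 := by
    rw [precf, obsf, Finset.smul_sum, logLik_sum]
    refine Finset.sum_congr rfl fun i _ => ?_
    rw [logLik_outer _ _ (M.ψ (e i.succ).1), nextLik, div_eq_inv_mul _ ((M.σf ^ 2 : ℝ≥0) : ℝ)]
    simp only [meanEmbedding_eq]
    push_cast
    rfl
  rw [hr, hf, epLik, partLik_eq_sum, Finset.sum_add_distrib, Fin.sum_univ_castSucc]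
  ring

lemma posSemidef_precf {n : ℕ} (e : Episode S A (n + 1)) : (M.precf e).PosSemidef :=
  posSemidef_outer_sum (by positivity) _

lemma posSemidef_precr {n : ℕ} (e : Episode S A (n + 1)) : (M.precr e).PosSemidef :=
  posSemidef_outer_sum (by positivity) _

section

variable {X : Type*} [MeasurableSpace X]

lemma measurable_featf {H : ℕ} {e : X → Episode S A H} (he : Measurable e) (i : Fin H) :
    Measurable fun x => M.featf (e x) i := by
  have h1 : Measurable fun x => M.φf ((e x i).1, (e x i).2.1) :=
    M.measurable_φf.comp (by fun_prop)
  unfold featf; fun_prop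

lemma measurable_featr {H : ℕ} {e : X → Episode S A H} (he : Measurable e) (i : Fin H) :
    Measurable fun x => M.featr (e x) i := by
  have h1 : Measurable fun x => M.φr ((e x i).1, (e x i).2.1) :=
    M.measurable_φr.comp (by fun_prop)
  unfold featr; fun_prop

lemma measurable_precf {n : ℕ} {e : X → Episode S A (n + 1)} (he : Measurable e) (i j : Fin dφ) :
    Measurable fun x => M.precf (e x) i j := by
  have h := fun i : Fin (n + 1) => M.measurable_featf he i
  simp only [precf, Matrix.smul_apply, Matrix.sum_apply, Matrix.vecMulVec_apply]
  fun_prop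

lemma measurable_precr {n : ℕ} {e : X → Episode S A (n + 1)} (he : Measurable e) (i j : Fin dφ') :
    Measurable fun x => M.precr (e x) i j := by
  have h := fun i : Fin (n + 1) => M.measurable_featr he i
  simp only [precr, Matrix.smul_apply, Matrix.sum_apply, Matrix.vecMulVec_apply]
  fun_prop

lemma measurable_obsf {n : ℕ} {e : X → Episode S A (n + 1)} (he : Measurable e) :
    Measurable fun x => M.obsf (e x) := by
  have h := fun i : Fin (n + 1) => M.measurable_featf he i
  have h2 : ∀ i, Measurable fun x => M.ψ (e x i).1 := fun i => M.measurable_ψ.comp (by fun_prop)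
  refine measurable_pi_lambda _ fun j => measurable_pi_lambda _ fun k => ?_
  simp only [obsf, Finset.sum_apply, Pi.smul_apply]
  fun_prop

lemma measurable_obsr {n : ℕ} {e : X → Episode S A (n + 1)} (he : Measurable e) :
    Measurable fun x => M.obsr (e x) := by
  have h := fun i : Fin (n + 1) => M.measurable_featr he i
  refine measurable_pi_lambda _ fun j => measurable_pi_lambda _ fun k => ?_
  simp only [obsr, Finset.sum_apply, Pi.smul_apply]
  fun_prop

end

/-! ### Runs -/

instance (H k : ℕ) : IsMarkovKernel (M.runKernel π H k) := (M.runKernelAux π H k).2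

instance {H k : ℕ} (κ : Kernel (Weights dφ dφ' dψ) (Run S A dφ dφ' dψ H k))
    [IsMarkovKernel κ] : IsMarkovKernel (M.posteriorOf κ) := by
  have : IsMarkovKernel (κ.map data) := Kernel.IsMarkovKernel.map _ measurable_data
  unfold posteriorOf; infer_instance

instance (H k : ℕ) : IsProbabilityMeasure (M.runLaw π H k) := by unfold runLaw; infer_instance

lemma lintegral_extend {H k : ℕ} (κ : Kernel (Weights dφ dφ' dψ) (Run S A dφ dφ' dψ H k))
    [IsMarkovKernel κ] (w : Weights dφ dφ' dψ) {f : Run S A dφ dφ' dψ H (k + 1) → ℝ≥0∞}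
    (hf : Measurable f) :
    ∫⁻ x, f x ∂(M.extend π κ w) = ∫⁻ x, ∫⁻ w', ∫⁻ e, f (Fin.snoc x (w', e))
      ∂(M.episodeKernel π H (w, w')) ∂(M.posteriorOf κ (data x)) ∂(κ w) := by
  have hs : Measurable fun q : (Run S A dφ dφ' dψ H k × Weights dφ dφ' dψ) × Episode S A H =>
      (Fin.snoc q.1.1 (q.1.2, q.2) : Run S A dφ dφ' dψ H (k + 1)) :=
    (measurable_snoc k).comp (f := fun q : (Run S A dφ dφ' dψ H k × Weights dφ dφ' dψ) ×
      Episode S A H => (q.1.1, (q.1.2, q.2))) (by fun_prop)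
  have hfs : Measurable fun q : (Run S A dφ dφ' dψ H k × Weights dφ dφ' dψ) × Episode S A H =>
      f (Fin.snoc q.1.1 (q.1.2, q.2)) := hf.comp hs
  have h2 := Measurable.lintegral_kernel_prod_right'
    (κ := (M.episodeKernel π H).comap
        (fun p : Run S A dφ dφ' dψ H k × Weights dφ dφ' dψ => (w, p.2))
        (measurable_const.prodMk measurable_snd)) hfs
  rw [extend, Kernel.map_apply _ hs, lintegral_map hf hs]
  refine (Kernel.lintegral_compProd _ _ w hfs).trans ?_
  exact Kernel.lintegral_compProd _ _ w h2

lemma lintegral_runKernel_succ (H k : ℕ) (w : Weights dφ dφ' dψ)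
    {f : Run S A dφ dφ' dψ H (k + 1) → ℝ≥0∞} (hf : Measurable f) :
    ∫⁻ x, f x ∂(M.runKernel π H (k + 1) w) = ∫⁻ x, ∫⁻ w', ∫⁻ e, f (Fin.snoc x (w', e))
      ∂(M.episodeKernel π H (w, w')) ∂(M.posteriorOf (M.runKernel π H k) (data x))
      ∂(M.runKernel π H k w) :=
  M.lintegral_extend π (M.runKernel π H k) w hf

lemma measurable_lintegral_episode {X : Type*} [MeasurableSpace X] (H : ℕ)
    {w w' : X → Weights dφ dφ' dψ} (hw : Measurable w) (hw' : Measurable w')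
    {f : X × Episode S A H → ℝ≥0∞} (hf : Measurable f) :
    Measurable fun x => ∫⁻ e, f (x, e) ∂(M.episodeKernel π H (w x, w' x)) :=
  Measurable.lintegral_kernel_prod_right' (κ := (M.episodeKernel π H).comap
    (fun x => (w x, w' x)) (hw.prodMk hw')) hf

lemma measurable_lintegral_posterior {X : Type*} [MeasurableSpace X] (H k : ℕ)
    {y : X → (Fin k → Episode S A H)} (hy : Measurable y)
    {f : X × Weights dφ dφ' dψ → ℝ≥0∞} (hf : Measurable f) :
    Measurable fun x => ∫⁻ w', f (x, w') ∂(M.posteriorOf (M.runKernel π H k) (y x)) :=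
  Measurable.lintegral_kernel_prod_right' (κ := (M.posteriorOf (M.runKernel π H k)).comap
    y hy) hf

variable {M}

/-- The law of a run is absolutely continuous with respect to its law for zero weights, with
density the likelihood ratio. -/
lemma lintegral_runKernel (hr : M.σr ≠ 0) (hf : M.σf ≠ 0) (w : Weights dφ dφ' dψ) (n k : ℕ)
    {f : Run S A dφ dφ' dψ (n + 1) k → ℝ≥0∞} (hfm : Measurable f) :
    ∫⁻ x, f x ∂(M.runKernel π (n + 1) k w) =
      ∫⁻ x, f x * ENNReal.ofReal (Real.exp (∑ j, M.epLik w (x j).2))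
        ∂(M.runKernel π (n + 1) k 0) := by
  induction k with
  | zero => simp [runKernel, runKernelAux]
  | succ k ih =>
    have hl (k : ℕ) : Measurable fun x : Run S A dφ dφ' dψ (n + 1) k =>
        ENNReal.ofReal (Real.exp (∑ j, M.epLik w (x j).2)) :=
      (Real.measurable_exp.comp (Finset.measurable_sum _ fun j _ =>
        M.measurable_epLik measurable_const (by fun_prop))).ennreal_ofReal
    have hs : Measurable fun q : (Run S A dφ dφ' dψ (n + 1) k × Weights dφ dφ' dψ) ×
        Episode S A (n + 1) => (Fin.snoc q.1.1 (q.1.2, q.2) : Run S A dφ dφ' dψ (n + 1) (k + 1)) :=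
      (measurable_snoc k).comp (f := fun q : (Run S A dφ dφ' dψ (n + 1) k × Weights dφ dφ' dψ) ×
        Episode S A (n + 1) => (q.1.1, (q.1.2, q.2))) (by fun_prop)
    have hfs : Measurable fun q : (Run S A dφ dφ' dψ (n + 1) k × Weights dφ dφ' dψ) ×
        Episode S A (n + 1) => f (Fin.snoc q.1.1 (q.1.2, q.2)) := hfm.comp hs
    have h1 := M.measurable_lintegral_episode π (n + 1)
      (X := Run S A dφ dφ' dψ (n + 1) k × Weights dφ dφ' dψ)
      (measurable_const (a := w)) measurable_snd hfs
    have h2 := M.measurable_lintegral_posterior π (n + 1) k measurable_data h1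
    -- The law of the sampled weights depends on the run through its data and not on `w`, so it is
    -- the same under both measures and contributes no factor.
    rw [lintegral_runKernel_succ _ _ _ _ _ hfm, ih h2,
      lintegral_runKernel_succ _ _ _ _ _
        (f := fun x => f x * ENNReal.ofReal (Real.exp (∑ j, M.epLik w (x j).2)))
        (hfm.mul (hl (k + 1)))]
    refine lintegral_congr fun x => ?_
    rw [← lintegral_mul_const]
    · refine lintegral_congr fun w' => ?_
      have h3 : Measurable fun e : Episode S A (n + 1) => f (Fin.snoc x (w', e)) :=
        hfs.comp (measurable_prodMk_left (x := (x, w')))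
      rw [lintegral_episodeKernel π hr hf w w' n (f := fun e => f (Fin.snoc x (w', e))) h3,
        ← lintegral_mul_const]
      · refine lintegral_congr fun e => ?_
        rw [mul_assoc, ← ENNReal.ofReal_mul (Real.exp_pos _).le, ← Real.exp_add,
          Fin.sum_univ_castSucc]
        simp [add_comm]
      · exact h3.mul (Real.measurable_exp.comp
          (M.measurable_epLik measurable_const measurable_id)).ennreal_ofReal
    · exact h1.comp (measurable_prodMk_left (x := x))

end FeatureModel

end PSRL

end

noncomputable section

namespace PSRL

variable {S A : Type} [MeasurableSpace S] [MeasurableSpace A]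

namespace FeatureModel

variable {dφ dφ' dψ : ℕ} (M : FeatureModel S A dφ dφ' dψ) (π : Planner S A dφ dφ' dψ)

/-! ### Deviation of the weights from their posterior mean -/

section

variable {n k : ℕ} (y : Fin k → Episode S A (n + 1))

/-- Precision matrix for the transition gained in several episodes. -/
def runPrecf : Matrix (Fin dφ) (Fin dφ) ℝ := ∑ j, M.precf (y j)

/-- Precision matrix for the reward gained in several episodes. -/
def runPrecr : Matrix (Fin dφ') (Fin dφ') ℝ := ∑ j, M.precr (y j)

/-- Posterior deviation of the transition weights, given several episodes. -/
def devf (w : Weights dφ dφ' dψ) : ℝ≥0∞ :=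
  devSq M.covf (M.runPrecf y) (∑ j, M.obsf (y j)) fun j => (w.2 j).ofLp

/-- Posterior deviation of the reward weights, given several episodes. -/
def devr (w : Weights dφ dφ' dψ) : ℝ≥0∞ :=
  devSq M.covr (M.runPrecr y) (∑ j, M.obsr (y j)) fun _ => w.1.ofLp

lemma posSemidef_runPrecf : (M.runPrecf y).PosSemidef :=
  Matrix.posSemidef_sum _ fun j _ => M.posSemidef_precf (y j)

lemma posSemidef_runPrecr : (M.runPrecr y).PosSemidef :=
  Matrix.posSemidef_sum _ fun j _ => M.posSemidef_precr (y j)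

lemma sum_epLik (w : Weights dφ dφ' dψ) :
    ∑ j, M.epLik w (y j) =
      logLik (M.runPrecr y) (∑ j, M.obsr (y j)) (fun _ => w.1.ofLp) +
        logLik (M.runPrecf y) (∑ j, M.obsf (y j)) fun j => (w.2 j).ofLp := by
  rw [runPrecr, runPrecf, logLik_sum, logLik_sum, ← Finset.sum_add_distrib]
  exact Finset.sum_congr rfl fun j _ => M.epLik_eq_logLik w (y j)

end

section

variable {X : Type*} [MeasurableSpace X] {n k : ℕ} {y : X → Fin k → Episode S A (n + 1)}
  {w : X → Weights dφ dφ' dψ}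

lemma measurable_runPrecf (hy : Measurable y) (i j : Fin dφ) :
    Measurable fun x => M.runPrecf (y x) i j := by
  simp only [runPrecf, Matrix.sum_apply]
  exact Finset.measurable_sum _ fun l _ => M.measurable_precf (by fun_prop) i j

lemma measurable_runPrecr (hy : Measurable y) (i j : Fin dφ') :
    Measurable fun x => M.runPrecr (y x) i j := by
  simp only [runPrecr, Matrix.sum_apply]
  exact Finset.measurable_sum _ fun l _ => M.measurable_precr (by fun_prop) i j

lemma measurable_devf (hy : Measurable y) (hw : Measurable w) :
    Measurable fun x => M.devf (y x) (w x) :=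
  measurable_devSq _ (M.measurable_runPrecf hy)
    (Finset.measurable_fun_sum _ fun l _ => M.measurable_obsf (by fun_prop)) (by fun_prop)

lemma measurable_devr (hy : Measurable y) (hw : Measurable w) :
    Measurable fun x => M.devr (y x) (w x) :=
  measurable_devSq _ (M.measurable_runPrecr hy)
    (Finset.measurable_fun_sum _ fun l _ => M.measurable_obsr (by fun_prop)) (by fun_prop)

lemma measurable_exp_sum_epLik (hy : Measurable y) (hw : Measurable w) :
    Measurable fun x => ENNReal.ofReal (Real.exp (∑ j, M.epLik (w x) (y x j))) :=
  (Real.measurable_exp.comp (Finset.measurable_sum _ fun j _ =>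
    M.measurable_epLik hw (by fun_prop))).ennreal_ofReal

end

variable {M}

/-- Tonelli's theorem puts the weights inside: for a fixed run the inner integral is against the
unnormalized posterior. This is Bayes' rule without a disintegration. -/
lemma lintegral_runLaw (hr : M.σr ≠ 0) (hf : M.σf ≠ 0) (n k : ℕ)
    {f : Weights dφ dφ' dψ × Run S A dφ dφ' dψ (n + 1) k → ℝ≥0∞} (hfm : Measurable f) :
    ∫⁻ p, f p ∂(M.runLaw π (n + 1) k) =
      ∫⁻ x, ∫⁻ w, f (w, x) * ENNReal.ofReal (Real.exp (∑ j, M.epLik w (data x j))) ∂M.prior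
        ∂(M.runKernel π (n + 1) k 0) := by
  have h1 : Measurable fun p : Weights dφ dφ' dψ × Run S A dφ dφ' dψ (n + 1) k =>
      ENNReal.ofReal (Real.exp (∑ j, M.epLik p.1 (data p.2 j))) :=
    M.measurable_exp_sum_epLik (measurable_data.comp measurable_snd) measurable_fst
  rw [runLaw, Measure.lintegral_compProd hfm, lintegral_lintegral_swap
    (f := fun x w => f (w, x) * ENNReal.ofReal (Real.exp (∑ j, M.epLik w (data x j))))
    ((hfm.mul h1).comp measurable_swap).aemeasurable]
  exact lintegral_congr fun w =>
    lintegral_runKernel π hr hf w n k (hfm.comp measurable_prodMk_left)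

/-- For a fixed run, prior and likelihood both factor into reward and transition weights. The weight
`F` depends only on the run and the reward weights, so the bound for the transition deviation
applies as if `F` were constant. -/
lemma lintegral_mul_devf_le (hr : M.σr ≠ 0) (hf : M.σf ≠ 0) (n k : ℕ)
    {F : EuclideanSpace ℝ (Fin dφ') × Run S A dφ dφ' dψ (n + 1) k → ℝ≥0∞} (hF : Measurable F) :
    ∫⁻ p, F (p.1.1, p.2) * M.devf (data p.2) p.1 ∂(M.runLaw π (n + 1) k) ≤
      ENNReal.ofReal (16 * (2 + dφ + dψ * Real.log expSqMoment)) *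
        ∫⁻ p, F (p.1.1, p.2) ∂(M.runLaw π (n + 1) k) := by
  have h0 : Measurable fun p : Weights dφ dφ' dψ × Run S A dφ dφ' dψ (n + 1) k =>
    F (p.1.1, p.2) := by fun_prop
  have h1 : Measurable fun p : Weights dφ dφ' dψ × Run S A dφ dφ' dψ (n + 1) k =>
      M.devf (data p.2) p.1 :=
    M.measurable_devf (measurable_data.comp measurable_snd) measurable_fst
  rw [lintegral_runLaw π hr hf n k
    (f := fun p => F (p.1.1, p.2) * M.devf (data p.2) p.1) (h0.mul h1),
    lintegral_runLaw π hr hf n k (f := fun p => F (p.1.1, p.2)) h0,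
    ← lintegral_const_mul' _ _ ENNReal.ofReal_ne_top]
  refine lintegral_mono fun x => ?_
  simp only [sum_epLik, Real.exp_add, ENNReal.ofReal_mul (Real.exp_pos _).le, prior]
  set lr : EuclideanSpace ℝ (Fin dφ') → ℝ≥0∞ := fun v => ENNReal.ofReal (Real.exp
    (logLik (M.runPrecr (data x)) (∑ j, M.obsr (data x j)) fun _ => v.ofLp)) with hlr
  have m1 : Measurable fun v => F (v, x) * lr v :=
    (hF.comp measurable_prodMk_right).mul ((measurable_exp_logLik_weights (ι := Fin 1) _ _).comp
      (f := fun v _ => v) (by fun_prop))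
  have m2 := measurable_exp_logLik_weights (M.runPrecf (data x)) (∑ j, M.obsf (data x j))
  have m3 : Measurable fun v : Fin dψ → EuclideanSpace ℝ (Fin dφ) => devSq M.covf
      (M.runPrecf (data x)) (∑ j, M.obsf (data x j)) fun j => (v j).ofLp :=
    measurable_devSq_weights _ _ _
  have e1 := lintegral_prod_mul (μ := multivariateGaussian 0 M.covr)
    (ν := Measure.pi fun _ : Fin dψ => multivariateGaussian 0 M.covf)
    m1.aemeasurable (m3.mul m2).aemeasurable
  have e2 := lintegral_prod_mul (μ := multivariateGaussian 0 M.covr)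
    (ν := Measure.pi fun _ : Fin dψ => multivariateGaussian 0 M.covf)
    m1.aemeasurable m2.aemeasurable
  calc _ = _ := lintegral_congr fun w => mul_mul_mul_comm _ _ _ _
    _ = _ := e1
    _ ≤ (∫⁻ v, F (v, x) * lr v ∂(multivariateGaussian 0 M.covr)) *
        (ENNReal.ofReal (16 * (2 + dφ + dψ * Real.log expSqMoment)) * _) := by
      gcongr
      simpa using lintegral_devSq_le M.posSemidef_covf (M.posSemidef_runPrecf (data x))
        (∑ j, M.obsf (data x j))
    _ = _ := mul_left_comm _ _ _
    _ = _ := by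
      rw [← e2]
      congr 1
      exact lintegral_congr fun w => mul_assoc _ _ _

lemma lintegral_mul_devr_le (hr : M.σr ≠ 0) (hf : M.σf ≠ 0) (n k : ℕ) :
    ∫⁻ p, M.devr (data p.2) p.1 ∂(M.runLaw π (n + 1) k) ≤
      ENNReal.ofReal (16 * (2 + dφ' + Real.log expSqMoment)) := by
  have h1 : Measurable fun p : Weights dφ dφ' dψ × Run S A dφ dφ' dψ (n + 1) k =>
      M.devr (data p.2) p.1 :=
    M.measurable_devr (measurable_data.comp measurable_snd) measurable_fst
  have h2 : ENNReal.ofReal (16 * (2 + dφ' + Real.log expSqMoment)) =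
      ENNReal.ofReal (16 * (2 + dφ' + Real.log expSqMoment)) *
        ∫⁻ p, 1 ∂(M.runLaw π (n + 1) k) := by simp
  rw [h2, lintegral_runLaw π hr hf n k (f := fun p => M.devr (data p.2) p.1) h1,
    lintegral_runLaw π hr hf n k (f := fun _ => 1) measurable_const,
    ← lintegral_const_mul' _ _ ENNReal.ofReal_ne_top]
  refine lintegral_mono fun x => ?_
  simp only [sum_epLik, Real.exp_add, ENNReal.ofReal_mul (Real.exp_pos _).le, prior, one_mul]
  set lr : EuclideanSpace ℝ (Fin dφ') → ℝ≥0∞ := fun v => ENNReal.ofReal (Real.exp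
    (logLik (M.runPrecr (data x)) (∑ j, M.obsr (data x j)) fun _ => v.ofLp)) with hlr
  set dr : EuclideanSpace ℝ (Fin dφ') → ℝ≥0∞ := fun v => devSq M.covr
    (M.runPrecr (data x)) (∑ j, M.obsr (data x j)) fun _ => v.ofLp with hdr
  have m1 : Measurable lr := (measurable_exp_logLik_weights (ι := Fin 1) _ _).comp
      (f := fun v _ => v) (by fun_prop)
  have m3 : Measurable dr := (measurable_devSq_weights (ι := Fin 1) _ _ _).comp
      (f := fun v _ => v) (by fun_prop)
  have m2 := measurable_exp_logLik_weights (M.runPrecf (data x)) (∑ j, M.obsf (data x j))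
  have e1 := lintegral_prod_mul (μ := multivariateGaussian 0 M.covr)
    (ν := Measure.pi fun _ : Fin dψ => multivariateGaussian 0 M.covf)
    (m3.mul m1).aemeasurable m2.aemeasurable
  have e2 := lintegral_prod_mul (μ := multivariateGaussian 0 M.covr)
    (ν := Measure.pi fun _ : Fin dψ => multivariateGaussian 0 M.covf)
    m1.aemeasurable m2.aemeasurable
  -- The reward is a regression with a single output; families indexed by `Fin 1` are identified
  -- with their only member.
  have mp := measurePreserving_funUnique (multivariateGaussian 0 M.covr) (Fin 1)
  have hdev : ∫⁻ v, dr v * lr v ∂(multivariateGaussian 0 M.covr) ≤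
      ENNReal.ofReal (16 * (2 + dφ' + Real.log expSqMoment)) *
        ∫⁻ v, lr v ∂(multivariateGaussian 0 M.covr) := by
    have h := lintegral_devSq_le (ι := Fin 1) M.posSemidef_covr (M.posSemidef_runPrecr (data x))
      (∑ j, M.obsr (data x j))
    rw [← mp.lintegral_comp (f := fun v => dr v * lr v) (m3.mul m1), ← mp.lintegral_comp m1]
    simp only [Fintype.card_fin, Nat.cast_one, one_mul] at h
    have hW (W : Fin 1 → EuclideanSpace ℝ (Fin dφ')) :
        (fun _ : Fin 1 => (MeasurableEquiv.funUnique (Fin 1) _ W).ofLp) = fun j => (W j).ofLp :=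
      funext fun j => by rw [Subsingleton.elim j 0]; rfl
    simp only [hdr, hlr, hW]
    exact h
  calc _ = _ := lintegral_congr fun w => (mul_assoc _ _ _).symm
    _ = _ := e1
    _ ≤ _ := mul_le_mul_left hdev _
    _ = _ := mul_assoc _ _ _
    _ = _ := by rw [← e2]

variable (M)

/-! ### Posterior sampling -/

lemma lintegral_runLaw_eq (H k : ℕ)
    {f : Weights dφ dφ' dψ × Run S A dφ dφ' dψ H k → ℝ≥0∞} (hf : Measurable f) :
    ∫⁻ p, f p ∂(M.runLaw π H k) = ∫⁻ w, ∫⁻ x, f (w, x) ∂(M.runKernel π H k w) ∂M.prior := by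
  rw [runLaw, Measure.lintegral_compProd hf]

/-- Given the data, true and sampled weights have the same law. -/
lemma lintegral_posterior (H k : ℕ)
    {G : Weights dφ dφ' dψ × (Fin k → Episode S A H) → ℝ≥0∞} (hG : Measurable G) :
    ∫⁻ p, ∫⁻ w', G (w', data p.2) ∂(M.posteriorOf (M.runKernel π H k) (data p.2))
        ∂(M.runLaw π H k) =
      ∫⁻ p, G (p.1, data p.2) ∂(M.runLaw π H k) := by
  have h1 : Measurable fun y => ∫⁻ w', G (w', y) ∂(M.posteriorOf (M.runKernel π H k) y) :=
    M.measurable_lintegral_posterior π H k measurable_id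
      (f := fun p : (Fin k → Episode S A H) × Weights dφ dφ' dψ => G (p.2, p.1)) (by fun_prop)
  have hdat : Measurable (data : Run S A dφ dφ' dψ H k → _) := measurable_data
  have : IsMarkovKernel ((M.runKernel π H k).map data) := Kernel.IsMarkovKernel.map _ hdat
  have key : (((M.runKernel π H k).map data) ∘ₘ M.prior) ⊗ₘ M.posteriorOf (M.runKernel π H k) =
      (M.prior ⊗ₘ (M.runKernel π H k).map data).map Prod.swap := compProd_posterior_eq_map_swap
  have hG' : Measurable fun q : (Fin k → Episode S A H) × Weights dφ dφ' dψ => G (q.2, q.1) := by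
    fun_prop
  have e := congrArg (fun m => ∫⁻ q, G (q.2, q.1) ∂m) key
  rw [Measure.lintegral_compProd hG', lintegral_map hG' measurable_swap,
    Measure.lintegral_bind (Kernel.aemeasurable _) h1.aemeasurable,
    Measure.lintegral_compProd (f := fun q => G (q.swap.2, q.swap.1))
      (hG'.comp measurable_swap)] at e
  refine (M.lintegral_runLaw_eq π H k (h1.comp (measurable_data.comp measurable_snd))).trans ?_
  rw [lintegral_runLaw_eq _ _ _ _ (f := fun p => G (p.1, data p.2))
      (hG.comp (measurable_fst.prodMk (measurable_data.comp measurable_snd)))]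
  simp only [Kernel.map_apply _ hdat, Prod.fst_swap, Prod.snd_swap] at e
  rw [lintegral_congr fun w => lintegral_map h1 hdat] at e
  refine e.trans (lintegral_congr fun w => ?_)
  rw [lintegral_map (f := fun y => G (w, y)) (by fun_prop) hdat]

lemma lintegral_runLaw_succ (H k : ℕ)
    {f : Weights dφ dφ' dψ × Run S A dφ dφ' dψ H (k + 1) → ℝ≥0∞} (hf : Measurable f) :
    ∫⁻ p, f p ∂(M.runLaw π H (k + 1)) =
      ∫⁻ p, ∫⁻ w', ∫⁻ e, f (p.1, Fin.snoc p.2 (w', e)) ∂(M.episodeKernel π H (p.1, w'))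
        ∂(M.posteriorOf (M.runKernel π H k) (data p.2)) ∂(M.runLaw π H k) := by
  have hs : Measurable fun q : ((Weights dφ dφ' dψ × Run S A dφ dφ' dψ H k) ×
      Weights dφ dφ' dψ) × Episode S A H =>
      (q.1.1.1, (Fin.snoc q.1.1.2 (q.1.2, q.2) : Run S A dφ dφ' dψ H (k + 1))) :=
    Measurable.prodMk (by fun_prop) ((measurable_snoc k).comp
      (f := fun q : ((Weights dφ dφ' dψ × Run S A dφ dφ' dψ H k) ×
        Weights dφ dφ' dψ) × Episode S A H => (q.1.1.2, (q.1.2, q.2))) (by fun_prop))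
  have h1 := M.measurable_lintegral_episode π H
    (X := (Weights dφ dφ' dψ × Run S A dφ dφ' dψ H k) × Weights dφ dφ' dψ)
    (measurable_fst.comp measurable_fst) measurable_snd (hf.comp hs)
  have h2 := M.measurable_lintegral_posterior π H k
    (X := Weights dφ dφ' dψ × Run S A dφ dφ' dψ H k) (measurable_data.comp measurable_snd) h1
  rw [lintegral_runLaw_eq _ _ _ _ hf]
  refine Eq.trans ?_ (M.lintegral_runLaw_eq π H k h2).symm
  exact lintegral_congr fun w =>
    M.lintegral_runKernel_succ π H k w (hf.comp measurable_prodMk_left)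

lemma lintegral_runLaw_init (H k : ℕ)
    {f : Weights dφ dφ' dψ × Run S A dφ dφ' dψ H k → ℝ≥0∞} (hf : Measurable f) :
    ∫⁻ p, f (p.1, Fin.init p.2) ∂(M.runLaw π H (k + 1)) = ∫⁻ p, f p ∂(M.runLaw π H k) := by
  rw [lintegral_runLaw_succ _ _ _ _ (f := fun p => f (p.1, Fin.init p.2))
    (hf.comp (measurable_fst.prodMk ((measurable_init k).comp measurable_snd)))]
  simp

/-- The identity behind posterior sampling, in the form in which it is used: jointly with the
preceding data, sampled and true weights are indistinguishable. -/
lemma lintegral_runLaw_last (H k : ℕ)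
    {G : Weights dφ dφ' dψ × (Fin k → Episode S A H) → ℝ≥0∞} (hG : Measurable G) :
    ∫⁻ p, G ((p.2 (Fin.last k)).1, data (Fin.init p.2)) ∂(M.runLaw π H (k + 1)) =
      ∫⁻ p, G (p.1, data p.2) ∂(M.runLaw π H k) := by
  have h1 : Measurable fun p : Weights dφ dφ' dψ × Run S A dφ dφ' dψ H (k + 1) =>
      data (Fin.init p.2 : Run S A dφ dφ' dψ H k) :=
    measurable_data.comp ((measurable_init k).comp measurable_snd)
  rw [lintegral_runLaw_succ _ _ _ _ (f := fun p => G ((p.2 (Fin.last k)).1, data (Fin.init p.2)))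
    (hG.comp (Measurable.prodMk (by fun_prop) h1)), ← lintegral_posterior _ _ _ _ hG]
  simp

lemma map_fst_runLaw (H k : ℕ) : (M.runLaw π H k).map Prod.fst = M.prior := by
  rw [runLaw]
  exact Measure.fst_compProd _ _

lemma map_last_runLaw (H k : ℕ) :
    (M.runLaw π H (k + 1)).map (fun p => (p.2 (Fin.last k)).1) = M.prior := by
  ext s hs
  rw [← lintegral_indicator_one hs, ← lintegral_indicator_one hs, ← M.map_fst_runLaw π H k,
    lintegral_map (measurable_one.indicator hs) (by fun_prop),
    lintegral_map (measurable_one.indicator hs) measurable_fst]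
  exact M.lintegral_runLaw_last π H k (G := fun q => s.indicator 1 q.1)
    ((measurable_one.indicator hs).comp measurable_fst)

lemma map_init_runLaw (H k : ℕ) :
    (M.runLaw π H (k + 1)).map (fun p => (p.1, Fin.init p.2)) = M.runLaw π H k := by
  have hi : Measurable fun p : Weights dφ dφ' dψ × Run S A dφ dφ' dψ H (k + 1) =>
      (p.1, (Fin.init p.2 : Run S A dφ dφ' dψ H k)) :=
    measurable_fst.prodMk ((measurable_init k).comp measurable_snd)
  ext s hs
  rw [← lintegral_indicator_one hs, ← lintegral_indicator_one hs,
    lintegral_map (measurable_one.indicator hs) hi]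
  exact M.lintegral_runLaw_init π H k (measurable_one.indicator hs)

end FeatureModel

end PSRL

end

noncomputable section

namespace PSRL

/-! ### Total variation distance of Gaussian measures -/

section TotalVariation

variable {X Y : Type*} [MeasurableSpace X] [MeasurableSpace Y]

lemma integrable_of_abs_le {μ : Measure X} [IsFiniteMeasure μ] {f : X → ℝ} (hf : Measurable f)
    {B : ℝ} (hB : ∀ x, |f x| ≤ B) : Integrable f μ :=
  Integrable.of_bound hf.aestronglyMeasurable B (ae_of_all _ hB)

lemma abs_integral_le {μ : Measure X} [IsProbabilityMeasure μ] {f : X → ℝ} {B : ℝ}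
    (hB : ∀ x, |f x| ≤ B) : |∫ x, f x ∂μ| ≤ B := by
  simpa using norm_integral_le_of_norm_le_const (μ := μ) (f := f) (ae_of_all _ hB)

lemma integral_bind_of_abs_le {μ : Measure X} [IsFiniteMeasure μ] (κ : Kernel X Y)
    [IsMarkovKernel κ] {f : Y → ℝ} (hf : Measurable f) {B : ℝ} (hB : ∀ x, |f x| ≤ B) :
    ∫ y, f y ∂(μ.bind κ) = ∫ x, ∫ y, f y ∂(κ x) ∂μ := by
  have h : μ.bind κ = (κ ∘ₖ Kernel.const Unit μ) () := by rw [Kernel.comp_apply, Kernel.const_apply]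
  rw [h, Kernel.integral_comp, Kernel.const_apply]
  exact integrable_of_abs_le hf hB

variable {ι : Type*} [Fintype ι]

/-- With `t = ‖δ‖ / σ`, the likelihood ratio `L` of the shift has second moment `exp (t²)`. For `t ≤
1` this makes `E |L - 1|` of order `t`; for `t ≥ 1` the trivial bound `2 B` suffices. -/
lemma abs_integral_pi_gaussianReal_add_sub_le {σ : ℝ≥0} (hσ : σ ≠ 0) (δ : ι → ℝ)
    {g : (ι → ℝ) → ℝ} (hg : Measurable g) {B : ℝ} (hB : ∀ x, |g x| ≤ B) :
    |∫ x, g (δ + x) ∂(Measure.pi fun _ : ι => gaussianReal 0 (σ ^ 2)) -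
        ∫ x, g x ∂(Measure.pi fun _ : ι => gaussianReal 0 (σ ^ 2))| ≤
      2 * B * (Real.sqrt (∑ i, δ i ^ 2) / σ) := by
  set ν := Measure.pi fun _ : ι => gaussianReal 0 (σ ^ 2) with hν
  set t := Real.sqrt (∑ i, δ i ^ 2) / σ with ht
  have hσ' : (0 : ℝ) < σ := by positivity
  have hB0 : 0 ≤ B := (abs_nonneg _).trans (hB 0)
  have ht0 : 0 ≤ t := by positivity
  have hgm : Measurable fun x => g (δ + x) := by fun_prop
  have hS : 0 ≤ ∑ i, δ i ^ 2 := Finset.sum_nonneg fun i _ => sq_nonneg _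
  rcases le_total 1 t with h1 | h1
  · calc _ ≤ |∫ x, g (δ + x) ∂ν| + |∫ x, g x ∂ν| := abs_sub _ _
      _ ≤ B + B := add_le_add (abs_integral_le fun x => hB _) (abs_integral_le hB)
      _ ≤ _ := by nlinarith
  rcases ht0.eq_or_lt with h0 | h0
  · have hz : ∑ i, δ i ^ 2 = 0 := by
      have := (div_eq_zero_iff.1 (ht.symm.trans h0.symm)).resolve_right hσ'.ne'
      exact (Real.sqrt_eq_zero hS).1 this
    have hδ : δ = 0 := by
      ext i
      simpa using (Finset.sum_eq_zero_iff_of_nonneg fun i _ => sq_nonneg (δ i)).1 hz i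
        (Finset.mem_univ i)
    rw [← h0]
    simp [hδ]
  have hv : σ ^ 2 ≠ 0 := pow_ne_zero 2 hσ
  set L : (ι → ℝ) → (ι → ℝ) → ℝ := fun m x =>
    Real.exp ((∑ i, (m i * x i - m i ^ 2 / 2)) / (σ ^ 2 : ℝ≥0)) with hL
  have hLm (m : ι → ℝ) : Measurable (L m) := by fun_prop
  have hmap (m : ι → ℝ) : ν.map (fun x => m + x) = ν.withDensity fun x => ENNReal.ofReal (L m x) :=
    pi_gaussianReal_map_add m hv
  have hLone (m : ι → ℝ) : ∫⁻ x, ENNReal.ofReal (L m x) ∂ν = 1 := by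
    rw [← setLIntegral_univ, ← withDensity_apply _ MeasurableSet.univ, ← hmap,
      Measure.map_apply (by fun_prop) MeasurableSet.univ]
    simp
  have hLint (m : ι → ℝ) : Integrable (L m) ν := by
    refine ⟨(hLm m).aestronglyMeasurable, ?_⟩
    rw [hasFiniteIntegral_iff_ofReal (ae_of_all _ fun x => (Real.exp_pos _).le), hLone]
    exact ENNReal.one_lt_top
  have hLi (m : ι → ℝ) : ∫ x, L m x ∂ν = 1 := by
    rw [integral_eq_lintegral_of_nonneg_ae (ae_of_all _ fun x => (Real.exp_pos _).le)
      (hLm m).aestronglyMeasurable, hLone, ENNReal.toReal_one]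
  -- The square of a Gaussian likelihood ratio is a multiple of the ratio for the doubled shift,
  -- which integrates to one.
  have hsq (x : ι → ℝ) : L δ x ^ 2 = Real.exp (t ^ 2) * L (2 • δ) x := by
    rw [hL, ← Real.exp_nat_mul, ← Real.exp_add]
    congr 1
    have h2 : t ^ 2 = (∑ i, δ i ^ 2) / (σ ^ 2 : ℝ≥0) := by
      rw [ht, div_pow, Real.sq_sqrt hS]; push_cast; rfl
    rw [h2, ← add_div, ← Finset.sum_add_distrib, mul_div_assoc', Finset.mul_sum]
    congr 1
    refine Finset.sum_congr rfl fun i _ => ?_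
    simp
    ring
  have hshift : ∫ x, g (δ + x) ∂ν = ∫ x, L δ x * g x ∂ν := by
    rw [← integral_map (φ := fun x => δ + x) (f := g) (by fun_prop) hg.aestronglyMeasurable, hmap,
      integral_withDensity_eq_integral_toReal_smul (by fun_prop)
        (ae_of_all _ fun x => ENNReal.ofReal_lt_top)]
    simp only [ENNReal.toReal_ofReal (Real.exp_pos _).le, hL, smul_eq_mul]
  have hgi : Integrable g ν := integrable_of_abs_le hg hB
  have hLg : Integrable (fun x => L δ x * g x) ν := by
    have := (hLint δ).bdd_mul (c := B) hg.aestronglyMeasurable (ae_of_all _ hB)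
    exact this.congr (ae_of_all _ fun x => mul_comm _ _)
  have hsqi : Integrable (fun x => L δ x ^ 2) ν := by
    simp only [hsq]
    exact (hLint _).const_mul _
  have i1 : Integrable (fun x => L δ x ^ 2 - 2 * L δ x) ν := hsqi.sub ((hLint δ).const_mul 2)
  have i2 : Integrable (fun x => L δ x ^ 2 - 2 * L δ x + 1) ν := i1.add (integrable_const _)
  have i3 : Integrable (fun x => 2 * t + (L δ x ^ 2 - 2 * L δ x + 1) / (2 * t)) ν :=
    (integrable_const _).add (i2.div_const _)
  have hrhs : Integrable (fun x => B * ((2 * t + (L δ x ^ 2 - 2 * L δ x + 1) / (2 * t)) / 2)) ν :=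
    (i3.div_const _).const_mul _
  rw [hshift, ← integral_sub hLg hgi]
  calc |∫ x, (L δ x * g x - g x) ∂ν| ≤ ∫ x, |L δ x * g x - g x| ∂ν := abs_integral_le_integral_abs
    -- Here `|y| ≤ (2t + y² / (2t)) / 2` replaces the Cauchy–Schwarz inequality, with `y = L - 1`;
    -- the size of `2t` is that of the expected `|y|`.
    _ ≤ ∫ x, B * ((2 * t + (L δ x ^ 2 - 2 * L δ x + 1) / (2 * t)) / 2) ∂ν := by
      refine integral_mono (hLg.sub hgi).abs hrhs fun x => ?_
      have e : L δ x * g x - g x = (L δ x - 1) * g x := by ring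
      simp only [e, abs_mul]
      rw [mul_comm]
      refine mul_le_mul (hB x) ?_ (abs_nonneg _) hB0
      rw [le_div_iff₀ two_pos, ← sub_nonneg]
      have e2 : 2 * t + (L δ x ^ 2 - 2 * L δ x + 1) / (2 * t) - |L δ x - 1| * 2 =
          (|L δ x - 1| - 2 * t) ^ 2 / (2 * t) := by
        have : |L δ x - 1| ^ 2 = (L δ x - 1) ^ 2 := sq_abs _
        field_simp
        linear_combination -this
      rw [e2]
      positivity
    _ = B * ((2 * t + (Real.exp (t ^ 2) - 1) / (2 * t)) / 2) := by
      have hE : ∫ x, L δ x ^ 2 ∂ν = Real.exp (t ^ 2) := by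
        simp only [hsq]
        rw [integral_const_mul, hLi, mul_one]
      rw [integral_const_mul, integral_div, integral_add (integrable_const _) (i2.div_const _),
        integral_div, integral_add i1 (integrable_const _),
        integral_sub hsqi ((hLint δ).const_mul 2), integral_const_mul 2 (L δ), hLi, hE]
      simp only [integral_const, probReal_univ, smul_eq_mul, one_mul]
      congr 3
      ring
    _ ≤ 2 * B * t := by
      have h3 : Real.exp (t ^ 2) - 1 ≤ 2 * t ^ 2 := by
        have := Real.abs_exp_sub_one_le (x := t ^ 2) (by rw [abs_of_nonneg (sq_nonneg t)]; nlinarith)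
        rw [abs_of_nonneg (sq_nonneg t)] at this
        exact (le_abs_self _).trans this
      have h4 : (Real.exp (t ^ 2) - 1) / (2 * t) ≤ t := by
        rw [div_le_iff₀ (by positivity)]; nlinarith
      nlinarith

end TotalVariation

variable {S A : Type} [MeasurableSpace S] [MeasurableSpace A]

namespace FeatureModel

variable {dφ dφ' dψ : ℕ} (M : FeatureModel S A dφ dφ' dψ) (π : Planner S A dφ dφ' dψ)

/-- Distance of the mean embeddings of the next state for two weights. -/
def transDist (w w' : Weights dφ dφ' dψ) (h : S × A) : ℝ :=
  Real.sqrt (∑ j, (M.meanEmbedding (w', h) j - M.meanEmbedding (w, h) j) ^ 2)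

variable {M}

/-- Both transitions decode with the same kernel, so averaging `f` over the decoded state reduces
the claim to the Gaussian embeddings. -/
lemma abs_integral_transKernel_sub_le (hσ : M.σf ≠ 0) (w w' : Weights dφ dφ' dψ) (h : S × A)
    {f : S → ℝ} (hf : Measurable f) {B : ℝ} (hB : ∀ s, |f s| ≤ B) :
    |∫ s, f s ∂(M.transKernel (w', h)) - ∫ s, f s ∂(M.transKernel (w, h))| ≤
      2 * B * (M.transDist w w' h / M.σf) := by
  have := M.isMarkovKernel_decode
  set g : (Fin dψ → ℝ) → ℝ := fun z => ∫ s, f s ∂(M.decode z) with hgdef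
  have hg : Measurable g := hf.stronglyMeasurable.integral_kernel.measurable
  have hgB (z) : |g z| ≤ B := abs_integral_le hB
  have key (w) : ∫ s, f s ∂(M.transKernel (w, h)) = ∫ x, g (M.meanEmbedding (w, h) + x)
      ∂(Measure.pi fun _ => gaussianReal 0 (M.σf ^ 2)) := by
    rw [transKernel, Kernel.comp_apply, integral_bind_of_abs_le _ hf hB, embeddingKernel_apply,
      integral_map (by fun_prop) hg.aestronglyMeasurable]
  have := abs_integral_pi_gaussianReal_add_sub_le hσ
    (M.meanEmbedding (w', h) - M.meanEmbedding (w, h))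
    (g := fun x => g (M.meanEmbedding (w, h) + x)) (by fun_prop) (fun x => hgB _)
  rw [key, key, transDist]
  simpa [← add_assoc] using this

end FeatureModel

end PSRL

end

noncomputable section

namespace PSRL

variable {S A : Type} [MeasurableSpace S] [MeasurableSpace A]

namespace FeatureModel

variable {dφ dφ' dψ : ℕ} (M : FeatureModel S A dφ dφ' dψ) (π : Planner S A dφ dφ' dψ)

/-! ### The value difference -/

/-- The value, with `j` steps to go at step `i`, of the policy planned for `w'` in the MDP with
weights `w'`. -/
def valueToGo (w' : Weights dφ dφ' dψ) : ℕ → ℕ → S → ℝ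
  | 0, _, _ => 0
  | j + 1, i, s => M.meanReward (w', (s, π.act w' i s)) +
      ∫ t, valueToGo w' j (i + 1) t ∂(M.transKernel (w', (s, π.act w' i s)))

/-- Expected reward at step `i` of the policy planned for `w'` in the MDP with weights `w`. -/
def expReward (w w' : Weights dφ dφ' dψ) (i : ℕ) : ℝ :=
  ∫ x, M.meanReward (w, (x.2, π.act w' i x.2)) ∂(M.partialEpisode π i (w, w'))

/-- Expected total reward of the policy planned for `w'` in the MDP with weights `w`. -/
def totalReward (H : ℕ) (w w' : Weights dφ dφ' dψ) : ℝ :=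
  ∑ i ∈ Finset.range H, M.expReward π w w' i

lemma measurable_action (w' : Weights dφ dφ' dψ) (i : ℕ) :
    Measurable fun s => (s, π.act w' i s) :=
  measurable_id.prodMk ((π.policy w').measurable_act i)

lemma measurable_valueToGo (w' : Weights dφ dφ' dψ) (j i : ℕ) :
    Measurable (M.valueToGo π w' j i) := by
  induction j generalizing i with
  | zero => exact measurable_const
  | succ j ih =>
    have h1 : Measurable fun s : S => (w', (s, π.act w' i s)) :=
      measurable_prodMk_left.comp (measurable_action π w' i)
    exact (M.measurable_meanReward.comp h1).add
      ((ih (i + 1)).stronglyMeasurable.integral_kernel.measurable.comp h1)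

lemma abs_valueToGo_le {w' : Weights dφ dφ' dψ} {R : ℝ} (hR : ∀ h, |M.meanReward (w', h)| ≤ R)
    (j i : ℕ) (s : S) : |M.valueToGo π w' j i s| ≤ j * R := by
  induction j generalizing i s with
  | zero => simp [valueToGo]
  | succ j ih =>
    refine (abs_add_le _ _).trans ?_
    have := abs_integral_le (μ := M.transKernel (w', (s, π.act w' i s)))
      (f := M.valueToGo π w' j (i + 1)) (ih (i + 1))
    push_cast
    linarith [hR (s, π.act w' i s)]

/-- Law of the next state under the policy planned for `w'`, given the current state. -/
def nextKernel (w w' : Weights dφ dφ' dψ) (i : ℕ) : Kernel S S :=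
  M.transKernel.comap (fun s => (w, (s, π.act w' i s)))
    (measurable_prodMk_left.comp (measurable_action π w' i))

instance (w w' : Weights dφ dφ' dψ) (i : ℕ) : IsMarkovKernel (M.nextKernel π w w' i) := by
  unfold nextKernel; infer_instance

lemma map_snd_partialEpisode_succ (w w' : Weights dφ dφ' dψ) (i : ℕ) :
    (M.partialEpisode π (i + 1) (w, w')).map Prod.snd =
      ((M.partialEpisode π i (w, w')).map Prod.snd).bind (M.nextKernel π w w' i) := by
  ext s hs
  have h1 : Measurable (s.indicator (1 : S → ℝ≥0∞)) := measurable_one.indicator hs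
  rw [← lintegral_indicator_one hs, ← lintegral_indicator_one hs,
    lintegral_map h1 measurable_snd,
    Measure.lintegral_bind (Kernel.aemeasurable _) h1.aemeasurable,
    lintegral_map h1.lintegral_kernel measurable_snd,
    lintegral_partialEpisode_succ _ _ _ _ (f := fun x => s.indicator 1 x.2)
      (h1.comp measurable_snd)]
  refine lintegral_congr fun x => ?_
  refine (lintegral_stepKernel M π i w w' x (g := fun q => s.indicator 1 q.2.2)
    (h1.comp (measurable_snd.comp measurable_snd))).trans ?_
  simp [nextKernel]

lemma integral_partialEpisode_succ (w w' : Weights dφ dφ' dψ) (i : ℕ) {f : S → ℝ}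
    (hf : Measurable f) {B : ℝ} (hB : ∀ s, |f s| ≤ B) :
    ∫ x, f x.2 ∂(M.partialEpisode π (i + 1) (w, w')) =
      ∫ x, ∫ t, f t ∂(M.transKernel (w, (x.2, π.act w' i x.2)))
        ∂(M.partialEpisode π i (w, w')) := by
  rw [← integral_map (φ := Prod.snd) (f := f) measurable_snd.aemeasurable hf.aestronglyMeasurable,
    map_snd_partialEpisode_succ]
  have : IsProbabilityMeasure ((M.partialEpisode π i (w, w')).map Prod.snd) :=
    Measure.isProbabilityMeasure_map measurable_snd.aemeasurable
  rw [integral_bind_of_abs_le _ hf hB, integral_map (f := fun s => ∫ y, f y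
      ∂(M.nextKernel π w w' i s)) measurable_snd.aemeasurable
    hf.stronglyMeasurable.integral_kernel.aestronglyMeasurable]
  rfl

/-- Expected difference of the rewards at step `i`. -/
def rewGap (w w' : Weights dφ dφ' dψ) (i : ℕ) : ℝ≥0∞ :=
  ∫⁻ x, ‖M.meanReward (w', (x.2, π.act w' i x.2)) - M.meanReward (w, (x.2, π.act w' i x.2))‖ₑ
    ∂(M.partialEpisode π i (w, w'))

/-- Expected loss at step `i` from the difference of the transitions, for values of size `B`. -/
def transGap (B : ℝ) (w w' : Weights dφ dφ' dψ) (i : ℕ) : ℝ≥0∞ :=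
  ∫⁻ x, ENNReal.ofReal (2 * B * (M.transDist w w' (x.2, π.act w' i x.2) / M.σf))
    ∂(M.partialEpisode π i (w, w'))

variable {M}

/-- One step of the Bellman recursion in the sampled model is exchanged for a step of the true one.
The error is the gap of the rewards plus the remaining value integrated against the difference of
the transitions; iterating keeps all errors on the state law of the true model. The last step leaves
no remaining value, hence only `j - 1` transition terms. -/
lemma enorm_valueToGo_sub_le (hσ : M.σf ≠ 0) {w w' : Weights dφ dφ' dψ} {R R' : ℝ}
    (hR : ∀ h, |M.meanReward (w, h)| ≤ R) (hR' : ∀ h, |M.meanReward (w', h)| ≤ R') (H j i : ℕ)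
    (hj : j ≤ H) :
    ‖∫ x, M.valueToGo π w' j i x.2 ∂(M.partialEpisode π i (w, w')) -
        ∑ n ∈ Finset.range j, M.expReward π w w' (i + n)‖ₑ ≤
      ∑ n ∈ Finset.range j, M.rewGap π w w' (i + n) +
      ∑ n ∈ Finset.range (j - 1), M.transGap π (H * R') w w' (i + n) := by
  induction j generalizing i with
  | zero => simp [valueToGo]
  | succ j ih =>
    have hm : Measurable fun x : Episode S A i × S => (x.2, π.act w' i x.2) :=
      (measurable_action π w' i).comp measurable_snd
    have hm1 (w : Weights dφ dφ' dψ) : Measurable fun x : Episode S A i × S => (w, (x.2, π.act w' i x.2)) :=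
      measurable_prodMk_left.comp hm
    have hU := M.measurable_valueToGo π w' j (i + 1)
    have hUB := M.abs_valueToGo_le π hR' j (i + 1)
    have i1 (w) (R) (hR : ∀ h, |M.meanReward (w, h)| ≤ R) :
        Integrable (fun x => M.meanReward (w, (x.2, π.act w' i x.2)))
        (M.partialEpisode π i (w, w')) :=
      integrable_of_abs_le (M.measurable_meanReward.comp (hm1 w)) fun x => hR _
    have i2 (v) : Integrable (fun x => ∫ t, M.valueToGo π w' j (i + 1) t
        ∂(M.transKernel (v, (x.2, π.act w' i x.2)))) (M.partialEpisode π i (w, w')) :=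
      integrable_of_abs_le (hU.stronglyMeasurable.integral_kernel.measurable.comp (hm1 v))
        fun x => abs_integral_le hUB
    have i3 (v) (R) (hR : ∀ h, |M.meanReward (v, h)| ≤ R) :
        Integrable (fun x => M.meanReward (v, (x.2, π.act w' i x.2)))
        (M.partialEpisode π i (w, w')) :=
      integrable_of_abs_le (M.measurable_meanReward.comp (hm1 v)) fun x => hR _
    have e1 : ∫ x, M.valueToGo π w' (j + 1) i x.2 ∂(M.partialEpisode π i (w, w')) =
        ∫ x, M.meanReward (w', (x.2, π.act w' i x.2)) ∂(M.partialEpisode π i (w, w')) +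
        ∫ x, ∫ t, M.valueToGo π w' j (i + 1) t ∂(M.transKernel (w', (x.2, π.act w' i x.2)))
          ∂(M.partialEpisode π i (w, w')) :=
      integral_add (i3 w' R' hR') (i2 w')
    have e2 := M.integral_partialEpisode_succ π w w' i hU hUB
    have e3 : ∑ n ∈ Finset.range (j + 1), M.expReward π w w' (i + n) =
        ∑ n ∈ Finset.range j, M.expReward π w w' (i + 1 + n) +
          ∫ x, M.meanReward (w, (x.2, π.act w' i x.2)) ∂(M.partialEpisode π i (w, w')) := by
      rw [Finset.sum_range_succ', add_zero]
      congr 1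
      exact Finset.sum_congr rfl fun n _ => by rw [add_assoc, add_comm n 1]
    have e4 : ∫ x, M.valueToGo π w' (j + 1) i x.2 ∂(M.partialEpisode π i (w, w')) -
        ∑ n ∈ Finset.range (j + 1), M.expReward π w w' (i + n) =
        (∫ x, M.valueToGo π w' j (i + 1) x.2 ∂(M.partialEpisode π (i + 1) (w, w')) -
          ∑ n ∈ Finset.range j, M.expReward π w w' (i + 1 + n)) +
        (∫ x, (M.meanReward (w', (x.2, π.act w' i x.2)) -
          M.meanReward (w, (x.2, π.act w' i x.2))) ∂(M.partialEpisode π i (w, w')) +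
        ∫ x, (∫ t, M.valueToGo π w' j (i + 1) t ∂(M.transKernel (w', (x.2, π.act w' i x.2))) -
          ∫ t, M.valueToGo π w' j (i + 1) t ∂(M.transKernel (w, (x.2, π.act w' i x.2))))
          ∂(M.partialEpisode π i (w, w'))) := by
      rw [e1, e3, e2, integral_sub (i3 w' R' hR') (i1 w R hR), integral_sub (i2 w') (i2 w)]
      ring
    rw [e4]
    have b1 := enorm_integral_le_lintegral_enorm (μ := M.partialEpisode π i (w, w')) fun x =>
      M.meanReward (w', (x.2, π.act w' i x.2)) - M.meanReward (w, (x.2, π.act w' i x.2))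
    have b2 := enorm_integral_le_lintegral_enorm (μ := M.partialEpisode π i (w, w')) fun x =>
      ∫ t, M.valueToGo π w' j (i + 1) t ∂(M.transKernel (w', (x.2, π.act w' i x.2))) -
          ∫ t, M.valueToGo π w' j (i + 1) t ∂(M.transKernel (w, (x.2, π.act w' i x.2)))
    have b3 (x : Episode S A i × S) :
        ‖∫ t, M.valueToGo π w' j (i + 1) t ∂(M.transKernel (w', (x.2, π.act w' i x.2))) -
          ∫ t, M.valueToGo π w' j (i + 1) t ∂(M.transKernel (w, (x.2, π.act w' i x.2)))‖ₑ ≤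
        ENNReal.ofReal (2 * (H * R') * (M.transDist w w' (x.2, π.act w' i x.2) / M.σf)) := by
      rw [Real.enorm_eq_ofReal_abs]
      refine ENNReal.ofReal_le_ofReal (abs_integral_transKernel_sub_le hσ w w' _ hU fun s =>
        (hUB s).trans ?_)
      have : (0 : ℝ) ≤ R' := (abs_nonneg _).trans (hR' (x.2, π.act w' i x.2))
      gcongr
      omega
    refine (enorm_add_le _ _).trans ?_
    rw [Finset.sum_range_succ']
    have ih' := ih (i + 1) (by omega)
    have hshift (n : ℕ) : i + 1 + n = i + (n + 1) := by ring
    simp only [hshift] at ih' ⊢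
    -- With a single step to go the remaining value is zero and only the reward gap is left.
    rcases j with _ | j
    · simp only [valueToGo, integral_zero, sub_self, enorm_zero, Finset.range_zero,
        Finset.sum_empty, add_zero, zero_add, Nat.sub_self]
      exact b1
    · have b4 := (enorm_add_le _ _).trans (add_le_add b1 (b2.trans (lintegral_mono b3)))
      rw [Nat.add_sub_cancel] at ih' ⊢
      refine (add_le_add ih' b4).trans_eq ?_
      conv_rhs => rhs; rw [Finset.sum_range_succ']
      exact add_add_add_comm _ _ _ _

/-- The value difference is bounded by the differences of rewards and transitions along the
episode. -/
lemma enorm_totalReward_sub_le (hσ : M.σf ≠ 0) {w w' : Weights dφ dφ' dψ} {R R' : ℝ}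
    (hR : ∀ h, |M.meanReward (w, h)| ≤ R) (hR' : ∀ h, |M.meanReward (w', h)| ≤ R') (n : ℕ) :
    ‖M.totalReward π (n + 1) w' w' - M.totalReward π (n + 1) w w'‖ₑ ≤
      ∑ i ∈ Finset.range (n + 1), M.rewGap π w w' i +
      ∑ i ∈ Finset.range n, M.transGap π ((n + 1 : ℕ) * R') w w' i := by
  have h1 := enorm_valueToGo_sub_le π hσ hR hR' (n + 1) (n + 1) 0 le_rfl
  -- Comparing the sampled model with itself makes all gaps vanish, so the recursion does compute
  -- the expected total reward.
  have h2 := enorm_valueToGo_sub_le π hσ hR' hR' (n + 1) (n + 1) 0 le_rfl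
  have h3 : ∀ h, M.transDist w' w' h = 0 := fun h => by simp [transDist]
  simp only [rewGap, transGap, sub_self, enorm_zero, h3, zero_div, mul_zero, ENNReal.ofReal_zero, lintegral_zero,
    Finset.sum_const_zero, add_zero, nonpos_iff_eq_zero, enorm_eq_zero, zero_add] at h2
  rw [sub_eq_zero] at h2
  -- The initial state has the same law in both models, so `partialEpisode π 0` may be read with `w`
  -- in place of `w'`.
  have h4 : M.totalReward π (n + 1) w' w' =
      ∫ x, M.valueToGo π w' (n + 1) 0 x.2 ∂(M.partialEpisode π 0 (w, w')) := h2.symm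
  have h5 : M.totalReward π (n + 1) w w' =
      ∑ i ∈ Finset.range (n + 1), M.expReward π w w' (0 + i) :=
    Finset.sum_congr rfl fun i _ => by rw [zero_add]
  rw [h4, h5]
  simpa only [zero_add, Nat.add_sub_cancel] using h1

variable (M)

/-- Later steps do not change the law of step `i`; thus losses at the separate steps can be
collected on one recorded episode. -/
lemma lintegral_partialEpisode_step (w w' : Weights dφ dφ' dψ) (n : ℕ) (i : Fin n)
    {g : S × A → ℝ≥0∞} (hg : Measurable g) :
    ∫⁻ x, g ((x.1 i).1, (x.1 i).2.1) ∂(M.partialEpisode π n (w, w')) =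
      ∫⁻ x, g (x.2, π.act w' i x.2) ∂(M.partialEpisode π i (w, w')) := by
  induction n with
  | zero => exact i.elim0
  | succ n ih =>
    rw [lintegral_partialEpisode_succ _ _ _ _ (f := fun x => g ((x.1 i).1, (x.1 i).2.1))
      (by fun_prop)]
    refine Fin.lastCases ?_ (fun j => ?_) i
    · refine lintegral_congr fun x => ?_
      simp only [appendStep, Fin.snoc_last]
      rw [lintegral_stepKernel _ _ _ _ _ _ (g := fun q => g (x.2, q.1)) (by fun_prop)]
      simp
    · simp only [appendStep, Fin.snoc_castSucc, lintegral_const, measure_univ, mul_one]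
      exact ih j

lemma lintegral_episodeKernel_step (w w' : Weights dφ dφ' dψ) (n : ℕ) (i : Fin n)
    {g : S × A → ℝ≥0∞} (hg : Measurable g) :
    ∫⁻ e, g ((e i).1, (e i).2.1) ∂(M.episodeKernel π n (w, w')) =
      ∫⁻ x, g (x.2, π.act w' i x.2) ∂(M.partialEpisode π i (w, w')) := by
  rw [episodeKernel, Kernel.map_apply _ measurable_fst, lintegral_map
    (f := fun e : Episode S A n => g ((e i).1, (e i).2.1)) (by fun_prop) measurable_fst]
  exact M.lintegral_partialEpisode_step π w w' n i hg

/-! ### Regret of an episode -/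

/-- Links the values, defined through `MDP.stateKernel`, to the episodes that the algorithm really
runs. -/
lemma bind_stateKernel (w w' : Weights dφ dφ' dψ) (i : ℕ) :
    M.ρ.bind ((M.mdp w).stateKernel (π.policy w') 0 i) =
      (M.partialEpisode π i (w, w')).map Prod.snd := by
  induction i with
  | zero =>
    rw [partialEpisode, Kernel.const_apply, Measure.map_map measurable_snd measurable_prodMk_left,
      MDP.stateKernel, Measure.id_comp]
    exact Measure.map_id.symm
  | succ i ih =>
    rw [map_snd_partialEpisode_succ, ← ih, MDP.stateKernel, Measure.comp_assoc]
    congr 2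
    ext s : 1
    simp only [zero_add]
    rfl

instance (w w' : Weights dφ dφ' dψ) (i n : ℕ) :
    IsMarkovKernel ((M.mdp w).stateKernel (π.policy w') i n) := by
  have : IsMarkovKernel (M.mdp w).trans := by unfold mdp; infer_instance
  induction n with
  | zero => unfold MDP.stateKernel; infer_instance
  | succ n ih => unfold MDP.stateKernel; infer_instance

lemma integral_value {w : Weights dφ dφ' dψ} {R : ℝ} (hR : ∀ h, |M.meanReward (w, h)| ≤ R)
    (w' : Weights dφ dφ' dψ) (H : ℕ) :
    Integrable ((M.mdp w).value H (π.policy w') 0) M.ρ ∧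
      ∫ s, (M.mdp w).value H (π.policy w') 0 s ∂M.ρ = M.totalReward π H w w' := by
  have := M.isProbabilityMeasure_ρ
  have hm (n : ℕ) : Measurable fun s => (M.mdp w).rew (s, (π.policy w').act (0 + n) s) :=
    M.measurable_meanReward.comp (measurable_prodMk_left.comp (measurable_action π w' (0 + n)))
  have hi (n : ℕ) : Integrable (fun s => ∫ s', (M.mdp w).rew (s', (π.policy w').act (0 + n) s')
      ∂((M.mdp w).stateKernel (π.policy w') 0 n s)) M.ρ :=
    integrable_of_abs_le (hm n).stronglyMeasurable.integral_kernel.measurable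
      fun s => abs_integral_le fun x => hR _
  refine ⟨integrable_finsetSum _ fun n _ => hi n, ?_⟩
  simp only [MDP.value]
  rw [integral_finsetSum _ fun n _ => hi n, totalReward, Nat.sub_zero]
  refine Finset.sum_congr rfl fun n _ => ?_
  rw [← integral_bind_of_abs_le _ (hm n) (fun s => hR _), bind_stateKernel,
    integral_map measurable_snd.aemeasurable (hm n).aestronglyMeasurable, expReward]
  simp only [zero_add]
  rfl

lemma episodeRegret_eq {w : Weights dφ dφ' dψ} {R : ℝ} (hR : ∀ h, |M.meanReward (w, h)| ≤ R)
    (w' : Weights dφ dφ' dψ) (H : ℕ) :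
    M.episodeRegret π H w w' = M.totalReward π H w w - M.totalReward π H w w' := by
  obtain ⟨h1, h2⟩ := M.integral_value π hR w H
  obtain ⟨h3, h4⟩ := M.integral_value π hR w' H
  rw [episodeRegret, integral_sub h1 h3, h2, h4]

lemma abs_totalReward_le {w : Weights dφ dφ' dψ} {R : ℝ} (hR : ∀ h, |M.meanReward (w, h)| ≤ R)
    (w' : Weights dφ dφ' dψ) (H : ℕ) : |M.totalReward π H w w'| ≤ H * R := by
  refine (Finset.abs_sum_le_sum_abs _ _).trans
    ((Finset.sum_le_card_nsmul _ _ R fun i _ => abs_integral_le fun x => hR _).trans_eq ?_)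
  simp

lemma measurable_totalReward (H : ℕ) :
    Measurable fun p : Weights dφ dφ' dψ × Weights dφ dφ' dψ => M.totalReward π H p.1 p.2 := by
  refine Finset.measurable_sum _ fun i _ => ?_
  have h1 : Measurable fun q : (Weights dφ dφ' dψ × Weights dφ dφ' dψ) × (Episode S A i × S) =>
      M.meanReward (q.1.1, (q.2.2, π.act q.1.2 i q.2.2)) :=
    M.measurable_meanReward.comp ((measurable_fst.comp measurable_fst).prodMk
      ((measurable_snd.comp measurable_snd).prodMk ((π.measurable_act i).comp
        ((measurable_snd.comp measurable_fst).prodMk (measurable_snd.comp measurable_snd)))))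
  exact (StronglyMeasurable.integral_kernel_prod_right' (κ := M.partialEpisode π i)
    h1.stronglyMeasurable).measurable

end FeatureModel

end PSRL

end

noncomputable section

namespace PSRL

/-! ### Expected loss of an episode -/

/-- Inequality of means, with `R²` kept next to `G` so that both can be integrated under the
posterior while `D` goes to the elliptic potential. For `G = ∞` the right side is infinite unless `R
= 0`. -/
lemma mul_ofReal_le_of_sq_le {R G : ℝ≥0∞} (hR : R ≠ ∞) {x D η : ℝ} (hη : 0 < η) (hD : 0 ≤ D)
    (h : G ≠ ∞ → x ^ 2 ≤ 2 * G.toReal * D) :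
    R * ENNReal.ofReal x ≤
      ENNReal.ofReal η * (R ^ 2 * G) + ENNReal.ofReal (1 / (2 * η)) * ENNReal.ofReal D := by
  rcases eq_or_ne R 0 with rfl | hR0
  · simp
  rcases eq_or_ne G ∞ with rfl | hG
  · rw [ENNReal.mul_top (pow_ne_zero 2 hR0), ENNReal.mul_top (by simpa using hη), top_add]
    exact le_top
  lift R to ℝ≥0 using hR
  lift G to ℝ≥0 using hG
  have hx := h ENNReal.coe_ne_top
  rw [ENNReal.coe_toReal] at hx
  have e1 : (R : ℝ≥0∞) = ENNReal.ofReal (R : ℝ) := (ENNReal.ofReal_coe_nnreal).symm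
  have e2 : (G : ℝ≥0∞) = ENNReal.ofReal (G : ℝ) := (ENNReal.ofReal_coe_nnreal).symm
  have hR' : (0 : ℝ) ≤ R := R.2
  have hG' : (0 : ℝ) ≤ G := G.2
  rw [e1, e2, ← ENNReal.ofReal_pow hR', ← ENNReal.ofReal_mul hR',
    ← ENNReal.ofReal_mul (by positivity), ← ENNReal.ofReal_mul hη.le,
    ← ENNReal.ofReal_mul (by positivity), ← ENNReal.ofReal_add (by positivity) (by positivity)]
  refine ENNReal.ofReal_le_ofReal (abs_le_of_sq_le_sq' ?_ (by positivity)).2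
  have h1 : η * ((R : ℝ) ^ 2 * G) * (1 / (2 * η) * D) * 4 = R ^ 2 * (2 * G * D) := by
    field_simp
    ring
  have h2 : ((R : ℝ) * x) ^ 2 ≤ R ^ 2 * (2 * G * D) := by
    rw [mul_pow]
    exact mul_le_mul_of_nonneg_left hx (sq_nonneg _)
  nlinarith [sq_nonneg (η * ((R : ℝ) ^ 2 * G) - 1 / (2 * η) * D)]

variable {S A : Type} [MeasurableSpace S] [MeasurableSpace A]

namespace FeatureModel

variable {dφ dφ' dψ : ℕ} (M : FeatureModel S A dφ dφ' dψ) (π : Planner S A dφ dφ' dψ)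

/-- Supremum of the absolute values of the mean rewards. -/
def rewSup (v : EuclideanSpace ℝ (Fin dφ')) : ℝ≥0∞ := ⨆ h, ‖(inner ℝ v (M.φr h) : ℝ)‖ₑ

/-- The supremum is over an uncountable set, but a supremum of continuous functions is lower
semicontinuous. -/
lemma measurable_rewSup : Measurable M.rewSup :=
  (lowerSemicontinuous_iSup fun h => (by fun_prop : Continuous fun v : EuclideanSpace ℝ (Fin dφ') =>
    ‖(inner ℝ v (M.φr h) : ℝ)‖ₑ).lowerSemicontinuous).measurable

lemma abs_meanReward_le {w : Weights dφ dφ' dψ} (hw : M.rewSup w.1 ≠ ∞) (h : S × A) :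
    |M.meanReward (w, h)| ≤ (M.rewSup w.1).toReal := by
  have h1 : ‖M.meanReward (w, h)‖ₑ ≤ M.rewSup w.1 :=
    le_iSup (fun h => ‖(inner ℝ w.1 (M.φr h) : ℝ)‖ₑ) h
  have := ENNReal.toReal_mono hw h1
  simpa using this

/-- Loss in an episode from the difference of two models. -/
def loss {n : ℕ} (w w' : Weights dφ dφ' dψ) (e : Episode S A (n + 1)) : ℝ≥0∞ :=
  ∑ i, ‖M.meanReward (w', ((e i).1, (e i).2.1)) - M.meanReward (w, ((e i).1, (e i).2.1))‖ₑ +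
  ENNReal.ofReal (2 * (n + 1 : ℕ) / M.σf) * ∑ i : Fin n, M.rewSup w'.1 *
    ENNReal.ofReal (M.transDist w w' ((e i.castSucc).1, (e i.castSucc).2.1))

lemma measurable_transDist {X : Type*} [MeasurableSpace X] {w w' : X → Weights dφ dφ' dψ}
    {h : X → S × A} (hw : Measurable w) (hw' : Measurable w') (hh : Measurable h) :
    Measurable fun x => M.transDist (w x) (w' x) (h x) := by
  have h1 : Measurable fun x => M.meanEmbedding (w x, h x) :=
    M.measurable_meanEmbedding.comp (hw.prodMk hh)
  have h2 : Measurable fun x => M.meanEmbedding (w' x, h x) :=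
    M.measurable_meanEmbedding.comp (hw'.prodMk hh)
  unfold transDist
  fun_prop

lemma measurable_meanReward' {X : Type*} [MeasurableSpace X] {w : X → Weights dφ dφ' dψ}
    {h : X → S × A} (hw : Measurable w) (hh : Measurable h) :
    Measurable fun x => M.meanReward (w x, h x) :=
  M.measurable_meanReward.comp (hw.prodMk hh)

lemma measurable_loss {X : Type*} [MeasurableSpace X] {n : ℕ} {w w' : X → Weights dφ dφ' dψ}
    {e : X → Episode S A (n + 1)} (hw : Measurable w) (hw' : Measurable w') (he : Measurable e) :
    Measurable fun x => M.loss (w x) (w' x) (e x) := by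
  have h1 (i) : Measurable fun x => ((e x i).1, (e x i).2.1) := by fun_prop
  have h2 : Measurable fun x => M.rewSup (w' x).1 := M.measurable_rewSup.comp hw'.fst
  have h3 (i) := M.measurable_transDist hw hw' (h1 i)
  have h4 (i) := M.measurable_meanReward' hw (h1 i)
  have h5 (i) := M.measurable_meanReward' hw' (h1 i)
  unfold loss
  fun_prop

variable {M}

lemma enorm_totalReward_sub_le_lintegral_loss (hσ : M.σf ≠ 0) {w w' : Weights dφ dφ' dψ}
    (hw : M.rewSup w.1 ≠ ∞) (hw' : M.rewSup w'.1 ≠ ∞) (n : ℕ) :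
    ‖M.totalReward π (n + 1) w' w' - M.totalReward π (n + 1) w w'‖ₑ ≤
      ∫⁻ e, M.loss w w' e ∂(M.episodeKernel π (n + 1) (w, w')) := by
  have h4 (w) : Measurable fun h => M.meanReward (w, h) :=
    M.measurable_meanReward' measurable_const measurable_id
  have h3 : Measurable fun h => M.transDist w w' h :=
    M.measurable_transDist measurable_const measurable_const measurable_id
  have m1 (i : Fin (n + 1)) : Measurable fun e : Episode S A (n + 1) =>
      ‖M.meanReward (w', ((e i).1, (e i).2.1)) - M.meanReward (w, ((e i).1, (e i).2.1))‖ₑ := by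
    have h5 : Measurable fun h => ‖M.meanReward (w', h) - M.meanReward (w, h)‖ₑ :=
      ((h4 w').sub (h4 w)).enorm
    exact h5.comp (f := fun e : Episode S A (n + 1) => ((e i).1, (e i).2.1)) (by fun_prop)
  have m2 (i : Fin n) : Measurable fun e : Episode S A (n + 1) =>
      M.rewSup w'.1 * ENNReal.ofReal (M.transDist w w'
        ((e i.castSucc).1, (e i.castSucc).2.1)) := by
    have h5 : Measurable fun h => M.rewSup w'.1 * ENNReal.ofReal (M.transDist w w' h) := by fun_prop
    exact h5.comp (f := fun e : Episode S A (n + 1) => ((e i.castSucc).1, (e i.castSucc).2.1))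
      (by fun_prop)
  refine (enorm_totalReward_sub_le π hσ (M.abs_meanReward_le hw) (M.abs_meanReward_le hw')
    n).trans_eq ?_
  simp only [loss]
  rw [lintegral_add_left (Finset.measurable_fun_sum _ fun i _ => m1 i),
    lintegral_const_mul _ (Finset.measurable_fun_sum _ fun i _ => m2 i),
    lintegral_finsetSum _ fun i _ => m1 i, lintegral_finsetSum _ fun i _ => m2 i,
    Finset.sum_range, Finset.sum_range, Finset.mul_sum]
  congr 1
  · refine Finset.sum_congr rfl fun i _ => ?_
    exact (M.lintegral_episodeKernel_step π w w' (n + 1) i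
      (g := fun h => ‖M.meanReward (w', h) - M.meanReward (w, h)‖ₑ)
      ((h4 w').sub (h4 w)).enorm).symm
  · refine Finset.sum_congr rfl fun i _ => ?_
    rw [M.lintegral_episodeKernel_step π w w' (n + 1) i.castSucc
      (g := fun h => M.rewSup w'.1 * ENNReal.ofReal (M.transDist w w' h)) (by fun_prop),
      transGap, ← lintegral_const_mul' _ _ ENNReal.ofReal_ne_top]
    refine lintegral_congr fun x => ?_
    have hR : M.rewSup w'.1 = ENNReal.ofReal (M.rewSup w'.1).toReal :=
      (ENNReal.ofReal_toReal hw').symm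
    rw [hR, ← ENNReal.ofReal_mul ENNReal.toReal_nonneg, ← ENNReal.ofReal_mul (by positivity),
      ENNReal.toReal_ofReal ENNReal.toReal_nonneg]
    congr 1
    simp only [Fin.val_castSucc]
    ring

variable (M)

lemma enorm_meanReward_sub_le {n k : ℕ} (y : Fin k → Episode S A (n + 1))
    (w w' : Weights dφ dφ' dψ) (h : S × A) {η : ℝ} (hη : 0 < η) :
    ‖M.meanReward (w', h) - M.meanReward (w, h)‖ₑ ≤
      ENNReal.ofReal η * (M.devr y w' + M.devr y w) + ENNReal.ofReal (1 / (2 * η)) *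
        ENNReal.ofReal (postVar M.covr (M.runPrecr y) (M.φr h).ofLp) := by
  have := mul_ofReal_le_of_sq_le (R := 1) (G := M.devr y w' + M.devr y w)
    (x := |M.meanReward (w', h) - M.meanReward (w, h)|) ENNReal.one_ne_top hη
    (postVar_nonneg M.posSemidef_covr (M.posSemidef_runPrecr y) (M.φr h).ofLp) fun hG => ?_
  · simpa [Real.enorm_eq_ofReal_abs] using this
  · obtain ⟨h1, h2⟩ := ENNReal.add_ne_top.1 hG
    have := sum_sq_sub_dotProduct_le M.posSemidef_covr (M.posSemidef_runPrecr y)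
      (∑ j, M.obsr (y j)) (fun _ : Fin 1 => w.1.ofLp) (fun _ => w'.1.ofLp) h2 h1 (M.φr h).ofLp
    rw [ENNReal.toReal_add h1 h2, sq_abs, meanReward_eq, meanReward_eq, ← sub_dotProduct]
    simpa only [devr, Fin.sum_univ_one] using this

lemma rewSup_mul_transDist_le {n k : ℕ} (y : Fin k → Episode S A (n + 1))
    (w w' : Weights dφ dφ' dψ) (hw' : M.rewSup w'.1 ≠ ∞) (h : S × A) {η : ℝ} (hη : 0 < η) :
    M.rewSup w'.1 * ENNReal.ofReal (M.transDist w w' h) ≤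
      ENNReal.ofReal η * (M.rewSup w'.1 ^ 2 * (M.devf y w' + M.devf y w)) +
        ENNReal.ofReal (1 / (2 * η)) *
          ENNReal.ofReal (postVar M.covf (M.runPrecf y) (M.φf h).ofLp) := by
  refine mul_ofReal_le_of_sq_le hw' hη
    (postVar_nonneg M.posSemidef_covf (M.posSemidef_runPrecf y) (M.φf h).ofLp) fun hG => ?_
  obtain ⟨h1, h2⟩ := ENNReal.add_ne_top.1 hG
  have := sum_sq_sub_dotProduct_le M.posSemidef_covf (M.posSemidef_runPrecf y)
    (∑ j, M.obsf (y j)) (fun j => (w.2 j).ofLp) (fun j => (w'.2 j).ofLp) h2 h1 (M.φf h).ofLp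
  rw [ENNReal.toReal_add h1 h2, transDist, Real.sq_sqrt (Finset.sum_nonneg fun j _ => sq_nonneg _)]
  simpa only [devf, meanEmbedding_eq, ← sub_dotProduct] using this

/-- Sum of the posterior variances of the rewards in an episode. -/
def sumVarr {n k : ℕ} (y : Fin k → Episode S A (n + 1)) (e : Episode S A (n + 1)) : ℝ :=
  ∑ i, postVar M.covr (M.runPrecr y) (M.featr e i)

/-- Sum of the posterior variances of the transitions in an episode. -/
def sumVarf {n k : ℕ} (y : Fin k → Episode S A (n + 1)) (e : Episode S A (n + 1)) : ℝ :=
  ∑ i : Fin n, postVar M.covf (M.runPrecf y) (M.featf e i.castSucc)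

lemma loss_le {n k : ℕ} (y : Fin k → Episode S A (n + 1)) (w w' : Weights dφ dφ' dψ)
    (hw' : M.rewSup w'.1 ≠ ∞) (e : Episode S A (n + 1)) {η : ℝ} (hη : 0 < η) :
    M.loss w w' e ≤
      ((n + 1 : ℕ) * (ENNReal.ofReal η * (M.devr y w' + M.devr y w)) +
        ENNReal.ofReal (1 / (2 * η)) * ENNReal.ofReal (M.sumVarr y e)) +
      ENNReal.ofReal (2 * (n + 1 : ℕ) / M.σf) *
        ((n + 1 : ℕ) * (ENNReal.ofReal η * (M.rewSup w'.1 ^ 2 * (M.devf y w' + M.devf y w))) +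
          ENNReal.ofReal (1 / (2 * η)) * ENNReal.ofReal (M.sumVarf y e)) := by
  refine add_le_add ?_ (mul_le_mul_right ?_ _)
  · refine (Finset.sum_le_sum fun i _ => M.enorm_meanReward_sub_le y w w' _ hη).trans_eq ?_
    rw [Finset.sum_add_distrib, Finset.sum_const, Finset.card_univ, Fintype.card_fin, nsmul_eq_mul,
      sumVarr, ENNReal.ofReal_sum_of_nonneg fun i _ => postVar_nonneg M.posSemidef_covr
        (M.posSemidef_runPrecr y) _, Finset.mul_sum]
    rfl
  · refine (Finset.sum_le_sum fun i _ => M.rewSup_mul_transDist_le y w w' hw' _ hη).trans ?_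
    rw [Finset.sum_add_distrib, Finset.sum_const, Finset.card_univ, Fintype.card_fin, nsmul_eq_mul,
      sumVarf, ENNReal.ofReal_sum_of_nonneg fun i _ => postVar_nonneg M.posSemidef_covf
        (M.posSemidef_runPrecf y) _, Finset.mul_sum]
    refine add_le_add ?_ le_rfl
    gcongr
    omega

end FeatureModel

end PSRL

end

noncomputable section

namespace PSRL

/-! ### Sum of the posterior variances -/

lemma measurable_logDet {X : Type*} [MeasurableSpace X] {d : ℕ} (Sg : Matrix (Fin d) (Fin d) ℝ)
    {B : X → Matrix (Fin d) (Fin d) ℝ} (hB : ∀ i j, Measurable fun x => B x i j) :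
    Measurable fun x => logDet Sg (B x) := by
  simp only [logDet, Matrix.det_apply, Matrix.add_apply, Matrix.mul_apply]
  fun_prop

variable {S A : Type} [MeasurableSpace S] [MeasurableSpace A]

namespace FeatureModel

variable {dφ dφ' dψ : ℕ} (M : FeatureModel S A dφ dφ' dψ) (π : Planner S A dφ dφ' dψ)

/-- The elliptic potential bound, summed over the episodes of a run. -/
lemma sum_lintegral_postVar_le {H N d : ℕ} {Sg : Matrix (Fin d) (Fin d) ℝ} (hSg : Sg.PosSemidef)
    {s κ : ℝ} (hs : 0 ≤ s) (hκ : 0 ≤ κ) (ft : Episode S A H → Fin N → Fin d → ℝ)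
    (hft : ∀ i, Measurable fun e => ft e i) (hφ : ∀ e i, ft e i ⬝ᵥ Sg.mulVec (ft e i) ≤ κ)
    (P : Episode S A H → Matrix (Fin d) (Fin d) ℝ)
    (hP : ∀ e, P e = s • ∑ i, Matrix.vecMulVec (ft e i) (ft e i)) (K : ℕ) :
    ∑ k ∈ Finset.range K, ∫⁻ p, ENNReal.ofReal (s * ∑ i, postVar Sg
        (∑ j, P (data (Fin.init p.2 : Run S A dφ dφ' dψ H k) j)) (ft (p.2 (Fin.last k)).2 i))
        ∂(M.runLaw π H (k + 1)) ≤
      ENNReal.ofReal ((1 + N * κ * s) * (d * Real.log (1 + K * (N * κ * s)))) := by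
  have hpsd (e) : (P e).PosSemidef := by rw [hP]; exact posSemidef_outer_sum hs _
  have hpsd' {k : ℕ} (y : Fin k → Episode S A H) : (∑ j, P (y j)).PosSemidef :=
    Matrix.posSemidef_sum _ fun j _ => hpsd (y j)
  have hPm (i j) : Measurable fun e => P e i j := by
    simp only [hP, Matrix.smul_apply, Matrix.sum_apply, Matrix.vecMulVec_apply]
    fun_prop
  have hNκ : 0 ≤ N * κ * s := by positivity
  have hpot (k : ℕ) : Measurable fun p : Weights dφ dφ' dψ × Run S A dφ dφ' dψ H k =>
      ENNReal.ofReal ((1 + N * κ * s) * logDet Sg (∑ j, P (data p.2 j))) := by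
    refine ((measurable_logDet Sg fun i j => ?_).const_mul _).ennreal_ofReal
    simp only [Matrix.sum_apply]
    exact Finset.measurable_fun_sum _ fun l _ =>
      (hPm i j).comp (measurable_snd.comp ((measurable_pi_apply l).comp measurable_snd))
  -- The increments of the log-determinant telescope. Potentials at different times live on runs of
  -- different lengths, and `lintegral_runLaw_init` lifts each to the next run law.
  have key : ∑ k ∈ Finset.range K, ∫⁻ p, ENNReal.ofReal (s * ∑ i, postVar Sg
        (∑ j, P (data (Fin.init p.2 : Run S A dφ dφ' dψ H k) j)) (ft (p.2 (Fin.last k)).2 i))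
        ∂(M.runLaw π H (k + 1)) ≤
      ∫⁻ p, ENNReal.ofReal ((1 + N * κ * s) * logDet Sg (∑ j, P (data p.2 j)))
        ∂(M.runLaw π H K) := by
    induction K with
    | zero => simp
    | succ k ih =>
      rw [Finset.sum_range_succ]
      refine (add_le_add ih le_rfl).trans ?_
      have hm := (hpot k).comp (f := fun p : Weights dφ dφ' dψ × Run S A dφ dφ' dψ H (k + 1) =>
        (p.1, (Fin.init p.2 : Run S A dφ dφ' dψ H k)))
        (measurable_fst.prodMk ((measurable_init k).comp measurable_snd))
      rw [← M.lintegral_runLaw_init π H k (hpot k)]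
      refine (lintegral_add_left hm _).ge.trans (lintegral_mono fun p => ?_)
      have h1 := elliptic_potential hSg
        (hpsd' (data (Fin.init p.2 : Run S A dφ dφ' dψ H k))) hs
        (ft (p.2 (Fin.last k)).2) (hφ _)
      have h2 : ∑ j, P (data (Fin.init p.2 : Run S A dφ dφ' dψ H k) j) +
          s • ∑ i, Matrix.vecMulVec (ft (p.2 (Fin.last k)).2 i) (ft (p.2 (Fin.last k)).2 i) =
          ∑ j, P (data p.2 j) := by
        rw [← hP, Fin.sum_univ_castSucc]
        rfl
      have h3 : 0 ≤ s * ∑ i, postVar Sg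
        (∑ j, P (data (Fin.init p.2 : Run S A dφ dφ' dψ H k) j)) (ft (p.2 (Fin.last k)).2 i) :=
        mul_nonneg hs (Finset.sum_nonneg fun i _ => postVar_nonneg hSg (hpsd' _) _)
      have h0 : 0 ≤ logDet Sg (∑ j, P (data (Fin.init p.2 : Run S A dφ dφ' dψ H k) j)) := by
        obtain ⟨T, -, -, hT, hdet, -⟩ := exists_whitening hSg
          (hpsd' (data (Fin.init p.2 : Run S A dφ dφ' dψ H k)))
        rw [logDet, hdet]
        exact Real.log_nonneg ((le_add_of_nonneg_right hT.trace_nonneg).trans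
          (one_add_trace_le_det hT))
      rw [h2] at h1
      simp only [Function.comp_apply]
      rw [← ENNReal.ofReal_add (by positivity) h3]
      refine ENNReal.ofReal_le_ofReal ?_
      linarith
  refine key.trans ?_
  calc _ ≤ ∫⁻ p, ENNReal.ofReal ((1 + N * κ * s) * (d * Real.log (1 + K * (N * κ * s))))
        ∂(M.runLaw π H K) := by
        refine lintegral_mono fun p => ENNReal.ofReal_le_ofReal
          (mul_le_mul_of_nonneg_left ((logDet_le hSg (hpsd' _)).trans ?_) (by positivity))
        have htr : ((∑ j, P (data p.2 j)) * Sg).trace ≤ K * (N * κ * s) := by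
          rw [Finset.sum_mul, Matrix.trace_sum]
          refine (Finset.sum_le_card_nsmul _ _ (N * κ * s) fun j _ => ?_).trans_eq (by simp)
          rw [hP, smul_mul_assoc, Matrix.trace_smul, Finset.sum_mul, Matrix.trace_sum, smul_eq_mul,
            mul_comm]
          refine mul_le_mul_of_nonneg_right ?_ hs
          refine (Finset.sum_le_card_nsmul _ _ κ fun i _ => ?_).trans_eq (by simp)
          rw [Matrix.vecMulVec_mul, Matrix.trace_vecMulVec, dotProduct_comm,
            ← Matrix.dotProduct_mulVec]
          exact hφ _ _
        have hnn : 0 ≤ ((∑ j, P (data p.2 j)) * Sg).trace := by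
          obtain ⟨T, -, h2, hT, -⟩ := exists_whitening hSg (hpsd' (data p.2))
          rw [← h2, ← Matrix.mul_assoc, Matrix.trace_mul_comm, ← Matrix.mul_assoc]
          exact hT.trace_nonneg
        gcongr
    _ = _ := by simp

end FeatureModel

end PSRL

end

/-! ### Prior moments of the rewards and expected deviations -/

noncomputable section

namespace PSRL

variable {S A : Type} [MeasurableSpace S] [MeasurableSpace A]

namespace FeatureModel

variable {dφ dφ' dψ : ℕ} {M : FeatureModel S A dφ dφ' dψ} (π : Planner S A dφ dφ' dψ)

/-- A bound on the second moment of the mean rewards bounds the prior variances of the rewards. -/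
lemma dotProduct_covr_le {E : ℝ} (hE : ∫⁻ w, M.rewSup w.1 ^ 2 ∂M.prior ≤ ENNReal.ofReal E)
    (hE0 : 0 ≤ E) (h : S × A) :
    (M.φr h).ofLp ⬝ᵥ M.covr.mulVec (M.φr h).ofLp ≤ E := by
  -- The quadratic form is the prior variance of the mean reward at `h`; as the prior is centred,
  -- this is a second moment and lies below that of the supremum.
  rw [← covarianceBilin_multivariateGaussian (μ := 0) M.posSemidef_covr (M.φr h) (M.φr h),
    covarianceBilin_apply IsGaussian.memLp_two_id]
  rw [← ENNReal.ofReal_le_ofReal_iff hE0]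
  have hmap : M.prior.map Prod.fst = multivariateGaussian 0 M.covr := by
    rw [prior, Measure.map_fst_prod]; simp
  calc _ ≤ ‖∫ z, inner ℝ (M.φr h) (z - (multivariateGaussian 0 M.covr)[id]) *
          inner ℝ (M.φr h) (z - (multivariateGaussian 0 M.covr)[id])
          ∂(multivariateGaussian 0 M.covr)‖ₑ := Real.ofReal_le_enorm _
    _ ≤ _ := enorm_integral_le_lintegral_enorm _
    _ ≤ ∫⁻ z, M.rewSup z ^ 2 ∂(multivariateGaussian 0 M.covr) := by
      refine lintegral_mono fun z => ?_
      rw [integral_id_multivariateGaussian', sub_zero, enorm_mul, ← sq, real_inner_comm]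
      exact pow_le_pow_left' (le_iSup (fun h => ‖(inner ℝ z (M.φr h) : ℝ)‖ₑ) h) 2
    _ ≤ _ := by
      rw [← hmap, lintegral_map (M.measurable_rewSup.pow_const 2) measurable_fst]
      exact hE

lemma lintegral_prior_eq (H k : ℕ) {f : Weights dφ dφ' dψ → ℝ≥0∞} (hf : Measurable f) :
    ∫⁻ p, f p.1 ∂(M.runLaw π H k) = ∫⁻ w, f w ∂M.prior := by
  rw [← M.map_fst_runLaw π H k, lintegral_map hf measurable_fst]

lemma ae_rewSup_ne_top {E : ℝ} (hE : ∫⁻ w, M.rewSup w.1 ^ 2 ∂M.prior ≤ ENNReal.ofReal E) :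
    ∀ᵐ w ∂M.prior, M.rewSup w.1 ≠ ∞ := by
  have h1 : Measurable fun w : Weights dφ dφ' dψ => M.rewSup w.1 ^ 2 :=
    (M.measurable_rewSup.comp measurable_fst).pow_const 2
  filter_upwards [ae_lt_top h1 (hE.trans_lt ENNReal.ofReal_lt_top).ne] with w hw h
  simp [h] at hw

lemma ae_fst_rewSup_ne_top {E : ℝ} (hE : ∫⁻ w, M.rewSup w.1 ^ 2 ∂M.prior ≤ ENNReal.ofReal E)
    (H k : ℕ) : ∀ᵐ p ∂(M.runLaw π H k), M.rewSup p.1.1 ≠ ∞ :=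
  ae_of_ae_map measurable_fst.aemeasurable
    (by rw [M.map_fst_runLaw π H k]; exact ae_rewSup_ne_top hE)

lemma ae_last_rewSup_ne_top {E : ℝ} (hE : ∫⁻ w, M.rewSup w.1 ^ 2 ∂M.prior ≤ ENNReal.ofReal E)
    (H k : ℕ) : ∀ᵐ p ∂(M.runLaw π H (k + 1)), M.rewSup (p.2 (Fin.last k)).1.1 ≠ ∞ :=
  ae_of_ae_map (f := fun p : Weights dφ dφ' dψ × Run S A dφ dφ' dψ H (k + 1) =>
      (p.2 (Fin.last k)).1) (Measurable.aemeasurable (by fun_prop))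
    (by rw [M.map_last_runLaw π H k]; exact ae_rewSup_ne_top hE)

lemma measurable_data_init (H k : ℕ) :
    Measurable fun p : Weights dφ dφ' dψ × Run S A dφ dφ' dψ H (k + 1) =>
      data (Fin.init p.2 : Run S A dφ dφ' dψ H k) :=
  measurable_data.comp ((measurable_init k).comp measurable_snd)

lemma lintegral_devr_add_le (hr : M.σr ≠ 0) (hf : M.σf ≠ 0) (n k : ℕ) :
    ∫⁻ p, (M.devr (data (Fin.init p.2)) (p.2 (Fin.last k)).1 + M.devr (data (Fin.init p.2)) p.1)
        ∂(M.runLaw π (n + 1) (k + 1)) ≤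
      ENNReal.ofReal (32 * (2 + dφ' + Real.log expSqMoment)) := by
  have hl : 0 ≤ Real.log expSqMoment := Real.log_nonneg one_le_expSqMoment
  have m1 : Measurable fun p : Weights dφ dφ' dψ × Run S A dφ dφ' dψ (n + 1) (k + 1) =>
      M.devr (data (Fin.init p.2)) (p.2 (Fin.last k)).1 :=
    M.measurable_devr (measurable_data_init (n + 1) k) (by fun_prop)
  have m2 : Measurable fun p : Weights dφ dφ' dψ × Run S A dφ dφ' dψ (n + 1) k =>
      M.devr (data p.2) p.1 :=
    M.measurable_devr (measurable_data.comp measurable_snd) measurable_fst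
  have m3 : Measurable fun q : Weights dφ dφ' dψ × (Fin k → Episode S A (n + 1)) =>
      M.devr q.2 q.1 := M.measurable_devr measurable_snd measurable_fst
  have h1 := M.lintegral_runLaw_last π (n + 1) k m3
  have h2 := M.lintegral_runLaw_init π (n + 1) k m2
  have h3 := lintegral_mul_devr_le π hr hf n k
  rw [lintegral_add_left m1]
  refine (add_le_add (h1.trans_le h3) (h2.trans_le h3)).trans_eq ?_
  rw [← ENNReal.ofReal_add (by positivity) (by positivity)]
  congr 1
  ring

lemma lintegral_sq_mul_devf_add_le (hr : M.σr ≠ 0) (hf : M.σf ≠ 0) {E : ℝ}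
    (hE : ∫⁻ w, M.rewSup w.1 ^ 2 ∂M.prior ≤ ENNReal.ofReal E) (n k : ℕ) :
    ∫⁻ p, M.rewSup (p.2 (Fin.last k)).1.1 ^ 2 * (M.devf (data (Fin.init p.2)) (p.2 (Fin.last k)).1 +
        M.devf (data (Fin.init p.2)) p.1) ∂(M.runLaw π (n + 1) (k + 1)) ≤
      ENNReal.ofReal (32 * (2 + dφ + dψ * Real.log expSqMoment) * E) := by
  have hl : 0 ≤ Real.log expSqMoment := Real.log_nonneg one_le_expSqMoment
  have mi := measurable_data_init (S := S) (A := A) (dφ := dφ) (dφ' := dφ') (dψ := dψ) (n + 1) k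
  have mR := M.measurable_rewSup
  have m1 : Measurable fun p : Weights dφ dφ' dψ × Run S A dφ dφ' dψ (n + 1) (k + 1) =>
      M.rewSup (p.2 (Fin.last k)).1.1 ^ 2 *
        M.devf (data (Fin.init p.2)) (p.2 (Fin.last k)).1 :=
    ((mR.comp (by fun_prop)).pow_const 2).mul (M.measurable_devf mi (by fun_prop))
  have m2 : Measurable fun p : Weights dφ dφ' dψ × Run S A dφ dφ' dψ (n + 1) (k + 1) =>
      M.rewSup (p.2 (Fin.last k)).1.1 ^ 2 * M.devf (data (Fin.init p.2)) p.1 :=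
    ((mR.comp (by fun_prop)).pow_const 2).mul (M.measurable_devf mi measurable_fst)
  have m3 : Measurable fun q : Weights dφ dφ' dψ × (Fin k → Episode S A (n + 1)) =>
      M.rewSup q.1.1 ^ 2 * M.devf q.2 q.1 :=
    ((mR.comp (by fun_prop)).pow_const 2).mul (M.measurable_devf measurable_snd measurable_fst)
  have mw : Measurable fun w : Weights dφ dφ' dψ => M.rewSup w.1 ^ 2 :=
    (mR.comp (by fun_prop)).pow_const 2
  have mG : Measurable fun y : Fin k → Episode S A (n + 1) =>
      ∫⁻ w', M.rewSup w'.1 ^ 2 ∂(M.posteriorOf (M.runKernel π (n + 1) k) y) :=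
    mw.lintegral_kernel
  -- Deviation of the sampled weights: they are exchanged for the true ones, and the reward factor
  -- is then a function of the reward weights alone.
  have h1 : ∫⁻ p, M.rewSup (p.2 (Fin.last k)).1.1 ^ 2 *
        M.devf (data (Fin.init p.2)) (p.2 (Fin.last k)).1 ∂(M.runLaw π (n + 1) (k + 1)) ≤
      ENNReal.ofReal (16 * (2 + dφ + dψ * Real.log expSqMoment)) * ENNReal.ofReal E := by
    refine (M.lintegral_runLaw_last π (n + 1) k m3).trans_le ?_
    refine (lintegral_mul_devf_le π hr hf n k (F := fun q => M.rewSup q.1 ^ 2)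
      ((mR.comp measurable_fst).pow_const 2)).trans ?_
    refine mul_le_mul_right ((lintegral_prior_eq π (n + 1) k mw).trans_le hE) _
  -- Deviation of the true weights: given the data they are independent of the sampled ones, so the
  -- reward factor may first be averaged over the posterior, which leaves a function of the data.
  have h2 : ∫⁻ p, M.rewSup (p.2 (Fin.last k)).1.1 ^ 2 *
        M.devf (data (Fin.init p.2)) p.1 ∂(M.runLaw π (n + 1) (k + 1)) ≤
      ENNReal.ofReal (16 * (2 + dφ + dψ * Real.log expSqMoment)) * ENNReal.ofReal E := by
    rw [lintegral_runLaw_succ _ _ _ _ m2]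
    have e : ∀ p : Weights dφ dφ' dψ × Run S A dφ dφ' dψ (n + 1) k,
        ∫⁻ w', ∫⁻ e, M.rewSup ((Fin.snoc p.2 (w', e) : Run S A dφ dφ' dψ (n + 1) (k + 1))
            (Fin.last k)).1.1 ^ 2 *
          M.devf (data (Fin.init (Fin.snoc p.2 (w', e) : Run S A dφ dφ' dψ (n + 1) (k + 1)))) p.1
          ∂(M.episodeKernel π (n + 1) (p.1, w'))
          ∂(M.posteriorOf (M.runKernel π (n + 1) k) (data p.2)) =
        (∫⁻ w', M.rewSup w'.1 ^ 2 ∂(M.posteriorOf (M.runKernel π (n + 1) k) (data p.2))) *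
          M.devf (data p.2) p.1 := by
      intro p
      rw [← lintegral_mul_const _ mw]
      simp
    refine (lintegral_congr e).trans_le ?_
    refine (lintegral_mul_devf_le π hr hf n k (F := fun q => ∫⁻ w', M.rewSup w'.1 ^ 2
      ∂(M.posteriorOf (M.runKernel π (n + 1) k) (data q.2)))
      (mG.comp (measurable_data.comp measurable_snd))).trans ?_
    refine mul_le_mul_right ?_ _
    refine (M.lintegral_posterior π (n + 1) k (G := fun q => M.rewSup q.1.1 ^ 2)
      (mw.comp measurable_fst)).trans_le ?_
    exact (lintegral_prior_eq π (n + 1) k mw).trans_le hE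
  simp only [mul_add]
  rw [lintegral_add_left m1]
  refine (add_le_add h1 h2).trans_eq ?_
  rw [← two_mul, ← ENNReal.ofReal_mul (by positivity), ← ENNReal.ofReal_ofNat,
    ← ENNReal.ofReal_mul (by positivity)]
  congr 1
  ring

end FeatureModel

end PSRL

end

/-! ### Measurability of the posterior variances and total expected loss -/

noncomputable section

namespace PSRL

section

variable {X : Type*} [MeasurableSpace X] {d : ℕ}

lemma measurable_det {C : X → Matrix (Fin d) (Fin d) ℝ}
    (hC : ∀ i j, Measurable fun x => C x i j) : Measurable fun x => (C x).det := by
  simp only [Matrix.det_apply]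
  fun_prop

lemma measurable_inv_apply {C : X → Matrix (Fin d) (Fin d) ℝ}
    (hC : ∀ i j, Measurable fun x => C x i j) (i j : Fin d) :
    Measurable fun x => (C x)⁻¹ i j := by
  simp only [Matrix.inv_def, Matrix.smul_apply, Ring.inverse_eq_inv', Matrix.adjugate_apply]
  refine (measurable_det hC).inv.smul (measurable_det fun a b => ?_)
  simp only [Matrix.updateRow_apply]
  split_ifs
  · exact measurable_const
  · exact hC a b

lemma measurable_postVar (Sg : Matrix (Fin d) (Fin d) ℝ) {B : X → Matrix (Fin d) (Fin d) ℝ}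
    {φ : X → Fin d → ℝ} (hB : ∀ i j, Measurable fun x => B x i j) (hφ : Measurable φ) :
    Measurable fun x => postVar Sg (B x) (φ x) := by
  have h1 (i j : Fin d) : Measurable fun x => (1 + B x * Sg : Matrix (Fin d) (Fin d) ℝ) i j := by
    simp only [Matrix.add_apply, Matrix.mul_apply]
    exact measurable_const.add (Finset.measurable_fun_sum _ fun l _ => (hB i l).mul_const _)
  have hφ' (i : Fin d) : Measurable fun x => φ x i := (measurable_pi_apply i).comp hφ
  simp only [postVar, dotProduct, Matrix.mulVec]
  exact Finset.measurable_fun_sum _ fun i _ => (hφ' i).mul (Finset.measurable_fun_sum _ fun j _ =>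
    (Finset.measurable_fun_sum _ fun l _ =>
      (measurable_inv_apply h1 j l).mul (hφ' l)).const_mul _)

lemma lintegral_mul_add_mul {μ : Measure X} {a b c e : X → ℝ≥0∞} (ha : Measurable a)
    (hb : Measurable b) (hc : Measurable c) (he : Measurable e) (x y z t : ℝ≥0∞) :
    ∫⁻ p, ((t * (x * a p) + y * b p) + z * (t * (x * c p) + y * e p)) ∂μ =
      (t * (x * ∫⁻ p, a p ∂μ) + y * ∫⁻ p, b p ∂μ) +
        z * (t * (x * ∫⁻ p, c p ∂μ) + y * ∫⁻ p, e p ∂μ) := by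
  rw [lintegral_add_left (by fun_prop), lintegral_add_left (by fun_prop),
    lintegral_const_mul _ (by fun_prop), lintegral_const_mul _ ha, lintegral_const_mul _ hb,
    lintegral_const_mul _ (by fun_prop), lintegral_add_left (by fun_prop),
    lintegral_const_mul _ (by fun_prop), lintegral_const_mul _ hc, lintegral_const_mul _ he]

end

variable {S A : Type} [MeasurableSpace S] [MeasurableSpace A]

namespace FeatureModel

variable {dφ dφ' dψ : ℕ} {M : FeatureModel S A dφ dφ' dψ} (π : Planner S A dφ dφ' dψ)

lemma sum_lintegral_sumVarr_le (hr : M.σr ≠ 0) {κ : ℝ} (hκ : 0 ≤ κ)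
    (hφ : ∀ h, (M.φr h).ofLp ⬝ᵥ M.covr.mulVec (M.φr h).ofLp ≤ κ) (n K : ℕ) :
    ∑ k ∈ Finset.range K, ∫⁻ p, ENNReal.ofReal (M.sumVarr
        (data (Fin.init p.2 : Run S A dφ dφ' dψ (n + 1) k)) (p.2 (Fin.last k)).2)
        ∂(M.runLaw π (n + 1) (k + 1)) ≤
      ENNReal.ofReal ((M.σr : ℝ) ^ 2 * ((1 + (n + 1 : ℕ) * κ * ((M.σr : ℝ) ^ 2)⁻¹) *
        (dφ' * Real.log (1 + K * ((n + 1 : ℕ) * κ * ((M.σr : ℝ) ^ 2)⁻¹))))) := by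
  have hσ : (0 : ℝ) < (M.σr : ℝ) ^ 2 := by positivity
  have h := M.sum_lintegral_postVar_le π (H := n + 1) M.posSemidef_covr
    (s := ((M.σr : ℝ) ^ 2)⁻¹) (by positivity) hκ (fun e i => M.featr e i)
    (fun i => M.measurable_featr measurable_id i) (fun e i => hφ _) (fun e => M.precr e)
    (fun e => rfl) K
  rw [ENNReal.ofReal_mul hσ.le]
  refine le_trans ?_ (mul_le_mul_right h _)
  rw [Finset.mul_sum]
  refine Finset.sum_le_sum fun k _ => ?_
  rw [← lintegral_const_mul' _ _ ENNReal.ofReal_ne_top]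
  refine lintegral_mono fun p => ?_
  rw [← ENNReal.ofReal_mul hσ.le, mul_inv_cancel_left₀ hσ.ne']
  rfl

lemma sum_lintegral_sumVarf_le (hf : M.σf ≠ 0) {κ : ℝ} (hκ : 0 ≤ κ)
    (hφ : ∀ h, (M.φf h).ofLp ⬝ᵥ M.covf.mulVec (M.φf h).ofLp ≤ κ) (n K : ℕ) :
    ∑ k ∈ Finset.range K, ∫⁻ p, ENNReal.ofReal (M.sumVarf
        (data (Fin.init p.2 : Run S A dφ dφ' dψ (n + 1) k)) (p.2 (Fin.last k)).2)
        ∂(M.runLaw π (n + 1) (k + 1)) ≤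
      ENNReal.ofReal ((M.σf : ℝ) ^ 2 * ((1 + (n + 1 : ℕ) * κ * ((M.σf : ℝ) ^ 2)⁻¹) *
        (dφ * Real.log (1 + K * ((n + 1 : ℕ) * κ * ((M.σf : ℝ) ^ 2)⁻¹))))) := by
  have hσ : (0 : ℝ) < (M.σf : ℝ) ^ 2 := by positivity
  have h := M.sum_lintegral_postVar_le π (H := n + 1) M.posSemidef_covf
    (s := ((M.σf : ℝ) ^ 2)⁻¹) (by positivity) hκ (fun e (i : Fin n) => M.featf e i.castSucc)
    (fun i => M.measurable_featf measurable_id i.castSucc) (fun e i => hφ _) (fun e => M.precf e)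
    (fun e => rfl) K
  -- Only `n` transitions per episode enter; `n + 1` is used for uniformity with the rewards.
  have hmono : (1 + n * κ * ((M.σf : ℝ) ^ 2)⁻¹) *
        (dφ * Real.log (1 + K * (n * κ * ((M.σf : ℝ) ^ 2)⁻¹))) ≤
      (1 + (n + 1 : ℕ) * κ * ((M.σf : ℝ) ^ 2)⁻¹) *
        (dφ * Real.log (1 + K * ((n + 1 : ℕ) * κ * ((M.σf : ℝ) ^ 2)⁻¹))) := by
    have : (n : ℝ) ≤ (n + 1 : ℕ) := by push_cast; linarith
    have h0 : 0 ≤ Real.log (1 + K * (n * κ * ((M.σf : ℝ) ^ 2)⁻¹)) :=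
      Real.log_nonneg (le_add_of_nonneg_right (by positivity))
    gcongr
  rw [ENNReal.ofReal_mul hσ.le]
  refine le_trans ?_ (mul_le_mul_right (h.trans (ENNReal.ofReal_le_ofReal hmono)) _)
  rw [Finset.mul_sum]
  refine Finset.sum_le_sum fun k _ => ?_
  rw [← lintegral_const_mul' _ _ ENNReal.ofReal_ne_top]
  refine lintegral_mono fun p => ?_
  rw [← ENNReal.ofReal_mul hσ.le, mul_inv_cancel_left₀ hσ.ne']
  rfl

lemma lintegral_loss_le (hr : M.σr ≠ 0) (hf : M.σf ≠ 0) {E : ℝ}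
    (hE : ∫⁻ w, M.rewSup w.1 ^ 2 ∂M.prior ≤ ENNReal.ofReal E) {η : ℝ} (hη : 0 < η) (n k : ℕ) :
    ∫⁻ p, M.loss p.1 (p.2 (Fin.last k)).1 (p.2 (Fin.last k)).2 ∂(M.runLaw π (n + 1) (k + 1)) ≤
      ((n + 1 : ℕ) * (ENNReal.ofReal η *
          ENNReal.ofReal (32 * (2 + dφ' + Real.log expSqMoment))) +
        ENNReal.ofReal (1 / (2 * η)) * ∫⁻ p, ENNReal.ofReal (M.sumVarr
          (data (Fin.init p.2 : Run S A dφ dφ' dψ (n + 1) k)) (p.2 (Fin.last k)).2)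
          ∂(M.runLaw π (n + 1) (k + 1))) +
      ENNReal.ofReal (2 * (n + 1 : ℕ) / M.σf) *
        ((n + 1 : ℕ) * (ENNReal.ofReal η *
            ENNReal.ofReal (32 * (2 + dφ + dψ * Real.log expSqMoment) * E)) +
          ENNReal.ofReal (1 / (2 * η)) * ∫⁻ p, ENNReal.ofReal (M.sumVarf
            (data (Fin.init p.2 : Run S A dφ dφ' dψ (n + 1) k)) (p.2 (Fin.last k)).2)
            ∂(M.runLaw π (n + 1) (k + 1))) := by
  have mi := measurable_data_init (S := S) (A := A) (dφ := dφ) (dφ' := dφ') (dψ := dψ) (n + 1) k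
  have mR := M.measurable_rewSup
  have m1 : Measurable fun p : Weights dφ dφ' dψ × Run S A dφ dφ' dψ (n + 1) (k + 1) =>
      M.devr (data (Fin.init p.2)) (p.2 (Fin.last k)).1 + M.devr (data (Fin.init p.2)) p.1 :=
    (M.measurable_devr mi (by fun_prop)).add (M.measurable_devr mi (by fun_prop))
  have m2 : Measurable fun p : Weights dφ dφ' dψ × Run S A dφ dφ' dψ (n + 1) (k + 1) =>
      M.rewSup (p.2 (Fin.last k)).1.1 ^ 2 * (M.devf (data (Fin.init p.2)) (p.2 (Fin.last k)).1 +
        M.devf (data (Fin.init p.2)) p.1) :=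
    ((mR.comp (by fun_prop)).pow_const 2).mul
      ((M.measurable_devf mi (by fun_prop)).add (M.measurable_devf mi (by fun_prop)))
  refine (lintegral_mono_ae ((ae_last_rewSup_ne_top π hE (n + 1) k).mono fun p hp =>
    M.loss_le (data (Fin.init p.2)) p.1 (p.2 (Fin.last k)).1 hp (p.2 (Fin.last k)).2 hη)).trans ?_
  have m3 : Measurable fun p : Weights dφ dφ' dψ × Run S A dφ dφ' dψ (n + 1) (k + 1) =>
      ENNReal.ofReal (M.sumVarr (data (Fin.init p.2 : Run S A dφ dφ' dψ (n + 1) k))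
        (p.2 (Fin.last k)).2) :=
    (Finset.measurable_fun_sum _ fun i _ => measurable_postVar _ (M.measurable_runPrecr mi)
      (M.measurable_featr (by fun_prop) i)).ennreal_ofReal
  have m4 : Measurable fun p : Weights dφ dφ' dψ × Run S A dφ dφ' dψ (n + 1) (k + 1) =>
      ENNReal.ofReal (M.sumVarf (data (Fin.init p.2 : Run S A dφ dφ' dψ (n + 1) k))
        (p.2 (Fin.last k)).2) :=
    (Finset.measurable_fun_sum _ fun i _ => measurable_postVar _ (M.measurable_runPrecf mi)
      (M.measurable_featf (by fun_prop) i.castSucc)).ennreal_ofReal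
  refine (lintegral_mul_add_mul m1 m3 m2 m4 _ _ _ _).trans_le ?_
  have h1 := lintegral_devr_add_le π hr hf n k
  have h2 := lintegral_sq_mul_devf_add_le π hr hf hE n k
  gcongr

/-- Bound on the expected loss in `K` episodes of length `n + 1`. -/
def lossBound (M : FeatureModel S A dφ dφ' dψ) (κ E η : ℝ) (n K : ℕ) : ℝ :=
  (K * ((n + 1 : ℕ) * (η * (32 * (2 + dφ' + Real.log expSqMoment)))) +
    1 / (2 * η) * ((M.σr : ℝ) ^ 2 * ((1 + (n + 1 : ℕ) * E * ((M.σr : ℝ) ^ 2)⁻¹) *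
        (dφ' * Real.log (1 + K * ((n + 1 : ℕ) * E * ((M.σr : ℝ) ^ 2)⁻¹)))))) +
  2 * (n + 1 : ℕ) / M.σf *
    (K * ((n + 1 : ℕ) * (η * (32 * (2 + dφ + dψ * Real.log expSqMoment) * E))) +
      1 / (2 * η) * ((M.σf : ℝ) ^ 2 * ((1 + (n + 1 : ℕ) * κ * ((M.σf : ℝ) ^ 2)⁻¹) *
        (dφ * Real.log (1 + K * ((n + 1 : ℕ) * κ * ((M.σf : ℝ) ^ 2)⁻¹))))))

lemma sum_lintegral_loss_le (hr : M.σr ≠ 0) (hf : M.σf ≠ 0) {κ E : ℝ} (hκ0 : 0 ≤ κ) (hE0 : 0 ≤ E)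
    (hκ : ∀ h, (M.φf h).ofLp ⬝ᵥ M.covf.mulVec (M.φf h).ofLp ≤ κ)
    (hE : ∫⁻ w, M.rewSup w.1 ^ 2 ∂M.prior ≤ ENNReal.ofReal E) {η : ℝ} (hη : 0 < η) (n K : ℕ) :
    ∑ k ∈ Finset.range K, ∫⁻ p, M.loss p.1 (p.2 (Fin.last k)).1 (p.2 (Fin.last k)).2
        ∂(M.runLaw π (n + 1) (k + 1)) ≤
      ENNReal.ofReal (M.lossBound κ E η n K) := by
  have hl : 0 ≤ Real.log expSqMoment := Real.log_nonneg one_le_expSqMoment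
  have h1 := sum_lintegral_sumVarr_le π hr hE0 (dotProduct_covr_le hE hE0) n K
  have h2 := sum_lintegral_sumVarf_le π hf hκ0 hκ n K
  have l1 : 0 ≤ Real.log (1 + K * ((n + 1 : ℕ) * E * ((M.σr : ℝ) ^ 2)⁻¹)) :=
    Real.log_nonneg (le_add_of_nonneg_right (by positivity))
  have l2 : 0 ≤ Real.log (1 + K * ((n + 1 : ℕ) * κ * ((M.σf : ℝ) ^ 2)⁻¹)) :=
    Real.log_nonneg (le_add_of_nonneg_right (by positivity))
  refine (Finset.sum_le_sum fun k _ => lintegral_loss_le π hr hf hE hη n k).trans ?_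
  simp only [Finset.sum_add_distrib, ← Finset.mul_sum, Finset.sum_const, Finset.card_range]
  refine (add_le_add (add_le_add le_rfl (mul_le_mul_right h1 _))
    (mul_le_mul_right (add_le_add le_rfl (mul_le_mul_right h2 _)) _)).trans_eq ?_
  simp only [nsmul_eq_mul, ← ENNReal.ofReal_natCast]
  rw [lossBound, ENNReal.ofReal_add (by positivity) (by positivity),
    ENNReal.ofReal_add (by positivity) (by positivity),
    ENNReal.ofReal_mul (p := 2 * (n + 1 : ℕ) / M.σf) (by positivity),
    ENNReal.ofReal_add (p := K * ((n + 1 : ℕ) *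
      (η * (32 * (2 + dφ + dψ * Real.log expSqMoment) * E)))) (by positivity) (by positivity)]
  simp only [ENNReal.ofReal_mul (p := (K : ℝ)) (Nat.cast_nonneg _),
    ENNReal.ofReal_mul (p := ((n + 1 : ℕ) : ℝ)) (Nat.cast_nonneg _),
    ENNReal.ofReal_mul (p := η) hη.le,
    ENNReal.ofReal_mul (p := 1 / (2 * η)) (by positivity)]
  ring

end FeatureModel

end PSRL

end

noncomputable section

namespace PSRL

variable {S A : Type} [MeasurableSpace S] [MeasurableSpace A]

namespace FeatureModel

variable {dφ dφ' dψ : ℕ} {M : FeatureModel S A dφ dφ' dψ} (π : Planner S A dφ dφ' dψ)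

/-! ### Regret of a run -/

/-- Regret of the last episode of a run. -/
lemma ae_episodeRegret_eq {E : ℝ} (hE : ∫⁻ w, M.rewSup w.1 ^ 2 ∂M.prior ≤ ENNReal.ofReal E)
    (H k : ℕ) : ∀ᵐ p ∂(M.runLaw π H (k + 1)),
      M.episodeRegret π H p.1 (p.2 (Fin.last k)).1 =
        M.totalReward π H p.1 p.1 - M.totalReward π H p.1 (p.2 (Fin.last k)).1 := by
  filter_upwards [ae_fst_rewSup_ne_top π hE H (k + 1)] with p hp
  exact M.episodeRegret_eq π (M.abs_meanReward_le hp) _ H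

lemma lintegral_rewSup_le {E : ℝ} (hE0 : 0 ≤ E)
    (hE : ∫⁻ w, M.rewSup w.1 ^ 2 ∂M.prior ≤ ENNReal.ofReal E) :
    ∫⁻ w, M.rewSup w.1 ∂M.prior ≤ ENNReal.ofReal (1 + E) := by
  rw [ENNReal.ofReal_add zero_le_one hE0, ENNReal.ofReal_one]
  calc _ ≤ ∫⁻ w, (1 + M.rewSup w.1 ^ 2) ∂M.prior := by
        refine lintegral_mono fun w => ?_
        rcases le_total (M.rewSup w.1) 1 with h | h
        · exact h.trans le_self_add
        · exact (le_self_pow₀ h two_ne_zero).trans le_add_self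
    _ = 1 + ∫⁻ w, M.rewSup w.1 ^ 2 ∂M.prior := by
        rw [lintegral_add_left measurable_const]; simp
    _ ≤ _ := by gcongr

lemma integrable_toReal_rewSup {E : ℝ} (hE0 : 0 ≤ E)
    (hE : ∫⁻ w, M.rewSup w.1 ^ 2 ∂M.prior ≤ ENNReal.ofReal E) :
    Integrable (fun w => (M.rewSup w.1).toReal) M.prior :=
  integrable_toReal_of_lintegral_ne_top (M.measurable_rewSup.comp measurable_fst).aemeasurable
    ((lintegral_rewSup_le hE0 hE).trans_lt ENNReal.ofReal_lt_top).ne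

lemma integral_toReal_rewSup_le {E : ℝ} (hE0 : 0 ≤ E)
    (hE : ∫⁻ w, M.rewSup w.1 ^ 2 ∂M.prior ≤ ENNReal.ofReal E) :
    ∫ w, (M.rewSup w.1).toReal ∂M.prior ≤ 1 + E := by
  rw [integral_toReal (f := fun w : Weights dφ dφ' dψ => M.rewSup w.1)
    (M.measurable_rewSup.comp measurable_fst).aemeasurable
    ((ae_rewSup_ne_top hE).mono fun w hw => hw.lt_top)]
  exact ENNReal.toReal_le_of_le_ofReal (by positivity) (lintegral_rewSup_le hE0 hE)

/-- The total reward in a model is at most `H` times the supremum of its mean rewards under any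
policy, so only the law of `w` matters and `w'` may depend on it in any measurable way. -/
lemma integrable_totalReward {E : ℝ} (hE0 : 0 ≤ E)
    (hE : ∫⁻ w, M.rewSup w.1 ^ 2 ∂M.prior ≤ ENNReal.ofReal E) (H : ℕ)
    {X : Type*} [MeasurableSpace X] {μ : Measure X} {w w' : X → Weights dφ dφ' dψ}
    (hw : Measurable w) (hw' : Measurable w') (hμ : μ.map w = M.prior) :
    Integrable (fun x => M.totalReward π H (w x) (w' x)) μ ∧
      |∫ x, M.totalReward π H (w x) (w' x) ∂μ| ≤ H * (1 + E) := by
  have hR := integrable_toReal_rewSup hE0 hE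
  have hae : ∀ᵐ x ∂μ, M.rewSup (w x).1 ≠ ∞ :=
    ae_of_ae_map hw.aemeasurable (by rw [hμ]; exact ae_rewSup_ne_top hE)
  have hRm : AEStronglyMeasurable (fun w => (M.rewSup w.1).toReal) (μ.map w) := by
    rw [hμ]; exact hR.aestronglyMeasurable
  have hR' : Integrable (fun x => H * (M.rewSup (w x).1).toReal) μ := by
    refine Integrable.const_mul ?_ _
    rw [← hμ] at hR
    exact (integrable_map_measure hRm hw.aemeasurable).1 hR
  have hle : ∀ᵐ x ∂μ, ‖M.totalReward π H (w x) (w' x)‖ ≤ H * (M.rewSup (w x).1).toReal :=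
    hae.mono fun x hx => M.abs_totalReward_le π (M.abs_meanReward_le hx) _ H
  refine ⟨hR'.mono' ((M.measurable_totalReward π H).comp
    (hw.prodMk hw')).aestronglyMeasurable hle, ?_⟩
  refine (norm_integral_le_of_norm_le hR' hle).trans ?_
  rw [integral_const_mul, ← integral_map (φ := w) (f := fun w => (M.rewSup w.1).toReal)
    hw.aemeasurable hRm, hμ]
  exact mul_le_mul_of_nonneg_left (integral_toReal_rewSup_le hE0 hE) (Nat.cast_nonneg _)

lemma measurable_last (H k : ℕ) :
    Measurable fun p : Weights dφ dφ' dψ × Run S A dφ dφ' dψ H (k + 1) =>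
      (p.2 (Fin.last k)).1 := by fun_prop

lemma integrable_episodeRegret {E : ℝ} (hE0 : 0 ≤ E)
    (hE : ∫⁻ w, M.rewSup w.1 ^ 2 ∂M.prior ≤ ENNReal.ofReal E) (H k : ℕ) :
    Integrable (fun p => M.episodeRegret π H p.1 (p.2 (Fin.last k)).1) (M.runLaw π H (k + 1)) := by
  have h1 := (integrable_totalReward π hE0 hE H (μ := M.runLaw π H (k + 1))
    measurable_fst measurable_fst (M.map_fst_runLaw π H (k + 1))).1
  have h2 := (integrable_totalReward π hE0 hE H (μ := M.runLaw π H (k + 1))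
    measurable_fst (measurable_last H k) (M.map_fst_runLaw π H (k + 1))).1
  exact (h1.sub h2).congr ((ae_episodeRegret_eq π hE H k).mono fun p hp => hp.symm)

/-- As true and sampled weights have the same law, the expected regret is a value difference of
one policy in two models. -/
lemma integral_episodeRegret_eq {E : ℝ} (hE0 : 0 ≤ E)
    (hE : ∫⁻ w, M.rewSup w.1 ^ 2 ∂M.prior ≤ ENNReal.ofReal E) (H k : ℕ) :
    ∫ p, M.episodeRegret π H p.1 (p.2 (Fin.last k)).1 ∂(M.runLaw π H (k + 1)) =
      ∫ p, (M.totalReward π H (p.2 (Fin.last k)).1 (p.2 (Fin.last k)).1 -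
        M.totalReward π H p.1 (p.2 (Fin.last k)).1) ∂(M.runLaw π H (k + 1)) := by
  have hl := M.map_last_runLaw π H k
  have h1 := (integrable_totalReward π hE0 hE H (μ := M.runLaw π H (k + 1))
    measurable_fst measurable_fst (M.map_fst_runLaw π H (k + 1))).1
  have h2 := (integrable_totalReward π hE0 hE H (μ := M.runLaw π H (k + 1))
    measurable_fst (measurable_last H k) (M.map_fst_runLaw π H (k + 1))).1
  have h3 := (integrable_totalReward π hE0 hE H (μ := M.runLaw π H (k + 1))
    (measurable_last H k) (measurable_last H k) hl).1
  have hm : Measurable fun w => M.totalReward π H w w :=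
    (M.measurable_totalReward π H).comp (measurable_id.prodMk measurable_id)
  rw [integral_congr_ae (ae_episodeRegret_eq π hE H k), integral_sub h1 h2, integral_sub h3 h2]
  congr 1
  rw [← integral_map (φ := Prod.fst) (f := fun w => M.totalReward π H w w)
    measurable_fst.aemeasurable hm.aestronglyMeasurable, M.map_fst_runLaw π H (k + 1), ← hl,
    integral_map (measurable_last H k).aemeasurable hm.aestronglyMeasurable]

lemma enorm_integral_episodeRegret_le (hf : M.σf ≠ 0) {E : ℝ} (hE0 : 0 ≤ E)
    (hE : ∫⁻ w, M.rewSup w.1 ^ 2 ∂M.prior ≤ ENNReal.ofReal E) (n k : ℕ) :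
    ‖∫ p, M.episodeRegret π (n + 1) p.1 (p.2 (Fin.last k)).1 ∂(M.runLaw π (n + 1) (k + 1))‖ₑ ≤
      ∫⁻ p, M.loss p.1 (p.2 (Fin.last k)).1 (p.2 (Fin.last k)).2
        ∂(M.runLaw π (n + 1) (k + 1)) := by
  rw [integral_episodeRegret_eq π hE0 hE]
  refine (enorm_integral_le_lintegral_enorm _).trans ?_
  refine (lintegral_mono_ae (g := fun p => ∫⁻ e, M.loss p.1 (p.2 (Fin.last k)).1 e
    ∂(M.episodeKernel π (n + 1) (p.1, (p.2 (Fin.last k)).1))) ?_).trans_eq ?_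
  · filter_upwards [ae_fst_rewSup_ne_top π hE (n + 1) (k + 1),
      ae_last_rewSup_ne_top π hE (n + 1) k] with p h1 h2
    exact enorm_totalReward_sub_le_lintegral_loss π hf h1 h2 n
  · have m1 : Measurable fun p : Weights dφ dφ' dψ × Run S A dφ dφ' dψ (n + 1) (k + 1) =>
        M.loss p.1 (p.2 (Fin.last k)).1 (p.2 (Fin.last k)).2 :=
      M.measurable_loss (by fun_prop) (by fun_prop) (by fun_prop)
    have m2 : Measurable fun p : Weights dφ dφ' dψ × Run S A dφ dφ' dψ (n + 1) (k + 1) =>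
        ∫⁻ e, M.loss p.1 (p.2 (Fin.last k)).1 e
          ∂(M.episodeKernel π (n + 1) (p.1, (p.2 (Fin.last k)).1)) :=
      M.measurable_lintegral_episode π (n + 1) (by fun_prop) (by fun_prop)
        (f := fun q : (Weights dφ dφ' dψ × Run S A dφ dφ' dψ (n + 1) (k + 1)) ×
          Episode S A (n + 1) => M.loss q.1.1 (q.1.2 (Fin.last k)).1 q.2)
        (M.measurable_loss (by fun_prop) (by fun_prop) (by fun_prop))
    -- The last stage of the run law draws the episode from `episodeKernel` given both weights;
    -- averaging the loss over a fresh episode therefore changes nothing.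
    rw [lintegral_runLaw_succ _ _ _ _ m1, lintegral_runLaw_succ _ _ _ _ m2]
    simp

lemma regret_succ (H k : ℕ) (p : Weights dφ dφ' dψ × Run S A dφ dφ' dψ H (k + 1)) :
    M.regret π H (k + 1) p = M.regret π H k (p.1, Fin.init p.2) +
      M.episodeRegret π H p.1 (p.2 (Fin.last k)).1 := by
  rw [regret, Fin.sum_univ_castSucc]
  rfl

lemma integrable_regret {E : ℝ} (hE0 : 0 ≤ E)
    (hE : ∫⁻ w, M.rewSup w.1 ^ 2 ∂M.prior ≤ ENNReal.ofReal E) (H K : ℕ) :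
    Integrable (M.regret π H K) (M.runLaw π H K) ∧
      ∫ p, M.regret π H K p ∂(M.runLaw π H K) = ∑ k ∈ Finset.range K,
        ∫ p, M.episodeRegret π H p.1 (p.2 (Fin.last k)).1 ∂(M.runLaw π H (k + 1)) := by
  induction K with
  | zero => 
    have : M.regret π H 0 = fun _ => 0 := by funext p; simp [regret]
    rw [this]
    simp
  | succ k ih =>
    have hm : Measurable fun p : Weights dφ dφ' dψ × Run S A dφ dφ' dψ H (k + 1) =>
        (p.1, (Fin.init p.2 : Run S A dφ dφ' dψ H k)) :=
      measurable_fst.prodMk ((measurable_init k).comp measurable_snd)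
    have hmap := M.map_init_runLaw π H k
    have h1 := ih.1
    rw [← hmap] at h1
    have h2 := (integrable_map_measure h1.aestronglyMeasurable hm.aemeasurable).1 h1
    have h3 := integrable_episodeRegret π hE0 hE H k
    have h4 : M.regret π H (k + 1) = fun p => M.regret π H k (p.1, Fin.init p.2) +
      M.episodeRegret π H p.1 (p.2 (Fin.last k)).1 := funext fun p => regret_succ π H k p
    rw [h4]
    refine ⟨h2.add h3, ?_⟩
    rw [Finset.sum_range_succ, ← ih.2]
    refine (integral_add h2 h3).trans ?_
    congr 1
    have h5 := integral_map hm.aemeasurable h1.aestronglyMeasurable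
    rw [hmap] at h5
    exact h5.symm

lemma abs_integral_regret_le_lossBound (hr : M.σr ≠ 0) (hf : M.σf ≠ 0) {κ E : ℝ} (hκ0 : 0 ≤ κ)
    (hE0 : 0 ≤ E) (hκ : ∀ h, (M.φf h).ofLp ⬝ᵥ M.covf.mulVec (M.φf h).ofLp ≤ κ)
    (hE : ∫⁻ w, M.rewSup w.1 ^ 2 ∂M.prior ≤ ENNReal.ofReal E) {η : ℝ} (hη : 0 < η) (n K : ℕ)
    (hB : 0 ≤ M.lossBound κ E η n K) :
    |∫ p, M.regret π (n + 1) K p ∂(M.runLaw π (n + 1) K)| ≤ M.lossBound κ E η n K := by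
  rw [(integrable_regret π hE0 hE (n + 1) K).2, ← ENNReal.ofReal_le_ofReal_iff hB,
    ← Real.enorm_eq_ofReal_abs]
  refine (enorm_sum_le _ _).trans ?_
  exact (Finset.sum_le_sum fun k _ => enorm_integral_episodeRegret_le π hf hE0 hE n k).trans
    (sum_lintegral_loss_le π hr hf hκ0 hE0 hκ hE hη n K)

/-- Needed when `T < H`: there is then at most one episode, and `√K H²` need not be of the order of
`H^(3/2) √T`. -/
lemma abs_integral_regret_le_trivial {E : ℝ} (hE0 : 0 ≤ E)
    (hE : ∫⁻ w, M.rewSup w.1 ^ 2 ∂M.prior ≤ ENNReal.ofReal E) (H K : ℕ) :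
    |∫ p, M.regret π H K p ∂(M.runLaw π H K)| ≤ K * (2 * H * (1 + E)) := by
  rw [(integrable_regret π hE0 hE H K).2]
  refine (Finset.abs_sum_le_sum_abs _ _).trans ?_
  refine (Finset.sum_le_card_nsmul _ _ (2 * H * (1 + E)) fun k _ => ?_).trans_eq (by simp)
  obtain ⟨h1, b1⟩ := integrable_totalReward π hE0 hE H (μ := M.runLaw π H (k + 1))
    measurable_fst measurable_fst (M.map_fst_runLaw π H (k + 1))
  obtain ⟨h2, b2⟩ := integrable_totalReward π hE0 hE H (μ := M.runLaw π H (k + 1))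
    measurable_fst (measurable_last H k) (M.map_fst_runLaw π H (k + 1))
  rw [integral_congr_ae (ae_episodeRegret_eq π hE H k), integral_sub h1 h2]
  refine (abs_sub _ _).trans ?_
  linarith

end FeatureModel

end PSRL

end

/-! ### Choice of `η` and the final rate -/

noncomputable section

namespace PSRL

lemma log_one_add_mul_le {T x y : ℝ} (hT : 1 ≤ T) (hx : 0 ≤ x) (hy : 0 ≤ y) (h : x ≤ T * y) :
    Real.log (1 + x) ≤ (1 + Real.log (1 + y)) * (1 + Real.log T) := by
  have h1 : 0 ≤ Real.log T := Real.log_nonneg hT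
  have h2 : 0 ≤ Real.log (1 + y) := Real.log_nonneg (by linarith)
  calc Real.log (1 + x) ≤ Real.log ((1 + y) * T) := Real.log_le_log (by linarith) (by nlinarith)
    _ = Real.log (1 + y) + Real.log T := Real.log_mul (by positivity) (by positivity)
    _ ≤ _ := by nlinarith

/-- Rounding up adds less than one episode, hence less than `H ≤ T` steps. -/
lemma numEpisodes_mul_le {T H : ℕ} (hH : 1 ≤ H) (hTH : H ≤ T) :
    (numEpisodes T H : ℝ) * H ≤ 2 * T := by
  have hH' : (0 : ℝ) < H := by exact_mod_cast hH
  have h1 : (H : ℝ) ≤ T := by exact_mod_cast hTH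
  have h2 : (numEpisodes T H : ℝ) < T / H + 1 := Nat.ceil_lt_add_one (by positivity)
  have h3 : (T : ℝ) / H * H = T := div_mul_cancel₀ _ hH'.ne'
  nlinarith

lemma numEpisodes_le_one {T H : ℕ} (hTH : T < H) : numEpisodes T H ≤ 1 := by
  have h1 : (T : ℝ) < H := by exact_mod_cast hTH
  refine Nat.ceil_le.2 ?_
  rw [Nat.cast_one, div_le_one ((Nat.cast_nonneg T).trans_lt h1)]
  exact h1.le

lemma one_le_numEpisodes {T H : ℕ} (hT : 1 ≤ T) (hH : 1 ≤ H) : 1 ≤ numEpisodes T H := by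
  have h1 : (0 : ℝ) < T := by exact_mod_cast hT
  have h2 : (0 : ℝ) < H := by exact_mod_cast hH
  exact Nat.ceil_pos.2 (by positivity)

/-- The constant of the bound for long runs. -/
def longConst (E κ c σr σf : ℝ) : ℝ :=
  32 * (2 + c + Real.log expSqMoment) +
  1 / 2 * σr ^ 2 * ((1 + E * (σr ^ 2)⁻¹) * (c * (1 + Real.log (1 + 2 * (E * (σr ^ 2)⁻¹))))) +
  2 / σf * (32 * (3 + c * Real.log expSqMoment) * E) +
  1 / σf * σf ^ 2 * ((1 + κ * (σf ^ 2)⁻¹) * (1 + Real.log (1 + 2 * (κ * (σf ^ 2)⁻¹))))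

lemma longConst_nonneg {E κ c σr σf : ℝ} (hE : 0 ≤ E) (hκ : 0 ≤ κ) (hc : 0 ≤ c) (hσr : 0 < σr)
    (hσf : 0 < σf) : 0 ≤ longConst E κ c σr σf := by
  have hl : 0 ≤ Real.log expSqMoment := Real.log_nonneg one_le_expSqMoment
  have l1 : 0 ≤ Real.log (1 + 2 * (E * (σr ^ 2)⁻¹)) :=
    Real.log_nonneg (le_add_of_nonneg_right (by positivity))
  have l2 : 0 ≤ Real.log (1 + 2 * (κ * (σf ^ 2)⁻¹)) :=
    Real.log_nonneg (le_add_of_nonneg_right (by positivity))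
  unfold longConst
  positivity

lemma deviation_term_le {s d l C y : ℝ} (hs : 0 ≤ s) (hd : 1 ≤ d) (hl : 1 ≤ l)
    (hC : 0 ≤ C) (hy : y ≤ C * d) : s * y ≤ C * (s * d * l) := by
  have hd0 : 0 ≤ d := by linarith
  calc s * y ≤ s * (C * d) := by gcongr
    _ = C * (s * d * 1) := by ring
    _ ≤ C * (s * d * l) := by gcongr

lemma potential_term_le {s N x m b l d' c d : ℝ} (hs : 0 ≤ s) (hN : 1 ≤ N) (hx : 0 ≤ x)
    (hm : 0 ≤ m) (hml : m ≤ b * l) (hd'0 : 0 ≤ d') (hd' : d' ≤ c * d) :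
    s * ((1 + N * x) * (d' * m)) ≤ (1 + x) * (c * b) * (s * N * d * l) := by
  have hN0 : 0 ≤ N := by linarith
  have h1 : 1 + N * x ≤ N * (1 + x) := by linarith
  have h2 : 0 ≤ c * d := hd'0.trans hd'
  calc s * ((1 + N * x) * (d' * m)) ≤ s * ((N * (1 + x)) * ((c * d) * (b * l))) := by gcongr
    _ = _ := by ring

variable {S A : Type} [MeasurableSpace S] [MeasurableSpace A]

namespace FeatureModel

variable {dφ dφ' dψ : ℕ} {M : FeatureModel S A dφ dφ' dψ} (π : Planner S A dφ dφ' dψ)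

/-- With `η = 1 / √K`, both `K η` and `1 / η` equal `√K`. Deviations contribute `√K N dφ` for
rewards and `√K N² dφ` for transitions, variances the same with a logarithm, where `N = n + 1`; in
the transition terms one factor `N` is the size of the values. -/
lemma lossBound_le {E κ c : ℝ} (hE : 0 ≤ E) (hκ : 0 ≤ κ) (hc : 0 ≤ c) (hr : M.σr ≠ 0)
    (hf : M.σf ≠ 0) (hd : 1 ≤ dφ) (hd' : (dφ' : ℝ) ≤ c * dφ) (hψ : (dψ : ℝ) ≤ c * dφ)
    {n K : ℕ} {T : ℝ} (hT : 1 ≤ T) (hK : 1 ≤ K) (hKT : (K : ℝ) * (n + 1 : ℕ) ≤ 2 * T) :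
    0 ≤ M.lossBound κ E (1 / Real.sqrt K) n K ∧
    M.lossBound κ E (1 / Real.sqrt K) n K ≤ longConst E κ c M.σr M.σf *
      (Real.sqrt K * ((n + 1 : ℕ) : ℝ) ^ 2 * dφ * (1 + Real.log T)) := by
  have hσr : (0 : ℝ) < M.σr := by positivity
  have hσf : (0 : ℝ) < M.σf := by positivity
  unfold lossBound longConst
  generalize (M.σr : ℝ) = σr at *
  generalize (M.σf : ℝ) = σf at *
  have hN : (1 : ℝ) ≤ (n + 1 : ℕ) := by exact_mod_cast Nat.le_add_left 1 n
  generalize ((n + 1 : ℕ) : ℝ) = N at *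
  have hd1 : (1 : ℝ) ≤ dφ := by exact_mod_cast hd
  have hd'0 : (0 : ℝ) ≤ dφ' := Nat.cast_nonneg _
  have hψ0 : (0 : ℝ) ≤ dψ := Nat.cast_nonneg _
  generalize (dφ : ℝ) = d at *
  generalize (dφ' : ℝ) = d' at *
  generalize (dψ : ℝ) = e at *
  have hL : 0 ≤ Real.log expSqMoment := Real.log_nonneg one_le_expSqMoment
  generalize Real.log expSqMoment = L at *
  have hK0 : (0 : ℝ) < K := by exact_mod_cast hK
  generalize (K : ℝ) = k at *
  have g (x : ℝ) (hx : 0 ≤ x) : 0 ≤ Real.log (1 + k * (N * x)) ∧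
      Real.log (1 + k * (N * x)) ≤ (1 + Real.log (1 + 2 * x)) * (1 + Real.log T) :=
    ⟨Real.log_nonneg (le_add_of_nonneg_right (by positivity)),
      log_one_add_mul_le hT (by positivity) (by positivity) (by nlinarith)⟩
  have hx1 : 0 ≤ E * (σr ^ 2)⁻¹ := by positivity
  have hx2 : 0 ≤ κ * (σf ^ 2)⁻¹ := by positivity
  obtain ⟨a1, a2⟩ := g _ hx1
  obtain ⟨b1, b2⟩ := g _ hx2
  simp only [mul_assoc N E, mul_assoc N κ]
  generalize E * (σr ^ 2)⁻¹ = x at *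
  generalize κ * (σf ^ 2)⁻¹ = z at *
  have hlT : 0 ≤ Real.log T := Real.log_nonneg hT
  have hlx : 0 ≤ Real.log (1 + 2 * x) := Real.log_nonneg (by linarith)
  have hlz : 0 ≤ Real.log (1 + 2 * z) := Real.log_nonneg (by linarith)
  have hl1 : 1 ≤ 1 + Real.log T := by linarith
  generalize 1 + Real.log T = l at *
  generalize Real.log (1 + 2 * x) = lx at *
  generalize Real.log (1 + 2 * z) = lz at *
  generalize Real.log (1 + k * (N * x)) = mx at *
  generalize Real.log (1 + k * (N * z)) = mz at *
  have hs : 0 < Real.sqrt k := Real.sqrt_pos.2 hK0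
  have hkk : k = Real.sqrt k * Real.sqrt k := (Real.mul_self_sqrt hK0.le).symm
  generalize Real.sqrt k = s at *
  subst hkk
  have hd0 : 0 < d := by linarith
  have hN0 : 0 < N := by linarith
  have hdl : d ≤ d * l := le_mul_of_one_le_right hd0.le hl1
  have h1dl : 1 ≤ d * l := hd1.trans hdl
  have hNN : N ≤ N ^ 2 := by nlinarith
  refine ⟨by positivity, ?_⟩
  have t1 := deviation_term_le (by positivity : 0 ≤ s * N ^ 2) hd1 hl1 (add_nonneg (add_nonneg two_pos.le hc) hL)
    (show 2 + d' + L ≤ (2 + c + L) * d by nlinarith)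
  have t3 := deviation_term_le (by positivity : 0 ≤ 2 / σf * E * (s * N ^ 2)) hd1 hl1
    (add_nonneg three_pos.le (mul_nonneg hc hL))
    (show 2 + d + e * L ≤ (3 + c * L) * d by nlinarith [mul_le_mul_of_nonneg_right hψ hL])
  have t2 := potential_term_le (by positivity : 0 ≤ 1 / 2 * σr ^ 2 * (N * s)) hN hx1 a1 a2
    hd'0 hd'
  have t4 := potential_term_le (by positivity : 0 ≤ 1 / σf * σf ^ 2 * (N * s)) hN hx2 b1 b2
    hd0.le (one_mul d).ge
  have t2' : 1 / 2 * σr ^ 2 * s * ((1 + N * x) * (d' * mx)) ≤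
      1 / 2 * σr ^ 2 * (N * s) * ((1 + N * x) * (d' * mx)) := by
    gcongr
    exact le_mul_of_one_le_left hs.le hN
  have t1' : s * N * (2 + d' + L) ≤ s * N ^ 2 * (2 + d' + L) := by gcongr
  have e1 : s * s * (N * (1 / s * (32 * (2 + d' + L)))) = 32 * (s * N * (2 + d' + L)) := by
    field_simp
  have e2 : 1 / (2 * (1 / s)) = s / 2 := by field_simp
  have e3 : 2 * N / σf * (s * s * (N * (1 / s * (32 * (2 + d + e * L) * E)))) =
      32 * (2 / σf * E * (s * N ^ 2) * (2 + d + e * L)) := by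
    field_simp
  have e4 : 2 * N / σf * (s / 2 * (σf ^ 2 * ((1 + N * z) * (d * mz)))) =
      1 / σf * σf ^ 2 * (N * s) * ((1 + N * z) * (d * mz)) := by
    field_simp
  rw [mul_add (2 * N / σf), e1, e2, e3, e4]
  linarith

/-- For the degenerate case `dφ = 0`, where the right side of the regret bound is zero and the
dimension condition forces `dφ' = 0`. -/
lemma regret_eq_zero (M : FeatureModel S A dφ 0 dψ) (π : Planner S A dφ 0 dψ) (H K : ℕ) :
    M.regret π H K = fun _ => 0 := by
  have h (w : Weights dφ 0 dψ) (h : S × A) : (M.mdp w).rew h = 0 := by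
    simp [mdp, meanReward, Subsingleton.elim w.1 0]
  funext p
  simp [regret, episodeRegret, MDP.value, h]

/-- The Bayesian regret of posterior sampling, when the transition features have dimension at
least one. -/
lemma bayesRegret_le {E κ c : ℝ} (hE0 : 0 ≤ E) (hκ0 : 0 ≤ κ) (hc : 0 ≤ c) (hr : M.σr ≠ 0)
    (hf : M.σf ≠ 0) (hd : 1 ≤ dφ) (hd' : (dφ' : ℝ) ≤ c * dφ) (hψ : (dψ : ℝ) ≤ c * dφ)
    (hκ : ∀ h, (M.φf h).ofLp ⬝ᵥ M.covf.mulVec (M.φf h).ofLp ≤ κ)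
    (hE : ∫⁻ w, M.rewSup w.1 ^ 2 ∂M.prior ≤ ENNReal.ofReal E) {H T : ℕ} (hH : 1 ≤ H) (hT : 1 ≤ T) :
    M.bayesRegret π H T ≤
      (Real.sqrt 2 * longConst E κ c M.σr M.σf + 2 * (1 + E)) * (H : ℝ) ^ (3 / 2 : ℝ) * dφ *
        Real.sqrt T * (1 + Real.log T) := by
  have hC := longConst_nonneg hE0 hκ0 hc (σr := M.σr) (σf := M.σf) (by positivity) (by positivity)
  have hH1 : (1 : ℝ) ≤ H := by exact_mod_cast hH
  have hT1 : (1 : ℝ) ≤ T := by exact_mod_cast hT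
  have hd1 : (1 : ℝ) ≤ dφ := by exact_mod_cast hd
  have hl : 0 ≤ Real.log T := Real.log_nonneg hT1
  have hpow : (H : ℝ) ^ (3 / 2 : ℝ) = H * Real.sqrt H := by
    rw [show (3 / 2 : ℝ) = 1 + 1 / 2 by norm_num, Real.rpow_add (by positivity), Real.rpow_one,
      Real.sqrt_eq_rpow]
  rw [hpow]
  have hsH : 1 ≤ Real.sqrt H := Real.one_le_sqrt.2 hH1
  have hsT : 1 ≤ Real.sqrt T := Real.one_le_sqrt.2 hT1
  refine (le_abs_self _).trans ?_
  rw [bayesRegret]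
  rcases lt_or_ge T H with hTH | hTH
  · refine (abs_integral_regret_le_trivial π hE0 hE H _).trans ?_
    have hK : (numEpisodes T H : ℝ) ≤ 1 := by exact_mod_cast numEpisodes_le_one hTH
    calc (numEpisodes T H : ℝ) * (2 * H * (1 + E)) ≤ 1 * (2 * H * (1 + E)) := by gcongr
      _ = (0 + 2 * (1 + E)) * (H * 1) * 1 * 1 * (1 + 0) := by ring
      _ ≤ _ := by gcongr; positivity
  · obtain ⟨n, rfl⟩ : ∃ n, H = n + 1 := ⟨H - 1, by omega⟩
    have hK := one_le_numEpisodes hT hH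
    have hKT := numEpisodes_mul_le hH hTH
    obtain ⟨h1, h2⟩ := lossBound_le (M := M) hE0 hκ0 hc hr hf hd hd' hψ hT1 hK hKT
    have hK0 : (0 : ℝ) < numEpisodes T (n + 1) := by exact_mod_cast hK
    refine (abs_integral_regret_le_lossBound π hr hf hκ0 hE0 hκ hE
      (by positivity : 0 < 1 / Real.sqrt (numEpisodes T (n + 1))) n _ h1).trans (h2.trans ?_)
    -- From `K N ≤ 2T`: writing `√K N² = √(K N) · N^(3/2)` gives the rate `√(2T) N^(3/2)`.
    have h3 : Real.sqrt (numEpisodes T (n + 1)) * ((n + 1 : ℕ) : ℝ) ^ 2 ≤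
        Real.sqrt 2 * Real.sqrt T * ((n + 1 : ℕ) * Real.sqrt (n + 1 : ℕ)) := by
      have h4 := Real.sqrt_le_sqrt hKT
      rw [Real.sqrt_mul hK0.le, Real.sqrt_mul two_pos.le] at h4
      have h5 := Real.mul_self_sqrt (Nat.cast_nonneg (α := ℝ) (n + 1))
      calc _ = Real.sqrt (numEpisodes T (n + 1)) * Real.sqrt (n + 1 : ℕ) *
            ((n + 1 : ℕ) * Real.sqrt (n + 1 : ℕ)) := by
              linear_combination (-(Real.sqrt (numEpisodes T (n + 1)) * (n + 1 : ℕ))) * h5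
        _ ≤ _ := by gcongr
    calc _ ≤ longConst E κ c M.σr M.σf * (Real.sqrt 2 * Real.sqrt T *
          ((n + 1 : ℕ) * Real.sqrt (n + 1 : ℕ)) * dφ * (1 + Real.log T)) := by gcongr
      _ = (Real.sqrt 2 * longConst E κ c M.σr M.σf + 0) * ((n + 1 : ℕ) * Real.sqrt (n + 1 : ℕ)) *
          dφ * Real.sqrt T * (1 + Real.log T) := by ring
      _ ≤ _ := by gcongr; positivity

end FeatureModel

end PSRL

end

theorem mainTheorem5 :
    ∃ p : ℕ, ∀ (Rmax κ c : ℝ) (σr σf : ℝ≥0), 0 < σr → 0 < σf →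
      ∃ C : ℝ, ∀ (ds da dφ dφ' dψ H T : ℕ)
        (S : Set (EuclideanSpace ℝ (Fin ds))) (A : Set (EuclideanSpace ℝ (Fin da)))
        (M : PSRL.FeatureModel S A dφ dφ' dψ) (π : PSRL.Planner S A dφ dφ' dψ),
        (dψ : ℝ) ≤ c * dφ → (dφ' : ℝ) ≤ c * dφ → 1 ≤ H → 1 ≤ T →
        M.σr = σr → M.σf = σf →
        (∀ h, (M.φf h).ofLp ⬝ᵥ M.covf.mulVec (M.φf h).ofLp ≤ κ) →
        (∫⁻ w, (⨆ h, ‖(M.mdp w).rew h‖ₑ) ^ 2 ∂M.prior ≤ ENNReal.ofReal (Rmax ^ 2)) →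
        (∀ᵐ w ∂M.prior, (M.mdp w).IsOptimal H (π.policy w)) →
        Integrable (M.regret π H (PSRL.numEpisodes T H))
            (M.runLaw π H (PSRL.numEpisodes T H)) ∧
          M.bayesRegret π H T ≤
            C * (H : ℝ) ^ (3 / 2 : ℝ) * dφ * Real.sqrt T * (1 + Real.log T) ^ p := by
  -- A single logarithm suffices. Absolute values keep the constant nonnegative without sign
  -- conditions on `κ` and `c`.
  refine ⟨1, fun Rmax κ c σr σf hσr hσf => ⟨Real.sqrt 2 *
    PSRL.longConst (Rmax ^ 2) |κ| |c| σr σf + 2 * (1 + Rmax ^ 2), ?_⟩⟩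
  intro ds da dφ dφ' dψ H T S A M π hψ hd' hH hT hr hf hκ hE _
  have hr' : M.σr ≠ 0 := by rw [hr]; exact hσr.ne'
  have hf' : M.σf ≠ 0 := by rw [hf]; exact hσf.ne'
  have hc : c * (dφ : ℝ) ≤ |c| * dφ := by gcongr; exact le_abs_self c
  refine ⟨(PSRL.FeatureModel.integrable_regret π (sq_nonneg Rmax) hE H _).1, ?_⟩
  rw [pow_one]
  rcases Nat.eq_zero_or_pos dφ with h0 | h0
  · have hz : dφ' = 0 := by
      have : (dφ' : ℝ) ≤ 0 := by simpa [h0] using hd'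
      exact_mod_cast le_antisymm this (Nat.cast_nonneg _)
    subst hz
    rw [PSRL.FeatureModel.bayesRegret, PSRL.FeatureModel.regret_eq_zero]
    simp [h0]
  · rw [← hr, ← hf]
    exact PSRL.FeatureModel.bayesRegret_le π (sq_nonneg _) (abs_nonneg _) (abs_nonneg _) hr' hf' h0
      (hd'.trans hc) (hψ.trans hc) (fun h => (hκ h).trans (le_abs_self κ)) hE hH hT
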